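/- Let $(M,g)$ be an oriented spacetime: a smooth four-dimensional manifold with a smooth metric of signature $(-,+,+,+)$ and metric volume form $\eta$. Let $u$ be an observer (a smooth vector field with $g(u,u)=-1$) on $M$. Write $h_{ab}=g_{ab}+u_au_b$, $\varepsilon_{abc}=\eta_{abcd}u^d$, and let $D$ be the spatially projected covariant derivative. Let $W$ be the Weyl tensor and ${*W}_{abcd}=\frac12\eta_{abef}W^{ef}{}_{cd}$. The electric and magnetic Weyl fields are $E_{ac}=W_{abcd}u^bu^d$ and $H_{ac}={*W}_{abcd}u^bu^d$. Let $a_b=u^c\nabla_cu_b$ be the acceleration of $u$, $\sigma_{ab}=D_{(a}u_{b)}-\frac13(\nabla^cu_c)h_{ab}$ its shear, and $\omega_a=-\frac12\varepsilon_a{}^{bc}D_bu_c$ its vorticity vector. For a spatial symmetric tensor put $(\operatorname{curl}S)_{ab}=\varepsilon_{cd(a}D^cS_{b)}{}^d$, and write $(A,B)=A_{ab}B^{ab}$, where $(D\omega)_{ab}=D_a\omega_b$. Suppose that $E=0$ on $M$. (1) If the Cotton tensor $\nabla_aP_{bc}-\nabla_bP_{ac}$, with $P=\frac12(\mathrm{Ric}-\frac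 R6g)$, vanishes on $M$ (for example in vacuum), then everywhere $$\tfrac14\operatorname{Tr}H^2=(H,D\omega+2a\otimes\omega)=\tfrac13(H,\operatorname{curl}\sigma).$$ Consequently, at every point where $H\neq0$, $$(H,\operatorname{curl}\sigma)>0\qquad\text{and}\qquad(H,D\omega+2a\otimes\omega)>0 .$$ In particular, if $\sigma$ vanishes identically or $\omega$ vanishes identically, then $H=0$ on $M$. (2) In particular, if $g$ is a vacuum metric ($\mathrm{Ric}=0$), then there is no point at which $H\ne0$ and at which $(H,\operatorname{curl}\sigma)\le0$ or $(H,D\omega+2a\otimes\omega)\le0$. -/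

import Mathlib

open scoped Manifold ContDiff

noncomputable section

/-- Coordinate space of a four-dimensional manifold. -/
abbrev E4 : Type := EuclideanSpace ℝ (Fin 4)

/-! ### Tensor calculus in a coordinate system

Tensor fields are given by their covariant components, as functions of the coordinates. -/

namespace Coord

/-- Partial derivative `∂_i f`. -/
def pd (i : Fin 4) (f : E4 → ℝ) (x : E4) : ℝ :=
  fderiv ℝ f x (EuclideanSpace.single i 1)

/-- Components `g^{ij}` of the inverse metric. -/
def inv (g : E4 → Fin 4 → Fin 4 → ℝ) (x : E4) (i j : Fin 4) : ℝ :=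
  (Matrix.of (g x))⁻¹ i j

/-- Christoffel symbols `Γ^k_{ij}` of the Levi-Civita connection. -/
def christoffel (g : E4 → Fin 4 → Fin 4 → ℝ) (x : E4) (k i j : Fin 4) : ℝ :=
  ∑ l, inv g x k l / 2 *
    (pd i (fun y => g y j l) x + pd j (fun y => g y i l) x - pd l (fun y => g y i j) x)

/-- Covariant derivative `∇_a v_b` of a covector field. -/
def nabla1 (g : E4 → Fin 4 → Fin 4 → ℝ) (v : E4 → Fin 4 → ℝ) (x : E4) (a b : Fin 4) : ℝ :=
  pd a (fun y => v y b) x - ∑ e, christoffel g x e a b * v x e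

/-- Covariant derivative `∇_c T_{ab}` of a covariant 2-tensor field (indices in order `c a b`). -/
def nabla2 (g : E4 → Fin 4 → Fin 4 → ℝ) (T : E4 → Fin 4 → Fin 4 → ℝ)
    (x : E4) (c a b : Fin 4) : ℝ :=
  pd c (fun y => T y a b) x
    - ∑ e, (christoffel g x e c a * T x e b + christoffel g x e c b * T x a e)

/-- Curvature tensor `R^a_{bcd}`, normalised by `(∇_c ∇_d - ∇_d ∇_c) X^a = R^a_{bcd} X^b`. -/
def riemannUp (g : E4 → Fin 4 → Fin 4 → ℝ) (x : E4) (a b c d : Fin 4) : ℝ :=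
  pd c (fun y => christoffel g y a d b) x - pd d (fun y => christoffel g y a c b) x
    + ∑ e, (christoffel g x a c e * christoffel g x e d b
        - christoffel g x a d e * christoffel g x e c b)

/-- Covariant curvature tensor `R_{abcd}`. -/
def riemann (g : E4 → Fin 4 → Fin 4 → ℝ) (x : E4) (a b c d : Fin 4) : ℝ :=
  ∑ e, g x a e * riemannUp g x e b c d

/-- Ricci tensor `R_{bd} = R^a_{bad}`. -/
def ricci (g : E4 → Fin 4 → Fin 4 → ℝ) (x : E4) (b d : Fin 4) : ℝ :=
  ∑ a, riemannUp g x a b a d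

/-- Scalar curvature. -/
def scalar (g : E4 → Fin 4 → Fin 4 → ℝ) (x : E4) : ℝ :=
  ∑ a, ∑ b, inv g x a b * ricci g x a b

/-- Weyl tensor `W_{abcd}` (dimension four). -/
def weyl (g : E4 → Fin 4 → Fin 4 → ℝ) (x : E4) (a b c d : Fin 4) : ℝ :=
  riemann g x a b c d
    - (g x a c * ricci g x b d - g x a d * ricci g x b c
        - g x b c * ricci g x a d + g x b d * ricci g x a c) / 2
    + scalar g x / 6 * (g x a c * g x b d - g x a d * g x b c)

/-- Schouten tensor `P_{ab}` (dimension four). -/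
def schouten (g : E4 → Fin 4 → Fin 4 → ℝ) (x : E4) (a b : Fin 4) : ℝ :=
  (ricci g x a b - scalar g x / 6 * g x a b) / 2

/-- Cotton tensor `C_{abc} = ∇_a P_{bc} - ∇_b P_{ac}`. -/
def cotton (g : E4 → Fin 4 → Fin 4 → ℝ) (x : E4) (a b c : Fin 4) : ℝ :=
  nabla2 g (schouten g) x a b c - nabla2 g (schouten g) x b a c

/-- Scalar product `(A, B) = A_{ab} B^{ab}` of covariant 2-tensors. -/
def inner2 (g : E4 → Fin 4 → Fin 4 → ℝ) (x : E4) (A B : Fin 4 → Fin 4 → ℝ) : ℝ :=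
  ∑ a, ∑ b, ∑ c, ∑ d, inv g x a c * inv g x b d * A a b * B c d

/-- Trace `Tr A² = A^a_b A^b_a` of the square of the endomorphism `A^a_b` of a covariant 2-tensor. -/
def traceSq (g : E4 → Fin 4 → Fin 4 → ℝ) (x : E4) (A : Fin 4 → Fin 4 → ℝ) : ℝ :=
  ∑ a, ∑ b, (∑ c, inv g x a c * A c b) * (∑ d, inv g x b d * A d a)

end Coord

/-! ### The 1+3 formalism in a coordinate system -/

/-- Components in a coordinate system of a metric `g_{ij}`, of a volume form `η_{ijkl}` and of a
vector field `u^i`. -/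
structure LocalData where
  g : E4 → Fin 4 → Fin 4 → ℝ
  vol : E4 → Fin 4 → Fin 4 → Fin 4 → Fin 4 → ℝ
  u : E4 → Fin 4 → ℝ

namespace LocalData

open Coord

variable (L : LocalData)

/-- The covector `u_a`. -/
def uLow (x : E4) (a : Fin 4) : ℝ := ∑ b, L.g x a b * L.u x b

/-- The spatial metric `h_{ab} = g_{ab} + u_a u_b`. -/
def h (x : E4) (a b : Fin 4) : ℝ := L.g x a b + L.uLow x a * L.uLow x b

/-- The spatial projector `h^a_b = δ^a_b + u^a u_b`. -/
def proj (x : E4) (a b : Fin 4) : ℝ := (if a = b then 1 else 0) + L.u x a * L.uLow x b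

/-- The spatial volume element `ε_{abc} = η_{abcd} u^d`. -/
def eps (x : E4) (a b c : Fin 4) : ℝ := ∑ d, L.vol x a b c d * L.u x d

/-- `ε_a^{bc}`. -/
def epsUp (x : E4) (a b c : Fin 4) : ℝ :=
  ∑ i, ∑ j, inv L.g x b i * inv L.g x c j * L.eps x a i j

/-- Spatial covariant derivative `D_a v_b = h_a^c h_b^d ∇_c v_d`. -/
def D1 (v : E4 → Fin 4 → ℝ) (x : E4) (a b : Fin 4) : ℝ :=
  ∑ c, ∑ d, L.proj x c a * L.proj x d b * nabla1 L.g v x c d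

/-- Spatial covariant derivative `D_c T_{ab} = h_c^f h_a^d h_b^e ∇_f T_{de}`
(indices in order `c a b`). -/
def D2 (T : E4 → Fin 4 → Fin 4 → ℝ) (x : E4) (c a b : Fin 4) : ℝ :=
  ∑ f, ∑ d, ∑ e, L.proj x f c * L.proj x d a * L.proj x e b * nabla2 L.g T x f d e

/-- Spatial curl `(curl S)_{ab} = ε_{cd(a} D^c S_{b)}^d` of a symmetric tensor field. -/
def curl (S : E4 → Fin 4 → Fin 4 → ℝ) (x : E4) (a b : Fin 4) : ℝ :=
  (∑ c, ∑ d, (L.epsUp x a c d * L.D2 S x c b d + L.epsUp x b c d * L.D2 S x c a d)) / 2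

/-- Acceleration `a_b = u^c ∇_c u_b`. -/
def acc (x : E4) (b : Fin 4) : ℝ := ∑ c, L.u x c * nabla1 L.g L.uLow x c b

/-- Expansion `θ = ∇^a u_a`. -/
def expansion (x : E4) : ℝ := ∑ a, ∑ b, inv L.g x a b * nabla1 L.g L.uLow x a b

/-- Shear `σ_{ab} = D_{(a} u_{b)} - (θ/3) h_{ab}`. -/
def shear (x : E4) (a b : Fin 4) : ℝ :=
  (L.D1 L.uLow x a b + L.D1 L.uLow x b a) / 2 - L.expansion x / 3 * L.h x a b

/-- Vorticity vector `ω_a = -(1/2) ε_a^{bc} D_b u_c`, i.e. `D_{[b} u_{a]} = ε_{abc} ω^c`. -/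
def vorticity (x : E4) (a : Fin 4) : ℝ :=
  -(∑ b, ∑ c, L.epsUp x a b c * L.D1 L.uLow x b c) / 2

/-- Electric Weyl field `E_{ac} = W_{abcd} u^b u^d`. -/
def electric (x : E4) (a c : Fin 4) : ℝ :=
  ∑ b, ∑ d, weyl L.g x a b c d * L.u x b * L.u x d

/-- Dual Weyl tensor `*W_{abcd} = (1/2) η_{abef} W^{ef}_{cd}`. -/
def dualWeyl (x : E4) (a b c d : Fin 4) : ℝ :=
  (∑ e, ∑ f, ∑ i, ∑ j,
    L.vol x a b e f * inv L.g x e i * inv L.g x f j * weyl L.g x i j c d) / 2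

/-- Magnetic Weyl field `H_{ac} = *W_{abcd} u^b u^d`. -/
def magnetic (x : E4) (a c : Fin 4) : ℝ :=
  ∑ b, ∑ d, L.dualWeyl x a b c d * L.u x b * L.u x d

/-- The tensor `D_a ω_b + 2 a_a ω_b`. -/
def vorticityTensor (x : E4) (a b : Fin 4) : ℝ :=
  L.D1 L.vorticity x a b + 2 * (L.acc x a * L.vorticity x b)

/-- The scalar `(H, curl σ)`. -/
def magCurlShear (x : E4) : ℝ := inner2 L.g x (L.magnetic x) (L.curl L.shear x)

/-- The scalar `(H, Dω + 2 a ⊗ ω)`. -/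
def magVorticity (x : E4) : ℝ := inner2 L.g x (L.magnetic x) (L.vorticityTensor x)

end LocalData

/-! ### Spacetimes and observers

Since all the objects above are tensorial, a tensor equation on the manifold means that its
components satisfy it at every point of every smooth coordinate system. -/

variable {M : Type*} [TopologicalSpace M] [ChartedSpace E4 M]

/-- The coordinate vector `∂_i` of the chart `e` at the point of coordinates `x`. -/
def coordVec (e : OpenPartialHomeomorph M E4) (x : E4) (i : Fin 4) :
    TangentSpace (𝓡 4) (e.symm x) :=
  mfderiv (𝓡 4) (𝓡 4) e.symm x (EuclideanSpace.single i (1 : ℝ) : E4)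

/-- An oriented spacetime: a smooth Lorentzian metric of signature `(-,+,+,+)` on a smooth
four-dimensional manifold, with the metric volume form of an orientation. -/
structure OrientedSpacetime (M : Type*) [TopologicalSpace M] [ChartedSpace E4 M]
    [IsManifold (𝓡 4) ∞ M] where
  /-- the metric -/
  g (p : M) : TangentSpace (𝓡 4) p →L[ℝ] TangentSpace (𝓡 4) p →L[ℝ] ℝ
  symm (p : M) (v w : TangentSpace (𝓡 4) p) : g p v w = g p w v
  signature (p : M) : ∃ b : Module.Basis (Fin 4) ℝ (TangentSpace (𝓡 4) p),
    ∀ i j, g p (b i) (b j) = if i = j then (if i = 0 then -1 else 1) else 0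
  contMDiff : ContMDiff (𝓡 4) ((𝓡 4).prod 𝓘(ℝ, E4 →L[ℝ] E4 →L[ℝ] ℝ)) ∞
    (fun p => Bundle.TotalSpace.mk' (E4 →L[ℝ] E4 →L[ℝ] ℝ)
      (E := fun p : M => TangentSpace (𝓡 4) p →L[ℝ] TangentSpace (𝓡 4) p →L[ℝ] ℝ) p (g p))
  /-- the volume form -/
  vol (p : M) : TangentSpace (𝓡 4) p [⋀^Fin 4]→ₗ[ℝ] ℝ
  vol_sq (p : M) (v : Fin 4 → TangentSpace (𝓡 4) p) :
    vol p v ^ 2 = -(Matrix.of fun i j => g p (v i) (v j)).det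
  vol_smooth : ∀ e ∈ IsManifold.maximalAtlas (𝓡 4) ∞ M,
    ContDiffOn ℝ ∞ (fun x => vol (e.symm x) (coordVec e x)) e.target

variable [IsManifold (𝓡 4) ∞ M]

namespace OrientedSpacetime

/-- Components of the metric in a chart. -/
def metricComp (S : OrientedSpacetime M) (e : OpenPartialHomeomorph M E4)
    (x : E4) (i j : Fin 4) : ℝ :=
  S.g (e.symm x) (coordVec e x i) (coordVec e x j)

/-- Components of the volume form in a chart. -/
def volComp (S : OrientedSpacetime M) (e : OpenPartialHomeomorph M E4)
    (x : E4) (i j k l : Fin 4) : ℝ :=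
  S.vol (e.symm x) ![coordVec e x i, coordVec e x j, coordVec e x k, coordVec e x l]

/-- The Cotton tensor vanishes. -/
def CottonVanishes (S : OrientedSpacetime M) : Prop :=
  ∀ e ∈ IsManifold.maximalAtlas (𝓡 4) ∞ M, ∀ x ∈ e.target, Coord.cotton (S.metricComp e) x = 0

/-- Vacuum: the Ricci tensor vanishes. -/
def IsVacuum (S : OrientedSpacetime M) : Prop :=
  ∀ e ∈ IsManifold.maximalAtlas (𝓡 4) ∞ M, ∀ x ∈ e.target, Coord.ricci (S.metricComp e) x = 0

end OrientedSpacetime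

/-- An observer: a smooth unit timelike vector field. -/
structure Observer (S : OrientedSpacetime M) where
  u (p : M) : TangentSpace (𝓡 4) p
  unit (p : M) : S.g p (u p) (u p) = -1
  contMDiff : ContMDiff (𝓡 4) (𝓡 4).tangent ∞
    (fun p => (⟨p, u p⟩ : TangentBundle (𝓡 4) M))

namespace Observer

variable {S : OrientedSpacetime M}

/-- The vector of components of the observer in a chart. -/
def comp (O : Observer S) (e : OpenPartialHomeomorph M E4) (x : E4) : E4 :=
  mfderiv (𝓡 4) (𝓡 4) e (e.symm x) (O.u (e.symm x))

/-- Metric, volume form and observer in a chart. -/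
def inChart (O : Observer S) (e : OpenPartialHomeomorph M E4) : LocalData where
  g := S.metricComp e
  vol := S.volComp e
  u x i := O.comp e x i

/-- The electric Weyl field of the observer vanishes. -/
def ElectricVanishes (O : Observer S) : Prop :=
  ∀ e ∈ IsManifold.maximalAtlas (𝓡 4) ∞ M, ∀ x ∈ e.target, (O.inChart e).electric x = 0

/-- The magnetic Weyl field of the observer vanishes. -/
def MagneticVanishes (O : Observer S) : Prop :=
  ∀ e ∈ IsManifold.maximalAtlas (𝓡 4) ∞ M, ∀ x ∈ e.target, (O.inChart e).magnetic x = 0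

/-- The observer is shear-free. -/
def ShearFree (O : Observer S) : Prop :=
  ∀ e ∈ IsManifold.maximalAtlas (𝓡 4) ∞ M, ∀ x ∈ e.target, (O.inChart e).shear x = 0

/-- The observer is vorticity-free. -/
def VorticityFree (O : Observer S) : Prop :=
  ∀ e ∈ IsManifold.maximalAtlas (𝓡 4) ∞ M, ∀ x ∈ e.target, (O.inChart e).vorticity x = 0

end Observer

end

/-! Where E = 0 the Weyl tensor W is determined by H, which is spatial, symmetric and trace-free
(`exists_eq_magneticWeyl`). If the Cotton tensor vanishes, ∇P is totally symmetric, so W inherits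
the second Bianchi identity from the Riemann tensor and, being trace-free, is divergence-free.

Apply ∇^a to W_{abcd}u^b u^d = 0. Since div W = 0, what remains is Z_c = W_{abcd}(u^d ∇^a u^b + u^b
∇^a u^d) = 0 (`weyl_divergence_and_strain`). In 1+3 terms this reads 3 H_{ab}ω^b = ε_{abc} σ^b_d
H^{cd}.

Now take the divergence of Z. The derivative of W drops out again, leaving W contracted with ∇∇u
together with products of ∇u (`weylStrain_divergence`). One of the two second-derivative terms sees
only the antisymmetric part of ∇u and is -2(H, Dω). The other becomes the same after its two
derivatives are exchanged, and the Ricci identity makes that exchange cost exactly Tr H²; the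
Schouten part of the curvature is invisible because H is symmetric. The lower-order terms supply the
acceleration, modulo multiples of Z, and the outcome is Tr H² = 4 (H, Dω + 2a⊗ω). The Ricci identity
alone also gives the constraint Tr H² = (H, curl σ) + (H, Dω + 2a⊗ω), the pairing with H of the
usual formula for H in terms of shear and vorticity. Together these are the two equations of the
theorem (`vorticity_curl_identity`). Positivity follows since Tr H² is a sum of squares for a
spatial symmetric tensor (`traceSq_magnetic_pos`).

The computation is made near a point of a chart, in an orthonormal frame field X with X_0 = u
(`exists_frameField`). There tensor components are scalar functions, and a covariant derivative is a
directional derivative corrected by the connection coefficients, of which ∇u is a part. The final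
step is then a polynomial identity in finitely many real numbers. The orientation enters only
through the sign s = η(X_1, X_2, X_3, X_0) = ±1, which is locally constant and occurs twice in each
scalar. `magnetic_identity` is the local result, and `isRegularOn_inChart` carries it to the
manifold. -/

noncomputable section

/-! ### Partial derivatives and the Levi-Civita connection in coordinates. -/

namespace Coord

/-- `f` is differentiable at `x` with partial derivatives `d`. -/
def HasPd (f : E4 → ℝ) (x : E4) (d : Fin 4 → ℝ) : Prop :=
  DifferentiableAt ℝ f x ∧ ∀ c, pd c f x = d c

namespace HasPd

variable {f f' : E4 → ℝ} {x : E4} {d d' : Fin 4 → ℝ}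

theorem of_differentiableAt (h : DifferentiableAt ℝ f x) : HasPd f x (fun c => pd c f x) :=
  ⟨h, fun _ => rfl⟩

theorem const (r : ℝ) : HasPd (fun _ => r) x (fun _ => 0) :=
  ⟨by fun_prop, fun c => by simp [pd]⟩

theorem add (h : HasPd f x d) (h' : HasPd f' x d') :
    HasPd (fun y => f y + f' y) x (fun c => d c + d' c) :=
  ⟨h.1.fun_add h'.1, fun c => by
    change _ = d c + d' c
    rw [← h.2, ← h'.2]; simp [pd, fderiv_fun_add h.1 h'.1]⟩

theorem sub (h : HasPd f x d) (h' : HasPd f' x d') :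
    HasPd (fun y => f y - f' y) x (fun c => d c - d' c) :=
  ⟨h.1.fun_sub h'.1, fun c => by
    change _ = d c - d' c
    rw [← h.2, ← h'.2]; simp [pd, fderiv_fun_sub h.1 h'.1]⟩

theorem mul (h : HasPd f x d) (h' : HasPd f' x d') :
    HasPd (fun y => f y * f' y) x (fun c => d c * f' x + f x * d' c) :=
  ⟨h.1.fun_mul h'.1, fun c => by
    change _ = d c * f' x + f x * d' c
    rw [← h.2, ← h'.2]; simp [pd, fderiv_fun_mul h.1 h'.1]; ring⟩

theorem sum {F : Fin 4 → E4 → ℝ} {D : Fin 4 → Fin 4 → ℝ} (h : ∀ a, HasPd (F a) x (D a)) :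
    HasPd (fun y => ∑ a, F a y) x (fun c => ∑ a, D a c) :=
  ⟨DifferentiableAt.fun_sum fun a _ => (h a).1, fun c => by
    simp only [← (h _).2]
    simp [pd, fderiv_fun_sum fun a (_ : a ∈ Finset.univ) => (h a).1]⟩

theorem congr (h : HasPd f x d) (hf : f' =ᶠ[nhds x] f) : HasPd f' x d :=
  ⟨h.1.congr_of_eventuallyEq hf, fun c => by rw [← h.2]; simp [pd, hf.fderiv_eq]⟩

theorem congr_pd (h : HasPd f x d) (hd : ∀ c, d c = d' c) : HasPd f x d' :=
  ⟨h.1, fun c => by rw [h.2, hd]⟩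

theorem unique (h : HasPd f x d) (h' : HasPd f x d') (c : Fin 4) : d c = d' c := by
  rw [← h.2, ← h'.2]

theorem const_mul (r : ℝ) (h : HasPd f x d) :
    HasPd (fun y => r * f y) x (fun c => r * d c) :=
  ((const r).mul h).congr_pd fun c => by ring

theorem div_const (h : HasPd f x d) (r : ℝ) :
    HasPd (fun y => f y / r) x (fun c => d c / r) := by
  have := h.const_mul r⁻¹
  simpa only [div_eq_inv_mul] using this

end HasPd

section Smooth

variable {U : Set E4} {f : E4 → ℝ}

theorem contDiffOn_pd (hU : IsOpen U) (hf : ContDiffOn ℝ ∞ f U) (i : Fin 4) :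
    ContDiffOn ℝ ∞ (pd i f) U := by
  have h : ContDiffOn ℝ ∞ (fderiv ℝ f) U := hf.fderiv_of_isOpen hU (by simp)
  exact h.clm_apply contDiffOn_const

theorem differentiableAt_of_contDiffOn (hU : IsOpen U) (hf : ContDiffOn ℝ ∞ f U) {x : E4}
    (hx : x ∈ U) : DifferentiableAt ℝ f x :=
  (hf.contDiffAt (hU.mem_nhds hx)).differentiableAt (by simp)

theorem hasPd_of_contDiffOn (hU : IsOpen U) (hf : ContDiffOn ℝ ∞ f U) {x : E4}
    (hx : x ∈ U) : HasPd f x (fun c => pd c f x) :=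
  .of_differentiableAt (differentiableAt_of_contDiffOn hU hf hx)

theorem pd_comm (hU : IsOpen U) (hf : ContDiffOn ℝ ∞ f U) {x : E4} (hx : x ∈ U) (i j : Fin 4) :
    pd i (pd j f) x = pd j (pd i f) x := by
  have hc : ContDiffAt ℝ ∞ f x := hf.contDiffAt (hU.mem_nhds hx)
  have hd : DifferentiableAt ℝ (fderiv ℝ f) x :=
    (hc.fderiv_right (m := 1) (by norm_cast)).differentiableAt (by simp)
  have hs : IsSymmSndFDerivAt ℝ f x := hc.isSymmSndFDerivAt (by simpa using WithTop.coe_le_coe.2 (le_top : (2 : ℕ∞) ≤ ⊤))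
  have key (i j : Fin 4) : pd i (pd j f) x =
      fderiv ℝ (fderiv ℝ f) x (EuclideanSpace.single i 1) (EuclideanSpace.single j 1) := by
    unfold pd
    rw [fderiv_clm_apply hd (differentiableAt_const _)]
    simp
  rw [key, key]
  exact hs _ _

end Smooth

/-- A smooth nondegenerate metric on an open set. -/
structure IsMetricOn (g : E4 → Fin 4 → Fin 4 → ℝ) (U : Set E4) : Prop where
  isOpen : IsOpen U
  smooth : ∀ i j, ContDiffOn ℝ ∞ (fun x => g x i j) U
  symm : ∀ x ∈ U, ∀ i j, g x i j = g x j i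
  det_ne : ∀ x ∈ U, (Matrix.of (g x)).det ≠ 0

/-- Christoffel symbols with lowered first index. -/
def christoffelLow (g : E4 → Fin 4 → Fin 4 → ℝ) (x : E4) (m i j : Fin 4) : ℝ :=
  (pd i (fun y => g y j m) x + pd j (fun y => g y i m) x - pd m (fun y => g y i j) x) / 2

namespace IsMetricOn

variable {g : E4 → Fin 4 → Fin 4 → ℝ} {U : Set E4} (hg : IsMetricOn g U) {x : E4} (hx : x ∈ U)

include hg

/-- Cramer's rule: an entry of the inverse is a quotient of determinants, hence of polynomials in
the entries of the metric. -/
theorem smooth_inv (i j : Fin 4) : ContDiffOn ℝ ∞ (fun x => inv g x i j) U := by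
  have hdet (A : E4 → Matrix (Fin 4) (Fin 4) ℝ)
      (hA : ∀ i j, ContDiffOn ℝ ∞ (fun x => A x i j) U) :
      ContDiffOn ℝ ∞ (fun x => (A x).det) U := by
    simp only [Matrix.det_apply']
    refine ContDiffOn.sum fun σ _ => contDiffOn_const.mul (contDiffOn_prod fun i _ => hA _ _)
  have h : ∀ x, inv g x i j = ((Matrix.of (g x)).det)⁻¹ *
      ((Matrix.of (g x)).updateRow j (Pi.single i 1)).det := fun x => by
    simp [inv, Matrix.inv_def, Matrix.adjugate_apply]
  simp only [h]
  refine ContDiffOn.mul (ContDiffOn.inv (hdet _ hg.smooth) hg.det_ne) (hdet _ fun a b => ?_)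
  simp only [Matrix.updateRow_apply]
  split_ifs
  · exact contDiffOn_const
  · exact hg.smooth a b

include hx

theorem sum_inv_mul (a c : Fin 4) : ∑ b, inv g x a b * g x b c = if a = c then 1 else 0 := by
  have h := congrFun (congrFun
    (Matrix.nonsing_inv_mul (Matrix.of (g x)) (isUnit_iff_ne_zero.2 (hg.det_ne x hx))) a) c
  simpa [inv, Matrix.mul_apply, Matrix.one_apply] using h

theorem sum_mul_inv (a c : Fin 4) : ∑ b, g x a b * inv g x b c = if a = c then 1 else 0 := by
  have h := congrFun (congrFun
    (Matrix.mul_nonsing_inv (Matrix.of (g x)) (isUnit_iff_ne_zero.2 (hg.det_ne x hx))) a) c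
  simpa [inv, Matrix.mul_apply, Matrix.one_apply] using h

theorem inv_symm (a b : Fin 4) : inv g x a b = inv g x b a := by
  have h : (Matrix.of (g x)).transpose = Matrix.of (g x) := by
    ext i j; simp [hg.symm x hx i j]
  have := Matrix.transpose_nonsing_inv (Matrix.of (g x))
  rw [h] at this
  exact congrFun (congrFun this b) a

omit hg hx in
theorem christoffel_eq (k i j : Fin 4) :
    christoffel g x k i j = ∑ l, inv g x k l * christoffelLow g x l i j := by
  unfold christoffel christoffelLow
  exact Finset.sum_congr rfl fun l _ => by ring

theorem sum_christoffel (m i j : Fin 4) :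
    ∑ k, g x m k * christoffel g x k i j = christoffelLow g x m i j := by
  simp only [christoffel_eq, Finset.mul_sum, ← mul_assoc]
  rw [Finset.sum_comm]
  simp only [← Finset.sum_mul, hg.sum_mul_inv hx]
  simp

theorem pd_symm (c i j : Fin 4) : pd c (fun y => g y i j) x = pd c (fun y => g y j i) x := by
  have : (fun y => g y i j) =ᶠ[nhds x] fun y => g y j i := by
    filter_upwards [hg.isOpen.mem_nhds hx] with y hy using hg.symm y hy i j
  simp [pd, this.fderiv_eq]

theorem christoffelLow_symm (m i j : Fin 4) :
    christoffelLow g x m i j = christoffelLow g x m j i := by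
  unfold christoffelLow
  rw [hg.pd_symm hx m i j]
  ring

theorem christoffel_symm (k i j : Fin 4) : christoffel g x k i j = christoffel g x k j i := by
  simp only [christoffel_eq, hg.christoffelLow_symm hx _ i j]

theorem pd_eq (c a b : Fin 4) : pd c (fun y => g y a b) x =
    christoffelLow g x a c b + christoffelLow g x b c a := by
  unfold christoffelLow
  rw [hg.pd_symm hx c b a, hg.pd_symm hx a c b, hg.pd_symm hx b c a]
  ring

/-- Metric compatibility, written as a formula for ∂g so that it can be substituted into product
rules. -/
theorem hasPd_metric (a b : Fin 4) : HasPd (fun y => g y a b) x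
    (fun c => ∑ e, (g x a e * christoffel g x e c b + g x b e * christoffel g x e c a)) := by
  refine (hasPd_of_contDiffOn hg.isOpen (hg.smooth a b) hx).congr_pd fun c => ?_
  rw [hg.pd_eq hx, Finset.sum_add_distrib, hg.sum_christoffel hx, hg.sum_christoffel hx]

theorem nabla2_metric (c a b : Fin 4) : nabla2 g g x c a b = 0 := by
  unfold nabla2
  rw [(hg.hasPd_metric hx a b).2, ← Finset.sum_sub_distrib]
  refine Finset.sum_eq_zero fun e _ => ?_
  rw [hg.symm x hx e b]
  ring

omit hx

theorem smooth_christoffelLow (m i j : Fin 4) :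
    ContDiffOn ℝ ∞ (fun x => christoffelLow g x m i j) U :=
  (((contDiffOn_pd hg.isOpen (hg.smooth _ _) _).add
    (contDiffOn_pd hg.isOpen (hg.smooth _ _) _)).sub
      (contDiffOn_pd hg.isOpen (hg.smooth _ _) _)).div_const _

theorem smooth_christoffel (m i j : Fin 4) :
    ContDiffOn ℝ ∞ (fun x => christoffel g x m i j) U := by
  simp only [christoffel_eq]
  exact ContDiffOn.sum fun l _ => (hg.smooth_inv _ _).mul (hg.smooth_christoffelLow _ _ _)

theorem smooth_riemannUp (a b c d : Fin 4) :
    ContDiffOn ℝ ∞ (fun x => riemannUp g x a b c d) U :=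
  ((contDiffOn_pd hg.isOpen (hg.smooth_christoffel _ _ _) _).sub
    (contDiffOn_pd hg.isOpen (hg.smooth_christoffel _ _ _) _)).add <|
    ContDiffOn.sum fun _ _ => ((hg.smooth_christoffel _ _ _).mul (hg.smooth_christoffel _ _ _)).sub
      ((hg.smooth_christoffel _ _ _).mul (hg.smooth_christoffel _ _ _))

theorem smooth_riemann (a b c d : Fin 4) :
    ContDiffOn ℝ ∞ (fun x => riemann g x a b c d) U :=
  ContDiffOn.sum fun _ _ => (hg.smooth _ _).mul (hg.smooth_riemannUp _ _ _ _)

theorem smooth_ricci (b d : Fin 4) : ContDiffOn ℝ ∞ (fun x => ricci g x b d) U :=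
  ContDiffOn.sum fun _ _ => hg.smooth_riemannUp _ _ _ _

theorem smooth_scalar : ContDiffOn ℝ ∞ (fun x => scalar g x) U :=
  ContDiffOn.sum fun _ _ => ContDiffOn.sum fun _ _ => (hg.smooth_inv _ _).mul (hg.smooth_ricci _ _)

theorem smooth_schouten (b d : Fin 4) : ContDiffOn ℝ ∞ (fun x => schouten g x b d) U :=
  ((hg.smooth_ricci _ _).sub ((hg.smooth_scalar.div_const _).mul (hg.smooth _ _))).div_const _

end IsMetricOn

end Coord

/-! ### Curvature: algebraic symmetries, Ricci identity, Bianchi identities. -/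

namespace Coord

/-- Covariant derivative `∇_e T_{abcd}` of a covariant 4-tensor field. -/
def nabla4 (g : E4 → Fin 4 → Fin 4 → ℝ) (T : E4 → Fin 4 → Fin 4 → Fin 4 → Fin 4 → ℝ)
    (x : E4) (e a b c d : Fin 4) : ℝ :=
  pd e (fun y => T y a b c d) x
    - ∑ f, (christoffel g x f e a * T x f b c d + christoffel g x f e b * T x a f c d
        + christoffel g x f e c * T x a b f d + christoffel g x f e d * T x a b c f)

/-- Kulkarni–Nomizu product of the metric and a 2-tensor. -/
def kn (g P : E4 → Fin 4 → Fin 4 → ℝ) (x : E4) (a b c d : Fin 4) : ℝ :=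
  g x a c * P x b d - g x a d * P x b c - g x b c * P x a d + g x b d * P x a c

namespace IsMetricOn

variable {g : E4 → Fin 4 → Fin 4 → ℝ} {U : Set E4} (hg : IsMetricOn g U) {x : E4} (hx : x ∈ U)

include hg hx

theorem hasPd_christoffelLow (a d b : Fin 4) : HasPd (fun y => christoffelLow g y a d b) x
    (fun c => (pd c (pd d fun y => g y b a) x + pd c (pd b fun y => g y d a) x
      - pd c (pd a fun y => g y d b) x) / 2) := by
  have h (i j k : Fin 4) : HasPd (pd i fun y => g y j k) x
      (fun c => pd c (pd i fun y => g y j k) x) :=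
    hasPd_of_contDiffOn hg.isOpen (contDiffOn_pd hg.isOpen (hg.smooth j k) i) hx
  exact (((h d b a).add (h b d a)).sub (h a d b)).div_const 2

theorem hasPd_christoffel (a d b : Fin 4) : HasPd (fun y => christoffel g y a d b) x
    (fun c => pd c (fun y => christoffel g y a d b) x) :=
  hasPd_of_contDiffOn hg.isOpen (hg.smooth_christoffel a d b) hx

/-- Leibniz rule applied to g_{ae} Γ^e_{db} = Γ_{adb}: lowering the index brings in second
derivatives of g and a product of Christoffel symbols. -/
theorem sum_mul_pd_christoffel (c a d b : Fin 4) :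
    ∑ e, g x a e * pd c (fun y => christoffel g y e d b) x =
      (pd c (pd d fun y => g y b a) x + pd c (pd b fun y => g y d a) x
        - pd c (pd a fun y => g y d b) x) / 2
      - ∑ e, (christoffelLow g x a c e + christoffelLow g x e c a) * christoffel g x e d b := by
  have h1 := HasPd.sum fun e => (hasPd_of_contDiffOn hg.isOpen (hg.smooth a e) hx).mul
    (hg.hasPd_christoffel hx e d b)
  have h2 := (hg.hasPd_christoffelLow hx a d b).congr
    (f' := fun y => ∑ e, g y a e * christoffel g y e d b) (by
      filter_upwards [hg.isOpen.mem_nhds hx] with y hy using hg.sum_christoffel hy a d b)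
  have h := h1.unique h2 c
  simp only [hg.pd_eq hx c a, Finset.sum_add_distrib] at h
  linarith

/-- The products of Christoffel symbols in the covariant curvature tensor. -/
theorem sum_christoffelLow_mul_comm (i j k l : Fin 4) :
    ∑ e, christoffelLow g x e i j * christoffel g x e k l =
      ∑ e, christoffelLow g x e k l * christoffel g x e i j := by
  simp only [← hg.sum_christoffel hx, Finset.sum_mul]
  rw [Finset.sum_comm]
  refine Finset.sum_congr rfl fun e _ => Finset.sum_congr rfl fun f _ => ?_
  rw [hg.symm x hx e f]
  ring

/-- In this form the symmetries of the curvature can be read off: the second derivatives of g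
commute, and each quadratic term is a scalar product of two Christoffel vectors, hence symmetric in
them. -/
theorem riemann_eq (a b c d : Fin 4) : riemann g x a b c d =
    (pd c (pd b fun y => g y d a) x - pd c (pd a fun y => g y d b) x
      - pd d (pd b fun y => g y c a) x + pd d (pd a fun y => g y c b) x) / 2
    - ∑ e, christoffelLow g x e c a * christoffel g x e d b
    + ∑ e, christoffelLow g x e d a * christoffel g x e c b := by
  have hq (i j k : Fin 4) : ∑ e, g x a e * ∑ f, christoffel g x e i f * christoffel g x f j k =
      ∑ f, christoffelLow g x a i f * christoffel g x f j k := by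
    simp only [← hg.sum_christoffel hx, Finset.sum_mul, Finset.mul_sum]
    rw [Finset.sum_comm]
    exact Finset.sum_congr rfl fun e _ => Finset.sum_congr rfl fun f _ => by ring
  have h : riemann g x a b c d =
      ∑ e, g x a e * pd c (fun y => christoffel g y e d b) x
      - ∑ e, g x a e * pd d (fun y => christoffel g y e c b) x
      + ∑ e, g x a e * ∑ f, christoffel g x e c f * christoffel g x f d b
      - ∑ e, g x a e * ∑ f, christoffel g x e d f * christoffel g x f c b := by
    simp only [riemann, riemannUp, Finset.sum_sub_distrib, mul_add, mul_sub,
      Finset.sum_add_distrib]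
    ring
  rw [h, hq, hq, hg.sum_mul_pd_christoffel hx, hg.sum_mul_pd_christoffel hx]
  simp only [add_mul, Finset.sum_add_distrib]
  rw [pd_comm hg.isOpen (hg.smooth b a) hx c d]
  ring

theorem pd_pd_comm (i j a b : Fin 4) :
    pd i (pd j fun y => g y a b) x = pd j (pd i fun y => g y a b) x :=
  pd_comm hg.isOpen (hg.smooth a b) hx i j

theorem pd_pd_symm (i j a b : Fin 4) :
    pd i (pd j fun y => g y a b) x = pd i (pd j fun y => g y b a) x := by
  have : (pd j fun y => g y a b) =ᶠ[nhds x] (pd j fun y => g y b a) := by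
    filter_upwards [hg.isOpen.mem_nhds hx] with y hy using hg.pd_symm hy j a b
  simp [pd, this.fderiv_eq]

theorem riemann_antisymm_right (a b c d : Fin 4) :
    riemann g x a b d c = -riemann g x a b c d := by
  simp only [hg.riemann_eq hx]
  ring

theorem riemann_antisymm_left (a b c d : Fin 4) :
    riemann g x b a c d = -riemann g x a b c d := by
  rw [hg.riemann_eq hx, hg.riemann_eq hx a b, hg.sum_christoffelLow_mul_comm hx c b d a,
    hg.sum_christoffelLow_mul_comm hx d b c a]
  ring

theorem riemann_pair_symm (a b c d : Fin 4) : riemann g x c d a b = riemann g x a b c d := by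
  rw [hg.riemann_eq hx, hg.riemann_eq hx a b]
  simp only [hg.christoffelLow_symm hx _ a c, hg.christoffelLow_symm hx _ b c,
    hg.christoffel_symm hx _ b d, hg.christoffel_symm hx _ a d]
  rw [hg.sum_christoffelLow_mul_comm hx c b d a, hg.pd_pd_comm hx a d, hg.pd_pd_symm hx d a b c,
    hg.pd_pd_comm hx a c, hg.pd_pd_symm hx c a b d, hg.pd_pd_comm hx b d, hg.pd_pd_symm hx d b a c,
    hg.pd_pd_comm hx b c, hg.pd_pd_symm hx c b a d]
  ring

theorem riemann_cyclic (a b c d : Fin 4) :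
    riemann g x a b c d + riemann g x a c d b + riemann g x a d b c = 0 := by
  simp only [hg.riemann_eq hx]
  simp only [hg.christoffel_symm hx _ d b, hg.christoffel_symm hx _ c b,
    hg.christoffel_symm hx _ d c]
  rw [hg.pd_pd_comm hx d c, hg.pd_pd_comm hx d b, hg.pd_pd_comm hx c b,
    hg.pd_pd_symm hx d a c b, hg.pd_pd_symm hx b a d c, hg.pd_pd_symm hx c a d b]
  ring

theorem sum_inv_riemann (b d : Fin 4) :
    ∑ a, ∑ c, inv g x a c * riemann g x a b c d = ricci g x b d := by
  unfold ricci riemann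
  rw [Finset.sum_comm]
  refine Finset.sum_congr rfl fun c _ => ?_
  simp only [Finset.mul_sum, ← mul_assoc]
  rw [Finset.sum_comm]
  simp only [← Finset.sum_mul, fun a => hg.inv_symm hx a c, hg.sum_inv_mul hx]
  simp

theorem ricci_symm (b d : Fin 4) : ricci g x b d = ricci g x d b := by
  rw [← hg.sum_inv_riemann hx, ← hg.sum_inv_riemann hx, Finset.sum_comm]
  refine Finset.sum_congr rfl fun a _ => Finset.sum_congr rfl fun c _ => ?_
  rw [hg.riemann_pair_symm hx, hg.inv_symm hx]

theorem schouten_symm (b d : Fin 4) : schouten g x b d = schouten g x d b := by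
  unfold schouten
  rw [hg.ricci_symm hx, hg.symm x hx]

omit hg hx in
theorem weyl_eq (a b c d : Fin 4) :
    weyl g x a b c d = riemann g x a b c d - kn g (schouten g) x a b c d := by
  unfold weyl kn schouten
  ring

theorem weyl_antisymm_right (a b c d : Fin 4) : weyl g x a b d c = -weyl g x a b c d := by
  simp only [weyl_eq, kn, hg.riemann_antisymm_right hx a b c d]
  ring

theorem weyl_antisymm_left (a b c d : Fin 4) : weyl g x b a c d = -weyl g x a b c d := by
  simp only [weyl_eq, kn, hg.riemann_antisymm_left hx a b c d]
  ring

theorem weyl_pair_symm (a b c d : Fin 4) : weyl g x c d a b = weyl g x a b c d := by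
  simp only [weyl_eq, kn, hg.riemann_pair_symm hx a b c d, hg.schouten_symm hx d b,
    hg.schouten_symm hx d a, hg.schouten_symm hx c b, hg.schouten_symm hx c a,
    hg.symm x hx c a, hg.symm x hx c b, hg.symm x hx d a, hg.symm x hx d b]
  ring

theorem weyl_cyclic (a b c d : Fin 4) :
    weyl g x a b c d + weyl g x a c d b + weyl g x a d b c = 0 := by
  have h := hg.riemann_cyclic hx a b c d
  simp only [weyl_eq, kn, hg.schouten_symm hx d b, hg.schouten_symm hx d c,
    hg.schouten_symm hx c b, hg.symm x hx c b, hg.symm x hx d b, hg.symm x hx d c]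
  linear_combination h

theorem weyl_trace (b d : Fin 4) : ∑ a, ∑ c, inv g x a c * weyl g x a b c d = 0 := by
  have h1 : ∑ a, ∑ c, inv g x a c * g x a c = 4 := by
    have : ∀ a, ∑ c, inv g x a c * g x a c = 1 := fun a => by
      simp only [hg.symm x hx a, hg.sum_inv_mul hx]; simp
    simp [this]
  have h2 (v : Fin 4 → ℝ) (d : Fin 4) : ∑ a, ∑ c, inv g x a c * (g x a d * v c) = v d := by
    rw [Finset.sum_comm]
    have : ∀ c, ∑ a, inv g x a c * (g x a d * v c) = (if c = d then 1 else 0) * v c := fun c => by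
      rw [← hg.sum_inv_mul hx, Finset.sum_mul]
      exact Finset.sum_congr rfl fun a _ => by rw [hg.inv_symm hx]; ring
    simp [this]
  have h3 (v : Fin 4 → ℝ) (b : Fin 4) : ∑ a, ∑ c, inv g x a c * (g x b c * v a) = v b := by
    rw [← h2 v b, Finset.sum_comm]
    refine Finset.sum_congr rfl fun a _ => Finset.sum_congr rfl fun c _ => ?_
    rw [hg.inv_symm hx, hg.symm x hx b a]
  have key : ∑ a, ∑ c, inv g x a c * weyl g x a b c d =
      ∑ a, ∑ c, inv g x a c * riemann g x a b c d
      - (∑ a, ∑ c, inv g x a c * g x a c) * ricci g x b d / 2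
      + (∑ a, ∑ c, inv g x a c * (g x a d * ricci g x b c)) / 2
      + (∑ a, ∑ c, inv g x a c * (g x b c * ricci g x a d)) / 2
      - g x b d * (∑ a, ∑ c, inv g x a c * ricci g x a c) / 2
      + scalar g x / 6 * ((∑ a, ∑ c, inv g x a c * g x a c) * g x b d
        - ∑ a, ∑ c, inv g x a c * (g x a d * g x b c)) := by
    simp only [weyl, Finset.sum_mul, Finset.mul_sum, Finset.sum_div, ← Finset.sum_add_distrib,
      ← Finset.sum_sub_distrib]
    exact Finset.sum_congr rfl fun a _ => Finset.sum_congr rfl fun c _ => by ring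
  rw [key, hg.sum_inv_riemann hx, h1, h2 (fun c => ricci g x b c), h3 (fun a => ricci g x a d),
    h2 (fun c => g x b c)]
  change _ - g x b d * scalar g x / 2 + _ = 0
  ring

theorem smooth_weyl (a b c d : Fin 4) : DifferentiableAt ℝ (fun y => weyl g y a b c d) x := by
  simp only [weyl_eq, kn]
  have h1 := fun i j => differentiableAt_of_contDiffOn hg.isOpen (hg.smooth i j) hx
  have h2 := fun i j => differentiableAt_of_contDiffOn hg.isOpen (hg.smooth_schouten i j) hx
  have h3 := differentiableAt_of_contDiffOn hg.isOpen (hg.smooth_riemann a b c d) hx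
  exact h3.fun_sub (((((h1 a c).fun_mul (h2 b d)).fun_sub ((h1 a d).fun_mul (h2 b c))).fun_sub
    ((h1 b c).fun_mul (h2 a d))).fun_add ((h1 b d).fun_mul (h2 a c)))

/-- Ricci identity. -/
theorem nabla2_nabla1_comm {v : E4 → Fin 4 → ℝ} (hv : ∀ i, ContDiffOn ℝ ∞ (fun y => v y i) U)
    (c a b : Fin 4) :
    nabla2 g (nabla1 g v) x c a b - nabla2 g (nabla1 g v) x a c b =
      -∑ e, riemannUp g x e b c a * v x e := by
  have hN (a b : Fin 4) : HasPd (fun y => nabla1 g v y a b) x (fun c =>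
      pd c (pd a fun y => v y b) x - ∑ e, (pd c (fun y => christoffel g y e a b) x * v x e
        + christoffel g x e a b * pd c (fun y => v y e) x)) :=
    (hasPd_of_contDiffOn hg.isOpen (contDiffOn_pd hg.isOpen (hv b) a) hx).sub
      (HasPd.sum fun e => (hg.hasPd_christoffel hx e a b).mul
        (hasPd_of_contDiffOn hg.isOpen (hv e) hx))
  unfold nabla2
  rw [(hN a b).2, (hN c b).2]
  beta_reduce
  rw [pd_comm hg.isOpen (hv b) hx c a]
  simp only [nabla1, riemannUp, fun e => hg.christoffel_symm hx e c a, Fin.sum_univ_four]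
  ring

/-- The derivative of the lowering metric cancels the correction on the first index. The corrections
on the form indices c, d are kept apart because they cancel separately in the Bianchi sum. -/
theorem nabla4_riemann (e a b c d : Fin 4) : nabla4 g (riemann g) x e a b c d =
    ∑ h, g x a h * (pd e (fun y => riemannUp g y h b c d) x
      + ∑ f, christoffel g x h e f * riemannUp g x f b c d
      - ∑ f, christoffel g x f e b * riemannUp g x h f c d)
    - ∑ f, (christoffel g x f e c * riemann g x a b f d
      + christoffel g x f e d * riemann g x a b c f) := by
  have h := HasPd.sum fun h => (hg.hasPd_metric hx a h).mul
    (hasPd_of_contDiffOn hg.isOpen (hg.smooth_riemannUp h b c d) hx)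
  have h' : pd e (fun y => riemann g y a b c d) x = _ := h.2 e
  unfold nabla4
  rw [h']
  simp only [riemann, Fin.sum_univ_four, hg.symm x hx 1 0, hg.symm x hx 2 0, hg.symm x hx 3 0,
    hg.symm x hx 2 1, hg.symm x hx 3 1, hg.symm x hx 3 2]
  fin_cases a <;> simp only [Fin.zero_eta, Fin.mk_one, Fin.reduceFinMk, hg.symm x hx 1 0,
    hg.symm x hx 2 0, hg.symm x hx 3 0, hg.symm x hx 2 1, hg.symm x hx 3 1, hg.symm x hx 3 2] <;>
    ring

/-- With A_c the connection matrices and F_{cd} = ∂_c A_d - ∂_d A_c + [A_c, A_d], this is the cyclic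
identity for ∂_e F_{cd} + [A_e, F_{cd}]. It needs only the symmetry of second derivatives and the
associativity of matrix multiplication. -/
theorem bianchi_riemannUp (e h b c d : Fin 4) :
    let K := fun e c d : Fin 4 => pd e (fun y => riemannUp g y h b c d) x
      + ∑ f, christoffel g x h e f * riemannUp g x f b c d
      - ∑ f, christoffel g x f e b * riemannUp g x h f c d
    K e c d + K c d e + K d e c = 0 := by
  intro K
  let A (c : Fin 4) : Matrix (Fin 4) (Fin 4) ℝ := .of fun h b => christoffel g x h c b
  let dA (e c : Fin 4) : Matrix (Fin 4) (Fin 4) ℝ :=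
    .of fun h b => pd e (fun y => christoffel g y h c b) x
  let ddA (f e c : Fin 4) : Matrix (Fin 4) (Fin 4) ℝ :=
    .of fun h b => pd f (pd e fun y => christoffel g y h c b) x
  have hdd (f e c : Fin 4) : ddA f e c = ddA e f c := by
    ext h b
    exact pd_comm hg.isOpen (hg.smooth_christoffel h c b) hx f e
  have hK (e c d : Fin 4) : K e c d = (ddA e c d - ddA e d c + dA e c * A d + A c * dA e d
      - dA e d * A c - A d * dA e c + A e * (dA c d - dA d c + A c * A d - A d * A c)
      - (dA c d - dA d c + A c * A d - A d * A c) * A e) h b := by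
    have hp (i j k l : Fin 4) := hasPd_of_contDiffOn hg.isOpen
      (contDiffOn_pd hg.isOpen (hg.smooth_christoffel i j k) l) hx
    have h1 := ((hp h d b c).sub (hp h c b d)).add (HasPd.sum fun f =>
      ((hg.hasPd_christoffel hx h c f).mul (hg.hasPd_christoffel hx f d b)).sub
      ((hg.hasPd_christoffel hx h d f).mul (hg.hasPd_christoffel hx f c b)))
    have h2 : pd e (fun y => riemannUp g y h b c d) x = _ := h1.2 e
    simp only [K]
    rw [h2]
    simp only [riemannUp, A, dA, ddA, Matrix.add_apply, Matrix.sub_apply, Matrix.mul_apply,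
      Matrix.of_apply, Finset.sum_add_distrib, Finset.sum_sub_distrib, mul_add, mul_sub, add_mul,
      sub_mul, fun f => mul_comm (christoffel g x f e b)]
    ring
  rw [hK, hK, hK, ← Matrix.add_apply, ← Matrix.add_apply]
  have : ddA e c d - ddA e d c + dA e c * A d + A c * dA e d
      - dA e d * A c - A d * dA e c + A e * (dA c d - dA d c + A c * A d - A d * A c)
      - (dA c d - dA d c + A c * A d - A d * A c) * A e
      + (ddA c d e - ddA c e d + dA c d * A e + A d * dA c e
      - dA c e * A d - A e * dA c d + A c * (dA d e - dA e d + A d * A e - A e * A d)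
      - (dA d e - dA e d + A d * A e - A e * A d) * A c)
      + (ddA d e c - ddA d c e + dA d e * A c + A e * dA d c
      - dA d c * A e - A c * dA d e + A d * (dA e c - dA c e + A e * A c - A c * A e)
      - (dA e c - dA c e + A e * A c - A c * A e) * A d) = 0 := by
    rw [hdd e c d, hdd e d c, hdd c d e]
    noncomm_ring
  rw [this]
  rfl

/-- Second Bianchi identity. -/
theorem bianchi_riemann (e a b c d : Fin 4) :
    nabla4 g (riemann g) x e a b c d + nabla4 g (riemann g) x c a b d e
      + nabla4 g (riemann g) x d a b e c = 0 := by
  let K := fun e c d h : Fin 4 => pd e (fun y => riemannUp g y h b c d) x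
      + ∑ f, christoffel g x h e f * riemannUp g x f b c d
      - ∑ f, christoffel g x f e b * riemannUp g x h f c d
  let Q := fun e c d : Fin 4 => ∑ f, christoffel g x f e c * riemann g x a b f d
  have hK : ∑ h, g x a h * K e c d h + ∑ h, g x a h * K c d e h
      + ∑ h, g x a h * K d e c h = 0 := by
    rw [← Finset.sum_add_distrib, ← Finset.sum_add_distrib]
    refine Finset.sum_eq_zero fun h _ => ?_
    rw [← mul_add, ← mul_add]
    exact mul_eq_zero_of_right _ (hg.bianchi_riemannUp hx e h b c d)
  -- Torsion-freeness: the corrections on the form indices cancel in pairs in the cyclic sum.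
  have hQ (e c d : Fin 4) : Q e c d = Q c e d :=
    Finset.sum_congr rfl fun f _ => by rw [hg.christoffel_symm hx]
  have hN (e c d : Fin 4) : nabla4 g (riemann g) x e a b c d =
      ∑ h, g x a h * K e c d h - (Q e c d - Q e d c) := by
    have : ∑ f, (christoffel g x f e c * riemann g x a b f d
        + christoffel g x f e d * riemann g x a b c f) = Q e c d - Q e d c := by
      simp only [Q, ← Finset.sum_sub_distrib]
      refine Finset.sum_congr rfl fun f _ => ?_
      rw [hg.riemann_antisymm_right hx a b f c]
      ring
    rw [hg.nabla4_riemann hx, this]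
  rw [hN, hN, hN, hQ c e, hQ d e, hQ d c]
  linear_combination hK

theorem nabla4_kn {P : E4 → Fin 4 → Fin 4 → ℝ} (hP : ∀ i j, ContDiffOn ℝ ∞ (fun y => P y i j) U)
    (e a b c d : Fin 4) : nabla4 g (kn g P) x e a b c d =
      g x a c * nabla2 g P x e b d - g x a d * nabla2 g P x e b c - g x b c * nabla2 g P x e a d
        + g x b d * nabla2 g P x e a c := by
  have hP := fun i j => hasPd_of_contDiffOn hg.isOpen (hP i j) hx
  have hm := hg.hasPd_metric hx
  have h := ((((hm a c).mul (hP b d)).sub ((hm a d).mul (hP b c))).sub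
    ((hm b c).mul (hP a d))).add ((hm b d).mul (hP a c))
  have h' : pd e (fun y => kn g P y a b c d) x = _ := h.2 e
  unfold nabla4
  rw [h']
  simp only [kn, nabla2, Fin.sum_univ_four, fun i => hg.symm x hx i c, fun i => hg.symm x hx i d]
  ring

theorem nabla2_symm {P : E4 → Fin 4 → Fin 4 → ℝ} (hP : ∀ y ∈ U, ∀ i j, P y i j = P y j i)
    (c a b : Fin 4) : nabla2 g P x c a b = nabla2 g P x c b a := by
  have : (fun y => P y a b) =ᶠ[nhds x] fun y => P y b a := by
    filter_upwards [hg.isOpen.mem_nhds hx] with y hy using hP y hy a b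
  unfold nabla2
  have h : pd c (fun y => P y a b) x = pd c (fun y => P y b a) x := by simp [pd, this.fderiv_eq]
  rw [h]
  congr 1
  refine Finset.sum_congr rfl fun e _ => ?_
  rw [hP x hx e b, hP x hx e a]
  ring

/-- If the Cotton tensor vanishes, the Weyl tensor satisfies the second Bianchi identity. -/
theorem bianchi_weyl (hC : cotton g x = 0) (e a b c d : Fin 4) :
    nabla4 g (weyl g) x e a b c d + nabla4 g (weyl g) x c a b d e
      + nabla4 g (weyl g) x d a b e c = 0 := by
  have hP : ∀ i j, ContDiffOn ℝ ∞ (fun y => schouten g y i j) U := hg.smooth_schouten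
  have hs : ∀ c a b, nabla2 g (schouten g) x c a b = nabla2 g (schouten g) x c b a :=
    hg.nabla2_symm hx fun y hy => hg.schouten_symm hy
  have hw (e a b c d : Fin 4) : nabla4 g (weyl g) x e a b c d =
      nabla4 g (riemann g) x e a b c d - nabla4 g (kn g (schouten g)) x e a b c d := by
    have h1 := hasPd_of_contDiffOn hg.isOpen (hg.smooth_riemann a b c d) hx
    have h2 : HasPd (fun y => kn g (schouten g) y a b c d) x
        (fun e => pd e (fun y => kn g (schouten g) y a b c d) x) :=
      hasPd_of_contDiffOn hg.isOpen (((((hg.smooth _ _).mul (hP _ _)).sub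
        ((hg.smooth _ _).mul (hP _ _))).sub ((hg.smooth _ _).mul (hP _ _))).add
        ((hg.smooth _ _).mul (hP _ _))) hx
    unfold nabla4
    have h3 : pd e (fun y => weyl g y a b c d) x = _ :=
      ((h1.sub h2).congr (Filter.Eventually.of_forall fun y => weyl_eq a b c d)).2 e
    rw [h3]
    simp only [weyl_eq, Fin.sum_univ_four]
    ring
  have hC' (i j k : Fin 4) : nabla2 g (schouten g) x i j k = nabla2 g (schouten g) x j i k := by
    have := congrFun (congrFun (congrFun hC i) j) k
    exact sub_eq_zero.1 this
  simp only [hw, hg.nabla4_kn hx hP]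
  have h := hg.bianchi_riemann hx e a b c d
  -- Vanishing Cotton tensor and symmetric P make ∇P totally symmetric, so the Kulkarni–Nomizu part
  -- of the cyclic sum cancels.
  have e1 (i j k : Fin 4) : nabla2 g (schouten g) x i j k = nabla2 g (schouten g) x k j i := by
    rw [hC', hs, hC']
  rw [e1 e b d, e1 e b c, e1 e a d, e1 e a c, e1 c b e, e1 c b d, e1 c a e, e1 c a d,
    e1 d b c] at *
  linear_combination h

end IsMetricOn

end Coord

/-! ### Directional derivatives and frame components. -/

namespace Coord

/-- `f` is differentiable at `x` with derivative `r` in the direction `w`. -/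
def HasDir (f : E4 → ℝ) (x : E4) (w : Fin 4 → ℝ) (r : ℝ) : Prop :=
  DifferentiableAt ℝ f x ∧ ∑ c, w c * pd c f x = r

theorem HasPd.hasDir {f : E4 → ℝ} {x : E4} {d : Fin 4 → ℝ} (h : HasPd f x d) (w : Fin 4 → ℝ) :
    HasDir f x w (∑ c, w c * d c) :=
  ⟨h.1, by simp only [h.2]⟩

namespace HasDir

variable {f f' : E4 → ℝ} {x : E4} {w : Fin 4 → ℝ} {r r' : ℝ}

theorem hasPd (h : HasDir f x w r) : HasPd f x (fun c => pd c f x) :=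
  .of_differentiableAt h.1

theorem of_differentiableAt (h : DifferentiableAt ℝ f x) (w : Fin 4 → ℝ) :
    HasDir f x w (∑ c, w c * pd c f x) :=
  ⟨h, rfl⟩

theorem const (r : ℝ) : HasDir (fun _ => r) x w 0 := by
  simpa using (HasPd.const (x := x) r).hasDir w

theorem congr_val (h : HasDir f x w r) (e : r = r') : HasDir f x w r' := e ▸ h

theorem add (h : HasDir f x w r) (h' : HasDir f' x w r') :
    HasDir (fun y => f y + f' y) x w (r + r') := by
  refine ((h.hasPd.add h'.hasPd).hasDir w).congr_val ?_
  rw [← h.2, ← h'.2, ← Finset.sum_add_distrib]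
  exact Finset.sum_congr rfl fun c _ => by ring

theorem sub (h : HasDir f x w r) (h' : HasDir f' x w r') :
    HasDir (fun y => f y - f' y) x w (r - r') := by
  refine ((h.hasPd.sub h'.hasPd).hasDir w).congr_val ?_
  rw [← h.2, ← h'.2, ← Finset.sum_sub_distrib]
  exact Finset.sum_congr rfl fun c _ => by ring

theorem mul (h : HasDir f x w r) (h' : HasDir f' x w r') :
    HasDir (fun y => f y * f' y) x w (r * f' x + f x * r') := by
  refine ((h.hasPd.mul h'.hasPd).hasDir w).congr_val ?_
  rw [← h.2, ← h'.2, Finset.sum_mul, Finset.mul_sum, ← Finset.sum_add_distrib]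
  exact Finset.sum_congr rfl fun c _ => by ring

theorem const_mul (s : ℝ) (h : HasDir f x w r) : HasDir (fun y => s * f y) x w (s * r) :=
  ((const s).mul h).congr_val (by ring)

theorem sum {F : Fin 4 → E4 → ℝ} {R : Fin 4 → ℝ} (h : ∀ a, HasDir (F a) x w (R a)) :
    HasDir (fun y => ∑ a, F a y) x w (∑ a, R a) := by
  refine ((HasPd.sum fun a => (h a).hasPd).hasDir w).congr_val ?_
  simp only [← (h _).2, Finset.mul_sum]
  exact Finset.sum_comm

theorem congr (h : HasDir f x w r) (hf : f' =ᶠ[nhds x] f) : HasDir f' x w r :=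
  ((h.hasPd.congr hf).hasDir w).congr_val h.2

theorem unique (h : HasDir f x w r) (h' : HasDir f x w r') : r = r' := h.2.symm.trans h'.2

theorem eq_zero_of_eventually_const (h : HasDir f x w r) {s : ℝ} (hf : ∀ᶠ y in nhds x, f y = s) :
    r = 0 :=
  h.unique ((const s).congr hf)

end HasDir

/-! ### Components with respect to a frame -/

/-- `e i a` is the a-th coordinate of the i-th frame vector. The higher versions nest this
contraction slot by slot, so that a result for one slot can be iterated. -/
def fr1 (e : Fin 4 → Fin 4 → ℝ) (T : Fin 4 → ℝ) (i : Fin 4) : ℝ := ∑ a, e i a * T a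

def fr2 (e : Fin 4 → Fin 4 → ℝ) (T : Fin 4 → Fin 4 → ℝ) (i j : Fin 4) : ℝ :=
  ∑ a, e i a * fr1 e (T a) j

def fr3 (e : Fin 4 → Fin 4 → ℝ) (T : Fin 4 → Fin 4 → Fin 4 → ℝ) (i j k : Fin 4) : ℝ :=
  ∑ a, e i a * fr2 e (T a) j k

def fr4 (e : Fin 4 → Fin 4 → ℝ) (T : Fin 4 → Fin 4 → Fin 4 → Fin 4 → ℝ) (i j k l : Fin 4) : ℝ :=
  ∑ a, e i a * fr3 e (T a) j k l

def fr5 (e : Fin 4 → Fin 4 → ℝ) (T : Fin 4 → Fin 4 → Fin 4 → Fin 4 → Fin 4 → ℝ)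
    (i j k l m : Fin 4) : ℝ :=
  ∑ a, e i a * fr4 e (T a) j k l m

section Linear

variable (e : Fin 4 → Fin 4 → ℝ)

/-- The shape N + Σ c_f T_f is the one produced by a covariant derivative plus a Christoffel
correction, which is how this lemma and its higher analogues are used. -/
theorem fr1_add_sum (N : Fin 4 → ℝ) (c : Fin 4 → ℝ) (T : Fin 4 → Fin 4 → ℝ) (i : Fin 4) :
    fr1 e (fun a => N a + ∑ f, c f * T f a) i = fr1 e N i + ∑ f, c f * fr1 e (T f) i := by
  simp only [fr1, mul_add, Finset.sum_add_distrib, Finset.mul_sum]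
  congr 1
  rw [Finset.sum_comm]
  exact Finset.sum_congr rfl fun a _ => Finset.sum_congr rfl fun b _ => by ring

theorem fr2_add_sum (N : Fin 4 → Fin 4 → ℝ) (c : Fin 4 → ℝ) (T : Fin 4 → Fin 4 → Fin 4 → ℝ)
    (i j : Fin 4) : fr2 e (fun a b => N a b + ∑ f, c f * T f a b) i j =
      fr2 e N i j + ∑ f, c f * fr2 e (T f) i j := by
  simp only [fr2, fr1_add_sum e (N _) c (fun f => T f _)]
  exact fr1_add_sum e (fun a => fr1 e (N a) j) c (fun f a => fr1 e (T f a) j) i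

theorem fr3_add_sum (N : Fin 4 → Fin 4 → Fin 4 → ℝ) (c : Fin 4 → ℝ)
    (T : Fin 4 → Fin 4 → Fin 4 → Fin 4 → ℝ) (i j k : Fin 4) :
    fr3 e (fun a b d => N a b d + ∑ f, c f * T f a b d) i j k =
      fr3 e N i j k + ∑ f, c f * fr3 e (T f) i j k := by
  simp only [fr3, fr2_add_sum e (N _) c (fun f => T f _)]
  exact fr1_add_sum e (fun a => fr2 e (N a) j k) c (fun f a => fr2 e (T f a) j k) i

theorem fr4_add_sum (N : Fin 4 → Fin 4 → Fin 4 → Fin 4 → ℝ) (c : Fin 4 → ℝ)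
    (T : Fin 4 → Fin 4 → Fin 4 → Fin 4 → Fin 4 → ℝ) (i j k l : Fin 4) :
    fr4 e (fun a b d m => N a b d m + ∑ f, c f * T f a b d m) i j k l =
      fr4 e N i j k l + ∑ f, c f * fr4 e (T f) i j k l := by
  simp only [fr4, fr3_add_sum e (N _) c (fun f => T f _)]
  exact fr1_add_sum e (fun a => fr3 e (N a) j k l) c (fun f a => fr3 e (T f a) j k l) i

end Linear

section Derivative

variable {X : E4 → Fin 4 → Fin 4 → ℝ} {x : E4} {w : Fin 4 → ℝ} {γ Γ : Fin 4 → Fin 4 → ℝ}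
  (hX : ∀ i a, HasDir (fun y => X y i a) x w (∑ j, γ i j * X x j a - ∑ b, Γ a b * X x i b))

include hX

/-- The Christoffel terms of the vector and of the covector cancel in the contraction. Only the
rotation of the frame and the covariant part N survive. -/
theorem hasDir_contract {S : E4 → Fin 4 → ℝ} {N : Fin 4 → ℝ}
    (hS : ∀ a, HasDir (fun y => S y a) x w (N a + ∑ f, Γ f a * S x f)) (i : Fin 4) :
    HasDir (fun y => ∑ a, X y i a * S y a) x w
      (∑ l, γ i l * ∑ a, X x l a * S x a + ∑ a, X x i a * N a) := by
  refine (HasDir.sum fun a => (hX i a).mul (hS a)).congr_val ?_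
  have h : ∑ a, ∑ b, Γ a b * X x i b * S x a = ∑ a, ∑ f, X x i a * (Γ f a * S x f) := by
    rw [Finset.sum_comm]
    exact Finset.sum_congr rfl fun a _ => Finset.sum_congr rfl fun b _ => by ring
  have h' : ∑ a, ∑ j, γ i j * X x j a * S x a = ∑ l, γ i l * ∑ a, X x l a * S x a := by
    simp only [Finset.mul_sum]
    rw [Finset.sum_comm]
    exact Finset.sum_congr rfl fun a _ => Finset.sum_congr rfl fun b _ => by ring
  simp only [sub_mul, mul_add, Finset.sum_add_distrib, Finset.sum_sub_distrib, Finset.sum_mul,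
    Finset.mul_sum] at h h' ⊢
  rw [h, h']
  ring

theorem hasDir_fr1 {T : E4 → Fin 4 → ℝ} {N : Fin 4 → ℝ}
    (hT : ∀ a, HasDir (fun y => T y a) x w (N a + ∑ f, Γ f a * T x f)) (i : Fin 4) :
    HasDir (fun y => fr1 (X y) (T y) i) x w
      (∑ l, γ i l * fr1 (X x) (T x) l + fr1 (X x) N i) :=
  hasDir_contract hX hT i

theorem hasDir_fr2 {T : E4 → Fin 4 → Fin 4 → ℝ} {N : Fin 4 → Fin 4 → ℝ}
    (hT : ∀ a b, HasDir (fun y => T y a b) x w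
      (N a b + ∑ f, Γ f a * T x f b + ∑ f, Γ f b * T x a f)) (i j : Fin 4) :
    HasDir (fun y => fr2 (X y) (T y) i j) x w
      (∑ l, γ i l * fr2 (X x) (T x) l j + ∑ l, γ j l * fr2 (X x) (T x) i l
        + fr2 (X x) N i j) := by
  have h := hasDir_contract (i := i) hX (S := fun y a => fr1 (X y) (T y a) j) (fun a => by
    refine (hasDir_fr1 hX (T := fun y => T y a) (fun b => hT a b) j).congr_val ?_
    rw [fr1_add_sum (X x) (N a) (fun f => Γ f a) (T x), ← add_assoc])
  refine h.congr_val ?_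
  have := fr1_add_sum (X x) (fun a => fr1 (X x) (N a) j) (γ j) (fun l a => fr1 (X x) (T x a) l) i
  simp only [add_comm (fr1 _ (N _) _)] at this
  simp only [fr1, fr2] at this ⊢
  rw [this]
  ring

theorem hasDir_fr3 {T : E4 → Fin 4 → Fin 4 → Fin 4 → ℝ} {N : Fin 4 → Fin 4 → Fin 4 → ℝ}
    (hT : ∀ a b c, HasDir (fun y => T y a b c) x w
      (N a b c + ∑ f, Γ f a * T x f b c + ∑ f, Γ f b * T x a f c + ∑ f, Γ f c * T x a b f))
    (i j k : Fin 4) :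
    HasDir (fun y => fr3 (X y) (T y) i j k) x w
      (∑ l, γ i l * fr3 (X x) (T x) l j k + ∑ l, γ j l * fr3 (X x) (T x) i l k
        + ∑ l, γ k l * fr3 (X x) (T x) i j l + fr3 (X x) N i j k) := by
  have h := hasDir_contract (i := i) hX (S := fun y a => fr2 (X y) (T y a) j k) (fun a => by
    refine (hasDir_fr2 hX (T := fun y => T y a) (fun b c => hT a b c) j k).congr_val ?_
    rw [fr2_add_sum (X x) (N a) (fun f => Γ f a) (T x), ← add_assoc])
  refine h.congr_val ?_
  have h1 := fr1_add_sum (X x) (fun a => fr2 (X x) (N a) j k + ∑ l, γ k l * fr2 (X x) (T x a) j l)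
    (γ j) (fun l a => fr2 (X x) (T x a) l k) i
  rw [fr1_add_sum (X x) (fun a => fr2 (X x) (N a) j k) (γ k) (fun l a => fr2 (X x) (T x a) j l)]
    at h1
  have h2 : fr1 (X x) (fun a => fr2 (X x) (N a) j k + ∑ l, γ k l * fr2 (X x) (T x a) j l
      + ∑ l, γ j l * fr2 (X x) (T x a) l k) i = ∑ a, X x i a * (∑ l, γ j l * fr2 (X x) (T x a) l k
      + ∑ l, γ k l * fr2 (X x) (T x a) j l + fr2 (X x) (N a) j k) :=
    Finset.sum_congr rfl fun a _ => by ring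
  rw [h2] at h1
  rw [h1]
  simp only [fr1, fr3]
  ring

theorem hasDir_fr4 {T : E4 → Fin 4 → Fin 4 → Fin 4 → Fin 4 → ℝ}
    {N : Fin 4 → Fin 4 → Fin 4 → Fin 4 → ℝ}
    (hT : ∀ a b c d, HasDir (fun y => T y a b c d) x w
      (N a b c d + ∑ f, Γ f a * T x f b c d + ∑ f, Γ f b * T x a f c d + ∑ f, Γ f c * T x a b f d
        + ∑ f, Γ f d * T x a b c f))
    (i j k m : Fin 4) :
    HasDir (fun y => fr4 (X y) (T y) i j k m) x w
      (∑ l, γ i l * fr4 (X x) (T x) l j k m + ∑ l, γ j l * fr4 (X x) (T x) i l k m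
        + ∑ l, γ k l * fr4 (X x) (T x) i j l m + ∑ l, γ m l * fr4 (X x) (T x) i j k l
        + fr4 (X x) N i j k m) := by
  have h := hasDir_contract (i := i) hX (S := fun y a => fr3 (X y) (T y a) j k m) (fun a => by
    refine (hasDir_fr3 hX (T := fun y => T y a) (fun b c d => hT a b c d) j k m).congr_val ?_
    rw [fr3_add_sum (X x) (N a) (fun f => Γ f a) (T x), ← add_assoc])
  refine h.congr_val ?_
  have h1 := fr1_add_sum (X x) (fun a => fr3 (X x) (N a) j k m
    + ∑ l, γ m l * fr3 (X x) (T x a) j k l + ∑ l, γ k l * fr3 (X x) (T x a) j l m)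
    (γ j) (fun l a => fr3 (X x) (T x a) l k m) i
  rw [fr1_add_sum (X x) (fun a => fr3 (X x) (N a) j k m + ∑ l, γ m l * fr3 (X x) (T x a) j k l)
      (γ k) (fun l a => fr3 (X x) (T x a) j l m),
    fr1_add_sum (X x) (fun a => fr3 (X x) (N a) j k m) (γ m) (fun l a => fr3 (X x) (T x a) j k l)]
    at h1
  have h2 : fr1 (X x) (fun a => fr3 (X x) (N a) j k m + ∑ l, γ m l * fr3 (X x) (T x a) j k l
      + ∑ l, γ k l * fr3 (X x) (T x a) j l m + ∑ l, γ j l * fr3 (X x) (T x a) l k m) i =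
      ∑ a, X x i a * (∑ l, γ j l * fr3 (X x) (T x a) l k m
      + ∑ l, γ k l * fr3 (X x) (T x a) j l m + ∑ l, γ m l * fr3 (X x) (T x a) j k l
      + fr3 (X x) (N a) j k m) :=
    Finset.sum_congr rfl fun a _ => by ring
  rw [h2] at h1
  rw [h1]
  simp only [fr1, fr4]
  ring

end Derivative

/-! ### Orthonormal frames -/

/-- The signs `(-,+,+,+)`. -/
def sg (i : Fin 4) : ℝ := if i = 0 then -1 else 1

theorem sg_mul_self (i : Fin 4) : sg i * sg i = 1 := by
  unfold sg; split_ifs <;> norm_num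

/-- `e` is an orthonormal frame of the scalar product `G`. -/
def IsFrame (G e : Fin 4 → Fin 4 → ℝ) : Prop := ∀ i j, fr2 e G i j = if i = j then sg i else 0

namespace IsFrame

variable {G e : Fin 4 → Fin 4 → ℝ} (h : IsFrame G e)

include h

/-- Orthonormality says that e G has a right inverse. For square matrices it is also a left inverse,
which is completeness of the frame. -/
theorem completeness (a b : Fin 4) :
    ∑ c, (∑ i, sg i * e i a * e i c) * G c b = if a = b then 1 else 0 := by
  let E : Matrix (Fin 4) (Fin 4) ℝ := .of e
  let S : Matrix (Fin 4) (Fin 4) ℝ := .of fun a i => e i a * sg i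
  have h1 : (E * Matrix.of G) * S = 1 := by
    ext i j
    have := h i j
    simp only [fr2, fr1] at this
    have hs : (E * Matrix.of G * S) i j = (∑ a, e i a * ∑ b, e j b * G a b) * sg j := by
      simp only [Matrix.mul_apply, E, S, Matrix.of_apply, Finset.sum_mul, Finset.mul_sum]
      rw [Finset.sum_comm]
      exact Finset.sum_congr rfl fun a _ => Finset.sum_congr rfl fun b _ => by ring
    rw [hs, this, Matrix.one_apply]
    split_ifs with hij
    · rw [hij, sg_mul_self]
    · simp
  have h2 : (S * (E * Matrix.of G)) a b = (1 : Matrix (Fin 4) (Fin 4) ℝ) a b := by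
    rw [mul_eq_one_comm.1 h1]
  rw [Matrix.one_apply] at h2
  rw [← h2, ← Matrix.mul_assoc]
  simp only [Matrix.mul_apply, E, S, Matrix.of_apply]
  refine Finset.sum_congr rfl fun c _ => ?_
  congr 1
  exact Finset.sum_congr rfl fun i _ => by ring

theorem det_ne : (Matrix.of G).det ≠ 0 := by
  have : (Matrix.of fun a c => ∑ i, sg i * e i a * e i c) * Matrix.of G = 1 := by
    ext a b
    simp only [Matrix.mul_apply, Matrix.of_apply, h.completeness a b, Matrix.one_apply]
  have := congrArg Matrix.det this
  rw [Matrix.det_mul, Matrix.det_one] at this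
  exact right_ne_zero_of_mul_eq_one this

theorem inv_eq (a b : Fin 4) : (Matrix.of G)⁻¹ a b = ∑ i, sg i * e i a * e i b := by
  have : (Matrix.of fun a c => ∑ i, sg i * e i a * e i c) * Matrix.of G = 1 := by
    ext a b
    simp only [Matrix.mul_apply, Matrix.of_apply, h.completeness a b, Matrix.one_apply]
  rw [Matrix.inv_eq_left_inv this]
  rfl

/-- Expansion of a vector in an orthonormal frame. -/
theorem expand (v : Fin 4 → ℝ) (hG : ∀ a b, G a b = G b a) (a : Fin 4) :
    ∑ i, (sg i * ∑ c, v c * ∑ b, e i b * G c b) * e i a = v a := by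
  have h1 : ∑ b, (∑ c, (∑ i, sg i * e i a * e i c) * G c b) * v b = v a := by
    simp [h.completeness]
  rw [← h1]
  simp only [Finset.sum_mul, Finset.mul_sum]
  rw [Finset.sum_comm]
  refine Finset.sum_congr rfl fun b _ => ?_
  rw [Finset.sum_comm]
  refine Finset.sum_congr rfl fun c _ => Finset.sum_congr rfl fun i _ => ?_
  rw [hG b c]
  ring

end IsFrame

end Coord

/-! ### Boosting an orthonormal frame to a given observer. -/

namespace Coord

/-- The scalar product `G_{ab} v^a w^b`. -/
def pair (G : Fin 4 → Fin 4 → ℝ) (v w : Fin 4 → ℝ) : ℝ := ∑ a, v a * ∑ b, w b * G a b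

section Pair

variable (G : Fin 4 → Fin 4 → ℝ)

theorem pair_comm (hG : ∀ a b, G a b = G b a) (v w : Fin 4 → ℝ) : pair G v w = pair G w v := by
  simp only [pair, Finset.mul_sum]
  rw [Finset.sum_comm]
  exact Finset.sum_congr rfl fun a _ => Finset.sum_congr rfl fun b _ => by rw [hG a b]; ring

theorem pair_sub_sum_left (s : Finset (Fin 4)) (p : Fin 4 → ℝ) (c : Fin 4 → ℝ)
    (q : Fin 4 → Fin 4 → ℝ) (w : Fin 4 → ℝ) :
    pair G (fun a => p a - ∑ i ∈ s, c i * q i a) w = pair G p w - ∑ i ∈ s, c i * pair G (q i) w := by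
  simp only [pair, sub_mul, Finset.sum_sub_distrib]
  congr 1
  simp only [Finset.sum_mul]
  rw [Finset.sum_comm]
  refine Finset.sum_congr rfl fun i _ => ?_
  simp only [Finset.mul_sum]
  exact Finset.sum_congr rfl fun a _ => Finset.sum_congr rfl fun b _ => by ring

theorem pair_mul_left (r : ℝ) (v w : Fin 4 → ℝ) :
    pair G (fun a => r * v a) w = r * pair G v w := by
  simp only [pair, Finset.mul_sum]
  exact Finset.sum_congr rfl fun a _ => Finset.sum_congr rfl fun b _ => by ring

theorem pair_mul_right (r : ℝ) (v w : Fin 4 → ℝ) :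
    pair G v (fun a => r * w a) = r * pair G v w := by
  simp only [pair, Finset.mul_sum]
  exact Finset.sum_congr rfl fun a _ => Finset.sum_congr rfl fun b _ => by ring

/-- Composition of frame changes; it reduces orthonormality of a transformed frame to a statement
about the matrix Λ. -/
theorem fr2_mul (e Λ : Fin 4 → Fin 4 → ℝ) (i j : Fin 4) :
    fr2 (fun i a => ∑ k, Λ i k * e k a) G i j = fr2 Λ (fr2 e G) i j := by
  have h1 (T : Fin 4 → ℝ) (j : Fin 4) :
      fr1 (fun i a => ∑ k, Λ i k * e k a) T j = fr1 Λ (fr1 e T) j := by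
    simp only [fr1, Finset.sum_mul, Finset.mul_sum]
    rw [Finset.sum_comm]
    exact Finset.sum_congr rfl fun a _ => Finset.sum_congr rfl fun b _ => by ring
  have h2 (T : Fin 4 → Fin 4 → ℝ) (k : Fin 4) :
      fr1 e (fun a => fr1 Λ (fr1 e (T a)) j) k = fr1 Λ (fr2 e T k) j := by
    simp only [fr2, fr1, Finset.mul_sum]
    rw [Finset.sum_comm]
    exact Finset.sum_congr rfl fun a _ => Finset.sum_congr rfl fun b _ =>
      Finset.sum_congr rfl fun c _ => by ring
  calc fr2 (fun i a => ∑ k, Λ i k * e k a) G i j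
      = fr1 (fun i a => ∑ k, Λ i k * e k a) (fun a => fr1 Λ (fr1 e (G a)) j) i :=
        Finset.sum_congr rfl fun a _ => by rw [h1]
    _ = fr1 Λ (fr1 e (fun a => fr1 Λ (fr1 e (G a)) j)) i := h1 _ _
    _ = fr2 Λ (fr2 e G) i j := Finset.sum_congr rfl fun k _ => by rw [h2]

end Pair

/-- An orthonormal frame whose timelike vector is a given unit timelike vector. -/
theorem exists_isFrame_eq {G e : Fin 4 → Fin 4 → ℝ} (he : IsFrame G e) (hG : ∀ a b, G a b = G b a)
    {u : Fin 4 → ℝ} (hu : pair G u u = -1) : ∃ e', IsFrame G e' ∧ e' 0 = u := by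
  have key : ∀ e, IsFrame G e → 0 < -pair G u (e 0) → ∃ e', IsFrame G e' ∧ e' 0 = u := by
    intro e he hpos
    -- The components of u in the frame; `hs` below is g(u,u) = -1 in terms of them.
    let t (i : Fin 4) : ℝ := sg i * pair G u (e i)
    have hexp (a : Fin 4) : ∑ i, t i * e i a = u a := he.expand u hG a
    have hdiag : fr2 e G = fun i j => if i = j then sg i else 0 := by
      ext i j; exact he i j
    have hs : t 1 ^ 2 + t 2 ^ 2 + t 3 ^ 2 = t 0 ^ 2 - 1 := by
      have h := fr2_mul G e (fun _ i => t i) 0 0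
      simp only [hexp, hdiag] at h
      change pair G u u = _ at h
      rw [hu] at h
      simp [fr2, fr1, sg, Fin.sum_univ_four] at h
      linarith
    have ht0 : 0 < t 0 := by simpa [t, sg] using hpos
    obtain ⟨q, hq⟩ : ∃ q : ℝ, q * (1 + t 0) = 1 := ⟨(1 + t 0)⁻¹, inv_mul_cancel₀ (by linarith)⟩
    -- The pure boost taking e_0 to u. Its spatial block is δ + t⊗t/(1 + t_0), and t_0 > 0
    -- guarantees that the denominator is nonzero.
    let Λ (i k : Fin 4) : ℝ := if i = 0 then t k else if k = 0 then t i else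
      (if i = k then 1 else 0) + q * t i * t k
    refine ⟨fun i a => ∑ k, Λ i k * e k a, fun i j => ?_, ?_⟩
    · rw [fr2_mul, hdiag]
      have h2 : fr2 Λ (fun i j => if i = j then sg i else 0) i j
          = -(Λ i 0 * Λ j 0) + Λ i 1 * Λ j 1 + Λ i 2 * Λ j 2 + Λ i 3 * Λ j 3 := by
        simp [fr2, fr1, sg, Fin.sum_univ_four]
      rw [h2]
      have h00 (i : Fin 4) : Λ 0 i = t i := by simp [Λ]
      have h0 (i : Fin 4) (hi : i ≠ 0) : Λ i 0 = t i := by simp [Λ, hi]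
      have hij (i j : Fin 4) (hi : i ≠ 0) (hj : j ≠ 0) :
          Λ i j = (if i = j then 1 else 0) + q * t i * t j := by simp [Λ, hi, hj]
      have e0 (j : Fin 4) (hj : j ≠ 0) :
          -(Λ 0 0 * Λ j 0) + Λ 0 1 * Λ j 1 + Λ 0 2 * Λ j 2 + Λ 0 3 * Λ j 3 = 0 := by
        rw [h00, h00, h00, h00, h0 j hj, hij j 1 hj (by decide), hij j 2 hj (by decide),
          hij j 3 hj (by decide)]
        have : (t 1 * if j = 1 then 1 else 0) + (t 2 * if j = 2 then 1 else 0)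
          + (t 3 * if j = 3 then 1 else 0) = t j := by
          fin_cases j <;> simp at hj ⊢
        linear_combination this + q * t j * hs + (t 0 - 1) * t j * hq
      by_cases hi : i = 0
      · by_cases hj : j = 0
        · subst hi hj
          simp only [h00, sg, if_true]
          linear_combination hs
        · subst hi
          rw [e0 j hj, if_neg (Ne.symm hj)]
      · by_cases hj : j = 0
        · subst hj
          rw [if_neg hi, ← e0 i hi]
          ring
        · rw [h0 i hi, h0 j hj, hij i 1 hi (by decide), hij i 2 hi (by decide),
            hij i 3 hi (by decide), hij j 1 hj (by decide), hij j 2 hj (by decide),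
            hij j 3 hj (by decide)]
          have hδ (i j : Fin 4) (hi : i ≠ 0) : (t 1 * if i = 1 then 1 else 0)
            + (t 2 * if i = 2 then 1 else 0) + (t 3 * if i = 3 then 1 else 0) = t i := by
            fin_cases i <;> simp at hi ⊢
          have hδ' : ((if i = 1 then 1 else 0) * if j = 1 then 1 else 0)
            + ((if i = 2 then 1 else 0) * if j = 2 then 1 else 0)
            + ((if i = 3 then 1 else 0) * if j = 3 then 1 else 0)
            = if i = j then sg i else 0 := by
            fin_cases i <;> fin_cases j <;> simp [sg] at hi hj ⊢
          linear_combination hδ' + q * t i * hδ j i hj + q * t j * hδ i j hi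
            + t i * t j * (q ^ 2 * hs + (q * (t 0 - 1) + 1) * hq)
    · ext a
      simpa [Λ] using hexp a
  -- With t_0 = 0 the vector u would be spatial and could not have square -1.
  have h0 : pair G u (e 0) ≠ 0 := by
    intro h0
    let t (i : Fin 4) : ℝ := sg i * pair G u (e i)
    have hexp (a : Fin 4) : ∑ i, t i * e i a = u a := he.expand u hG a
    have hdiag : fr2 e G = fun i j => if i = j then sg i else 0 := by
      ext i j; exact he i j
    have h := fr2_mul G e (fun _ i => t i) 0 0
    simp only [hexp, hdiag] at h
    change pair G u u = _ at h
    rw [hu] at h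
    have ht0 : t 0 = 0 := by simp [t, h0]
    simp [fr2, fr1, sg, Fin.sum_univ_four, ht0] at h
    nlinarith [sq_nonneg (t 1), sq_nonneg (t 2), sq_nonneg (t 3)]
  rcases lt_or_gt_of_ne h0 with hneg | hpos
  · exact key e he (by linarith)
  -- If u and e_0 have opposite time orientations, reverse e_0.
  · let ε (i : Fin 4) : ℝ := if i = 0 then -1 else 1
    refine key (fun i a => ε i * e i a) (fun i j => ?_) ?_
    · change pair G _ _ = _
      rw [pair_mul_left, pair_mul_right]
      have := he i j
      change pair G _ _ = _ at this
      rw [this]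
      split_ifs with hij
      · subst hij
        by_cases hi : i = 0 <;> simp [ε, hi]
      · simp
    · rw [pair_mul_right]
      simpa [ε] using hpos

end Coord

/-! ### Local data and differentiable adapted frame fields. -/

namespace LocalData

open Coord

/-- `L` consists of a smooth Lorentzian metric, a metric volume form and a unit timelike vector
field on the open set `U`. -/
structure IsRegularOn (L : LocalData) (U : Set E4) : Prop where
  isOpen : IsOpen U
  smooth_g : ∀ i j, ContDiffOn ℝ ∞ (fun x => L.g x i j) U
  smooth_u : ∀ i, ContDiffOn ℝ ∞ (fun x => L.u x i) U
  smooth_vol : ∀ i j k l, ContDiffOn ℝ ∞ (fun x => L.vol x i j k l) U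
  symm : ∀ x ∈ U, ∀ i j, L.g x i j = L.g x j i
  exists_frame : ∀ x ∈ U, ∃ e, IsFrame (L.g x) e
  unit : ∀ x ∈ U, pair (L.g x) (L.u x) (L.u x) = -1
  vol_swap₁ : ∀ x ∈ U, ∀ i j k l, L.vol x j i k l = -L.vol x i j k l
  vol_swap₂ : ∀ x ∈ U, ∀ i j k l, L.vol x i k j l = -L.vol x i j k l
  vol_swap₃ : ∀ x ∈ U, ∀ i j k l, L.vol x i j l k = -L.vol x i j k l
  vol_sq : ∀ x ∈ U, ∀ e, IsFrame (L.g x) e → fr4 e (L.vol x) 0 1 2 3 ^ 2 = 1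

/-- An orthonormal frame at the point `x` whose timelike vector is the observer. -/
structure IsAdapted (L : LocalData) (x : E4) (e : Fin 4 → Fin 4 → ℝ) : Prop where
  isFrame : IsFrame (L.g x) e
  zero : e 0 = L.u x

variable {L : LocalData} {U : Set E4} (hL : L.IsRegularOn U) {x : E4} (hx : x ∈ U)

namespace IsRegularOn

include hL

theorem isMetricOn : IsMetricOn L.g U where
  isOpen := hL.isOpen
  smooth := hL.smooth_g
  symm := hL.symm
  det_ne x hx := (hL.exists_frame x hx).choose_spec.det_ne

include hx

theorem exists_isAdapted : ∃ e, L.IsAdapted x e := by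
  obtain ⟨e, he⟩ := hL.exists_frame x hx
  obtain ⟨e', he', h0⟩ := exists_isFrame_eq he (hL.symm x hx) (hL.unit x hx)
  exact ⟨e', he', h0⟩

theorem differentiableAt_pair {v w : E4 → Fin 4 → ℝ}
    (hv : ∀ a, DifferentiableAt ℝ (fun y => v y a) x)
    (hw : ∀ a, DifferentiableAt ℝ (fun y => w y a) x) :
    DifferentiableAt ℝ (fun y => pair (L.g y) (v y) (w y)) x :=
  .fun_sum fun a _ => (hv a).fun_mul <| .fun_sum fun b _ => (hw b).fun_mul <|
    differentiableAt_of_contDiffOn hL.isOpen (hL.smooth_g a b) hx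

/-- One step of the Gram–Schmidt process. -/
theorem gramSchmidt_step {e : Fin 4 → Fin 4 → ℝ} (he : L.IsAdapted x e) (s : Finset (Fin 4))
    (h0 : 0 ∈ s) (k : Fin 4) (hk : k ∉ s)
    (hX : ∃ X : E4 → Fin 4 → Fin 4 → ℝ, X x = e ∧
      (∀ i a, DifferentiableAt ℝ (fun y => X y i a) x) ∧
      ∀ᶠ y in nhds x, (∀ i ∈ s, ∀ j ∈ s, pair (L.g y) (X y i) (X y j) = if i = j then sg i else 0)
        ∧ X y 0 = L.u y) :
    ∃ X : E4 → Fin 4 → Fin 4 → ℝ, X x = e ∧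
      (∀ i a, DifferentiableAt ℝ (fun y => X y i a) x) ∧
      ∀ᶠ y in nhds x, (∀ i ∈ insert k s, ∀ j ∈ insert k s,
        pair (L.g y) (X y i) (X y j) = if i = j then sg i else 0) ∧ X y 0 = L.u y := by
  obtain ⟨X, hXx, hXd, hXe⟩ := hX
  have hk0 : k ≠ 0 := fun h => hk (h ▸ h0)
  have hee (i j : Fin 4) : pair (L.g x) (e i) (e j) = if i = j then sg i else 0 := he.isFrame i j
  -- The sign divides by the square ±1 of X_i. At x itself the frame is already orthonormal, so the
  -- corrections vanish and the normalising factor is 1: the prescribed value e is not disturbed.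
  let c (y : E4) (i : Fin 4) : ℝ := sg i * pair (L.g y) (X y k) (X y i)
  let v (y : E4) (a : Fin 4) : ℝ := X y k a - ∑ i ∈ s, c y i * X y i a
  have hvd (a : Fin 4) : DifferentiableAt ℝ (fun y => v y a) x :=
    (hXd k a).fun_sub <| .fun_sum fun i _ =>
      ((differentiableAt_const _).fun_mul (hL.differentiableAt_pair hx (hXd k) (hXd i))).fun_mul
        (hXd i a)
  have hvx : v x = e k := by
    ext a
    simp only [v, c, hXx, hee]
    rw [Finset.sum_eq_zero, sub_zero]
    intro i hi
    rw [if_neg (fun h : k = i => hk (h ▸ hi))]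
    simp
  have hn1 : pair (L.g x) (v x) (v x) = 1 := by
    rw [hvx, hee]; simp [sg, hk0]
  have hnd : DifferentiableAt ℝ (fun y => pair (L.g y) (v y) (v y)) x :=
    hL.differentiableAt_pair hx hvd hvd
  let r (y : E4) : ℝ := (√(pair (L.g y) (v y) (v y)))⁻¹
  have hrd : DifferentiableAt ℝ r x :=
    (hnd.sqrt (by simp [hn1])).inv (by simp [hn1])
  refine ⟨fun y => Function.update (X y) k (fun a => r y * v y a), ?_, fun i a => ?_, ?_⟩
  · ext i a
    by_cases hi : i = k
    · subst hi
      have hr : r x = 1 := by simp only [r]; rw [hn1]; simp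
      simp [hr, hvx]
    · simp [Function.update_of_ne hi, hXx]
  · by_cases hi : i = k
    · subst hi
      simpa using hrd.fun_mul (hvd a)
    · simpa [Function.update_of_ne hi] using hXd i a
  · have hpos : ∀ᶠ y in nhds x, 0 < pair (L.g y) (v y) (v y) :=
      hnd.continuousAt.eventually_const_lt (hn1 ▸ one_pos : 0 < pair (L.g x) (v x) (v x))
    filter_upwards [hXe, hpos, hL.isOpen.mem_nhds hx] with y hy hpy hyU
    have hvj (j : Fin 4) (hj : j ∈ s) : pair (L.g y) (v y) (X y j) = 0 := by
      simp only [v]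
      rw [pair_sub_sum_left, Finset.sum_eq_single j]
      · rw [hy.1 j hj j hj]
        simp only [c, if_true]
        linear_combination -pair (L.g y) (X y k) (X y j) * sg_mul_self j
      · intro i hi hij
        rw [hy.1 i hi j hj, if_neg hij, mul_zero]
      · exact fun h => absurd hj h
    have hvv : pair (L.g y) (fun a => r y * v y a) (fun a => r y * v y a) = 1 := by
      rw [pair_mul_left, pair_mul_right, ← mul_assoc]
      simp only [r]
      rw [← mul_inv, Real.mul_self_sqrt hpy.le]
      exact inv_mul_cancel₀ hpy.ne'
    have hne (j : Fin 4) (hj : j ∈ s) : j ≠ k := fun h => hk (h ▸ hj)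
    refine ⟨fun i hi j hj => ?_, by simpa [Function.update_of_ne hk0.symm] using hy.2⟩
    rcases Finset.mem_insert.1 hi with rfl | hi'
    · rcases Finset.mem_insert.1 hj with rfl | hj'
      · simp [hvv, sg, hk0]
      · rw [Function.update_self, Function.update_of_ne (hne j hj'), pair_mul_left, hvj j hj',
          if_neg (hne j hj').symm, mul_zero]
    · rcases Finset.mem_insert.1 hj with rfl | hj'
      · rw [Function.update_self, Function.update_of_ne (hne i hi'), pair_mul_right,
          pair_comm _ (hL.symm y hyU), hvj i hi', if_neg (hne i hi'), mul_zero]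
      · rw [Function.update_of_ne (hne i hi'), Function.update_of_ne (hne j hj'), hy.1 i hi' j hj']

/-- A differentiable adapted frame field with a given value at a point. -/
theorem exists_frameField {e : Fin 4 → Fin 4 → ℝ} (he : L.IsAdapted x e) :
    ∃ X : E4 → Fin 4 → Fin 4 → ℝ, X x = e ∧
      (∀ i a, DifferentiableAt ℝ (fun y => X y i a) x) ∧
      ∀ᶠ y in nhds x, L.IsAdapted y (X y) := by
  have h0 : ∃ X : E4 → Fin 4 → Fin 4 → ℝ, X x = e ∧
      (∀ i a, DifferentiableAt ℝ (fun y => X y i a) x) ∧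
      ∀ᶠ y in nhds x, (∀ i ∈ ({0} : Finset (Fin 4)), ∀ j ∈ ({0} : Finset (Fin 4)),
        pair (L.g y) (X y i) (X y j) = if i = j then sg i else 0) ∧ X y 0 = L.u y := by
    -- The starting field is u itself, with the other three vectors extended by constant components.
    refine ⟨fun y => Function.update e 0 (L.u y), ?_, fun i a => ?_, ?_⟩
    · change Function.update e 0 (L.u x) = e
      rw [← he.zero]; simp
    · by_cases hi : i = 0
      · subst hi
        simpa using differentiableAt_of_contDiffOn hL.isOpen (hL.smooth_u a) hx
      · simp [Function.update_of_ne hi]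
    · filter_upwards [hL.isOpen.mem_nhds hx] with y hy
      simpa [sg] using hL.unit y hy
  have h1 := hL.gramSchmidt_step hx he _ (by simp) 1 (by simp) h0
  have h2 := hL.gramSchmidt_step hx he _ (by simp) 2 (by decide) h1
  have h3 := hL.gramSchmidt_step hx he _ (by simp) 3 (by decide) h2
  obtain ⟨X, hXx, hXd, hXe⟩ := h3
  refine ⟨X, hXx, hXd, ?_⟩
  filter_upwards [hXe] with y hy
  refine ⟨fun i j => hy.1 i ?_ j ?_, hy.2⟩
  · fin_cases i <;> simp
  · fin_cases j <;> simp

end IsRegularOn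

end LocalData

/-! ### Contractions as signed sums over frame indices. -/

namespace Coord

section Contraction

variable (e : Fin 4 → Fin 4 → ℝ)

theorem fr1_comm (S : Fin 4 → Fin 4 → ℝ) (i j : Fin 4) :
    fr1 e (fun a => fr1 e (fun b => S a b) j) i = fr1 e (fun b => fr1 e (fun a => S a b) i) j := by
  simp only [fr1, Finset.mul_sum]
  rw [Finset.sum_comm]
  exact Finset.sum_congr rfl fun a _ => Finset.sum_congr rfl fun b _ => by ring

theorem fr2_swap (S : Fin 4 → Fin 4 → ℝ) (i j : Fin 4) :
    fr2 e (fun a b => S b a) i j = fr2 e S j i :=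
  fr1_comm e (fun a b => S b a) i j

theorem fr1_sum_sum (c : Fin 4 → Fin 4 → ℝ) (P : Fin 4 → Fin 4 → Fin 4 → ℝ) (i : Fin 4) :
    fr1 e (fun a => ∑ m, ∑ n, c m n * P a m n) i =
      ∑ m, ∑ n, c m n * fr1 e (fun a => P a m n) i := by
  simp only [fr1, Finset.mul_sum]
  rw [Finset.sum_comm]
  refine Finset.sum_congr rfl fun m _ => ?_
  rw [Finset.sum_comm]
  exact Finset.sum_congr rfl fun n _ => Finset.sum_congr rfl fun a _ => by ring

theorem fr1_const_mul (r : ℝ) (S : Fin 4 → ℝ) (i : Fin 4) :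
    fr1 e (fun a => r * S a) i = r * fr1 e S i := by
  simp only [fr1, Finset.mul_sum]
  exact Finset.sum_congr rfl fun a _ => by ring

theorem fr1_add (S T : Fin 4 → ℝ) (i : Fin 4) :
    fr1 e (fun a => S a + T a) i = fr1 e S i + fr1 e T i := by
  simp only [fr1, mul_add, Finset.sum_add_distrib]

theorem fr2_const_mul (r : ℝ) (S : Fin 4 → Fin 4 → ℝ) (i j : Fin 4) :
    fr2 e (fun a b => r * S a b) i j = r * fr2 e S i j := by
  simp only [fr2, fr1_const_mul]
  exact fr1_const_mul e r (fun a => fr1 e (S a) j) i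

theorem fr2_add (S T : Fin 4 → Fin 4 → ℝ) (i j : Fin 4) :
    fr2 e (fun a b => S a b + T a b) i j = fr2 e S i j + fr2 e T i j := by
  simp only [fr2, fr1_add]
  exact fr1_add e (fun a => fr1 e (S a) j) (fun a => fr1 e (T a) j) i

theorem fr2_mul_fr1 (v w : Fin 4 → ℝ) (i j : Fin 4) :
    fr2 e (fun a b => v a * w b) i j = fr1 e v i * fr1 e w j := by
  simp only [fr2, fr1_const_mul]
  simp only [fr1, Finset.sum_mul]
  exact Finset.sum_congr rfl fun a _ => by ring

theorem fr2_sum_sum_mul (c : Fin 4 → Fin 4 → ℝ) (P Q : Fin 4 → Fin 4 → Fin 4 → ℝ)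
    (i j : Fin 4) : fr2 e (fun a b => ∑ m, ∑ n, c m n * (P a m n * Q b m n)) i j =
      ∑ m, ∑ n, c m n * (fr1 e (fun a => P a m n) i * fr1 e (fun b => Q b m n) j) := by
  have h (a : Fin 4) : fr1 e (fun b => ∑ m, ∑ n, c m n * (P a m n * Q b m n)) j =
      ∑ m, ∑ n, (c m n * fr1 e (fun b => Q b m n) j) * P a m n := by
    rw [fr1_sum_sum e c (fun b m n => P a m n * Q b m n)]
    refine Finset.sum_congr rfl fun m _ => Finset.sum_congr rfl fun n _ => ?_
    rw [fr1_const_mul]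
    ring
  unfold fr2
  simp only [h]
  refine (fr1_sum_sum e (fun m n => c m n * fr1 e (fun b => Q b m n) j) P i).trans ?_
  exact Finset.sum_congr rfl fun m _ => Finset.sum_congr rfl fun n _ => by ring

variable {e} {I : Fin 4 → Fin 4 → ℝ} (hI : ∀ a b, I a b = ∑ i, sg i * e i a * e i b)

include hI

/-- The hypothesis on I is the expansion of the inverse metric in an orthonormal frame, so raising
an index costs only a sign in frame components. -/
theorem sum_raise (S : Fin 4 → ℝ) (b : Fin 4) :
    ∑ i, I b i * S i = ∑ m, sg m * e m b * fr1 e S m := by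
  simp only [hI, fr1, Finset.sum_mul, Finset.mul_sum]
  rw [Finset.sum_comm]
  exact Finset.sum_congr rfl fun a _ => Finset.sum_congr rfl fun b _ => by ring

theorem sum_contract (S : Fin 4 → Fin 4 → ℝ) :
    ∑ a, ∑ b, I a b * S a b = ∑ m, sg m * fr2 e S m m := by
  simp only [sum_raise hI (S _)]
  rw [Finset.sum_comm]
  refine Finset.sum_congr rfl fun m _ => ?_
  simp only [fr2, Finset.mul_sum]
  exact Finset.sum_congr rfl fun b _ => by ring

theorem sum_raise_raise (S : Fin 4 → Fin 4 → ℝ) (b c : Fin 4) :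
    ∑ i, ∑ j, I b i * I c j * S i j =
      ∑ m, ∑ n, sg m * sg n * (e m b * e n c * fr2 e S m n) := by
  have h (i : Fin 4) : ∑ j, I b i * I c j * S i j = I b i * ∑ n, sg n * e n c * fr1 e (S i) n := by
    rw [← sum_raise hI, Finset.mul_sum]
    exact Finset.sum_congr rfl fun j _ => by ring
  simp only [h]
  rw [sum_raise hI]
  refine Finset.sum_congr rfl fun m _ => ?_
  have := fr1_add_sum e (fun _ => 0) (fun n => sg n * e n c) (fun n i => fr1 e (S i) n) m
  simp only [zero_add] at this
  rw [this]
  have h0 : fr1 e (fun _ => 0) m = 0 := by simp [fr1]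
  rw [h0, zero_add, Finset.mul_sum]
  exact Finset.sum_congr rfl fun n _ => by
    change _ * (_ * fr2 e S m n) = _
    ring

theorem sum_raise_raise_mul (S T : Fin 4 → Fin 4 → ℝ) :
    ∑ b, ∑ c, (∑ i, ∑ j, I b i * I c j * S i j) * T b c =
      ∑ m, ∑ n, sg m * sg n * (fr2 e S m n * fr2 e T m n) := by
  simp only [sum_raise_raise hI, Finset.sum_mul]
  have h (m n : Fin 4) : sg m * sg n * (fr2 e S m n * fr2 e T m n) =
      ∑ b, ∑ c, sg m * sg n * (e m b * e n c * fr2 e S m n) * T b c := by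
    rw [show fr2 e T m n = ∑ b, e m b * ∑ c, e n c * T b c from rfl]
    simp only [Finset.mul_sum]
    exact Finset.sum_congr rfl fun b _ => Finset.sum_congr rfl fun c _ => by ring
  simp only [h]
  have h4 (F : Fin 4 → Fin 4 → Fin 4 → Fin 4 → ℝ) :
      ∑ b, ∑ c, ∑ m, ∑ n, F b c m n = ∑ m, ∑ n, ∑ b, ∑ c, F b c m n := by
    have h3 (G : Fin 4 → Fin 4 → Fin 4 → ℝ) :
        ∑ c, ∑ m, ∑ n, G c m n = ∑ m, ∑ n, ∑ c, G c m n := by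
      rw [Finset.sum_comm]
      exact Finset.sum_congr rfl fun m _ => Finset.sum_comm
    simp only [h3 (F _)]
    exact h3 fun b m n => ∑ c, F b c m n
  exact h4 fun b c m n => sg m * sg n * (e m b * e n c * fr2 e S m n) * T b c

end Contraction

end Coord

/-! ### The 1+3 quantities in an adapted frame. -/

namespace LocalData

open Coord

variable {L : LocalData} {U : Set E4} {x : E4}

namespace IsAdapted

variable {e : Fin 4 → Fin 4 → ℝ} (he : L.IsAdapted x e)

include he

theorem inv_eq (a b : Fin 4) : inv L.g x a b = ∑ i, sg i * e i a * e i b := he.isFrame.inv_eq a b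

theorem fr1_uLow (i : Fin 4) : fr1 e (L.uLow x) i = if i = 0 then -1 else 0 := by
  have h := he.isFrame i 0
  have : fr1 e (L.uLow x) i = fr2 e (L.g x) i 0 := by
    simp only [fr1, fr2, uLow, ← he.zero]
    exact Finset.sum_congr rfl fun a _ => by
      congr 1
      exact Finset.sum_congr rfl fun b _ => by ring
  rw [this, h]
  split_ifs with h0 <;> simp [sg, h0]

theorem fr1_proj (i c : Fin 4) : fr1 e (fun a => L.proj x c a) i = if i = 0 then 0 else e i c := by
  have h : fr1 e (fun a => L.proj x c a) i = e i c + L.u x c * fr1 e (L.uLow x) i := by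
    simp [fr1, proj, mul_add, Finset.sum_add_distrib, Finset.mul_sum]
    exact Finset.sum_congr rfl fun a _ => by ring
  rw [h, he.fr1_uLow, ← he.zero]
  split_ifs with h0
  · subst h0; ring
  · ring

/-- The spatial projector kills e_0 = u and fixes the other frame vectors, so projecting a tensor
amounts to deleting its components with an index 0. -/
theorem fr2_proj_proj (N : Fin 4 → Fin 4 → ℝ) (i j : Fin 4) :
    fr2 e (fun a b => ∑ c, ∑ d, L.proj x c a * L.proj x d b * N c d) i j =
      if i = 0 ∨ j = 0 then 0 else fr2 e N i j := by
  have h := fr2_sum_sum_mul e N (fun a c _ => L.proj x c a) (fun b _ d => L.proj x d b) i j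
  simp only [he.fr1_proj] at h
  have h' : (fun a b => ∑ c, ∑ d, L.proj x c a * L.proj x d b * N c d) =
      fun a b => ∑ c, ∑ d, N c d * (L.proj x c a * L.proj x d b) := by
    ext a b
    exact Finset.sum_congr rfl fun c _ => Finset.sum_congr rfl fun d _ => by ring
  rw [h', h]
  by_cases hi : i = 0
  · simp [hi]
  · by_cases hj : j = 0
    · simp [hj]
    · simp only [hi, hj, or_self, if_false, fr2, fr1, Finset.mul_sum]
      exact Finset.sum_congr rfl fun c _ => Finset.sum_congr rfl fun d _ => by ring

theorem fr2_D1 (v : E4 → Fin 4 → ℝ) (i j : Fin 4) :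
    fr2 e (L.D1 v x) i j = if i = 0 ∨ j = 0 then 0 else fr2 e (nabla1 L.g v x) i j :=
  he.fr2_proj_proj _ i j

theorem fr3_D2 (T : E4 → Fin 4 → Fin 4 → ℝ) (k i j : Fin 4) :
    fr3 e (L.D2 T x) k i j =
      if k = 0 ∨ i = 0 ∨ j = 0 then 0 else fr3 e (nabla2 L.g T x) k i j := by
  have h (c : Fin 4) : fr2 e (L.D2 T x c) i j = ∑ f, L.proj x f c *
      (if i = 0 ∨ j = 0 then 0 else fr2 e (nabla2 L.g T x f) i j) := by
    simp only [← he.fr2_proj_proj]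
    have h1 : L.D2 T x c = fun a b => ∑ f, L.proj x f c *
        ∑ d, ∑ e', L.proj x d a * L.proj x e' b * nabla2 L.g T x f d e' := by
      ext a b
      simp only [D2, Finset.mul_sum]
      exact Finset.sum_congr rfl fun f _ => Finset.sum_congr rfl fun d _ =>
        Finset.sum_congr rfl fun e' _ => by ring
    rw [h1]
    have := fr2_add_sum e (fun _ _ => 0) (fun f => L.proj x f c) (fun f a b =>
      ∑ d, ∑ e', L.proj x d a * L.proj x e' b * nabla2 L.g T x f d e') i j
    simp only [zero_add] at this
    rw [this]
    simp [fr2, fr1]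
  have h' : fr3 e (L.D2 T x) k i j = ∑ f, fr1 e (fun c => L.proj x f c) k *
      (if i = 0 ∨ j = 0 then 0 else fr2 e (nabla2 L.g T x f) i j) := by
    simp only [fr3, h, fr1, Finset.mul_sum, Finset.sum_mul]
    rw [Finset.sum_comm]
    exact Finset.sum_congr rfl fun a _ => Finset.sum_congr rfl fun b _ => by ring
  rw [h']
  simp only [he.fr1_proj]
  by_cases hk : k = 0
  · simp [hk]
  · by_cases hij : i = 0 ∨ j = 0
    · simp [hij]
    · simp [hk, hij, fr3]

theorem inner2_eq (A B : Fin 4 → Fin 4 → ℝ) :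
    inner2 L.g x A B = ∑ i, ∑ j, sg i * sg j * (fr2 e A i j * fr2 e B i j) := by
  rw [show (∑ i, ∑ j, sg i * sg j * (fr2 e A i j * fr2 e B i j)) =
    ∑ i, ∑ j, sg i * sg j * (fr2 e B i j * fr2 e A i j) from
      Finset.sum_congr rfl fun i _ => Finset.sum_congr rfl fun j _ => by ring,
    ← sum_raise_raise_mul he.inv_eq]
  unfold inner2
  refine Finset.sum_congr rfl fun a _ => Finset.sum_congr rfl fun b _ => ?_
  simp only [Finset.sum_mul]
  exact Finset.sum_congr rfl fun c _ => Finset.sum_congr rfl fun d _ => by ring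

theorem traceSq_eq (A : Fin 4 → Fin 4 → ℝ) :
    traceSq L.g x A = ∑ i, ∑ j, sg i * sg j * (fr2 e A i j * fr2 e A j i) := by
  rw [show (∑ i, ∑ j, sg i * sg j * (fr2 e A i j * fr2 e A j i)) =
    ∑ i, ∑ j, sg i * sg j * (fr2 e A i j * fr2 e (fun a b => A b a) i j) by simp only [fr2_swap],
    ← sum_raise_raise_mul he.inv_eq]
  have h (a b : Fin 4) : (∑ c, inv L.g x a c * A c b) * (∑ d, inv L.g x b d * A d a) =
      ∑ c, ∑ d, (inv L.g x a c * A c b) * (inv L.g x b d * A d a) := by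
    rw [Finset.sum_mul_sum]
  have h4 (F : Fin 4 → Fin 4 → Fin 4 → Fin 4 → ℝ) :
      ∑ a, ∑ b, ∑ c, ∑ d, F a b c d = ∑ a, ∑ d, ∑ c, ∑ b, F a b c d := by
    refine Finset.sum_congr rfl fun a _ => ?_
    rw [Finset.sum_comm]
    simp only [Finset.sum_comm (s := Finset.univ) (t := Finset.univ) (f := fun b d => F a b _ d)]
    rw [Finset.sum_comm]
  unfold traceSq
  simp only [h]
  rw [h4]
  refine Finset.sum_congr rfl fun a _ => Finset.sum_congr rfl fun d _ => ?_
  simp only [Finset.sum_mul]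
  refine Finset.sum_congr rfl fun c _ => Finset.sum_congr rfl fun b _ => ?_
  have : inv L.g x d b = inv L.g x b d := by
    rw [he.inv_eq, he.inv_eq]
    exact Finset.sum_congr rfl fun i _ => by ring
  rw [this]
  ring

theorem fr3_eps (i j k : Fin 4) : fr3 e (L.eps x) i j k = fr4 e (L.vol x) i j k 0 := by
  have : L.eps x = fun a b c => fr1 e (L.vol x a b c) 0 := by
    ext a b c
    simp only [eps, fr1, he.zero]
    exact Finset.sum_congr rfl fun d _ => by ring
  rw [this]
  rfl

theorem sum_epsUp_mul (T : Fin 4 → Fin 4 → ℝ) (a : Fin 4) :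
    ∑ b, ∑ c, L.epsUp x a b c * T b c =
      ∑ m, ∑ n, sg m * sg n * (fr2 e (L.eps x a) m n * fr2 e T m n) :=
  sum_raise_raise_mul he.inv_eq _ _

theorem fr1_vorticity (i : Fin 4) : fr1 e (L.vorticity x) i =
    -(∑ m, ∑ n, sg m * sg n * (fr4 e (L.vol x) i m n 0 * fr2 e (L.D1 L.uLow x) m n)) / 2 := by
  have h : L.vorticity x = fun a => (-1 / 2) * ∑ m, ∑ n, (sg m * sg n *
      fr2 e (L.D1 L.uLow x) m n) * fr2 e (L.eps x a) m n := by
    ext a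
    have : ∑ m, ∑ n, sg m * sg n * (fr2 e (L.eps x a) m n * fr2 e (L.D1 L.uLow x) m n) =
        ∑ m, ∑ n, (sg m * sg n * fr2 e (L.D1 L.uLow x) m n) * fr2 e (L.eps x a) m n :=
      Finset.sum_congr rfl fun m _ => Finset.sum_congr rfl fun n _ => by ring
    rw [vorticity, he.sum_epsUp_mul, this]
    ring
  have h' : ∑ m, ∑ n, (sg m * sg n * fr2 e (L.D1 L.uLow x) m n) *
      fr1 e (fun a => fr2 e (L.eps x a) m n) i =
      ∑ m, ∑ n, sg m * sg n * (fr4 e (L.vol x) i m n 0 * fr2 e (L.D1 L.uLow x) m n) :=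
    Finset.sum_congr rfl fun m _ => Finset.sum_congr rfl fun n _ => by
      rw [← he.fr3_eps]
      change _ * fr3 e (L.eps x) i m n = _
      ring
  rw [h, fr1_const_mul, fr1_sum_sum, h']
  ring

theorem fr1_acc (j : Fin 4) : fr1 e (L.acc x) j = fr2 e (nabla1 L.g L.uLow x) 0 j := by
  have : L.acc x = fun b => fr1 e (fun c => nabla1 L.g L.uLow x c b) 0 := by
    ext b
    simp only [acc, fr1, he.zero]
  rw [this, ← fr1_comm]
  rfl

theorem fr2_vorticityTensor (i j : Fin 4) : fr2 e (L.vorticityTensor x) i j =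
    fr2 e (L.D1 L.vorticity x) i j
      + 2 * (fr2 e (nabla1 L.g L.uLow x) 0 i * fr1 e (L.vorticity x) j) := by
  have h := fr2_add e (L.D1 L.vorticity x) (fun a b => 2 * (L.acc x a * L.vorticity x b)) i j
  rw [fr2_const_mul e 2 (fun a b => L.acc x a * L.vorticity x b), fr2_mul_fr1, he.fr1_acc] at h
  exact h

theorem fr2_h (i j : Fin 4) :
    fr2 e (L.h x) i j = if i = j ∧ i ≠ 0 then 1 else 0 := by
  have h := fr2_add e (L.g x) (fun a b => L.uLow x a * L.uLow x b) i j
  rw [fr2_mul_fr1, he.fr1_uLow, he.fr1_uLow, he.isFrame] at h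
  refine h.trans ?_
  by_cases hi : i = 0
  · by_cases hj : j = 0
    · simp [hi, hj, sg]
    · simp [hi, hj, Ne.symm hj]
  · by_cases hij : i = j
    · subst hij; simp [hi, sg]
    · simp [hi, hij]

theorem fr2_shear (i j : Fin 4) : fr2 e (L.shear x) i j =
    (fr2 e (L.D1 L.uLow x) i j + fr2 e (L.D1 L.uLow x) j i) / 2
      - L.expansion x / 3 * (if i = j ∧ i ≠ 0 then 1 else 0) := by
  have h : L.shear x = fun a b => (1 / 2) * (L.D1 L.uLow x a b + L.D1 L.uLow x b a)
      + (-(L.expansion x / 3)) * L.h x a b := by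
    ext a b
    simp only [shear]
    ring
  rw [h, fr2_add e (fun a b => (1 / 2) * (L.D1 L.uLow x a b + L.D1 L.uLow x b a))
    (fun a b => (-(L.expansion x / 3)) * L.h x a b), fr2_const_mul e (1 / 2)
    (fun a b => L.D1 L.uLow x a b + L.D1 L.uLow x b a), fr2_add e (L.D1 L.uLow x)
    (fun a b => L.D1 L.uLow x b a), fr2_swap e (L.D1 L.uLow x), fr2_const_mul, he.fr2_h]
  ring

theorem fr2_curl (S : E4 → Fin 4 → Fin 4 → ℝ) (i j : Fin 4) : fr2 e (L.curl S x) i j =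
    (∑ m, ∑ n, sg m * sg n * (fr4 e (L.vol x) i m n 0 * fr3 e (L.D2 S x) m j n)
      + ∑ m, ∑ n, sg m * sg n * (fr4 e (L.vol x) j m n 0 * fr3 e (L.D2 S x) m i n)) / 2 := by
  let K (a b : Fin 4) : ℝ := ∑ m, ∑ n, sg m * sg n *
    (fr2 e (L.eps x a) m n * fr2 e (fun c d => L.D2 S x c b d) m n)
  have hK (i j : Fin 4) : fr2 e K i j =
      ∑ m, ∑ n, sg m * sg n * (fr4 e (L.vol x) i m n 0 * fr3 e (L.D2 S x) m j n) := by
    refine (fr2_sum_sum_mul e (fun m n => sg m * sg n) (fun a m n => fr2 e (L.eps x a) m n)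
      (fun b m n => fr2 e (fun c d => L.D2 S x c b d) m n) i j).trans ?_
    refine Finset.sum_congr rfl fun m _ => Finset.sum_congr rfl fun n _ => ?_
    rw [← he.fr3_eps]
    congr 2
    exact (fr1_comm e (fun b c => fr1 e (fun d => L.D2 S x c b d) n) j m)
  have h : L.curl S x = fun a b => (1 / 2) * (K a b + K b a) := by
    ext a b
    simp only [curl, Finset.sum_add_distrib, K, ← he.sum_epsUp_mul]
    ring
  rw [h, fr2_const_mul e (1 / 2) (fun a b => K a b + K b a), fr2_add e K (fun a b => K b a),
    fr2_swap e K, hK, hK]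
  ring

theorem fr2_electric (i k : Fin 4) : fr2 e (L.electric x) i k = fr4 e (weyl L.g x) i 0 k 0 := by
  have h : L.electric x = fun a c => fr1 e (fun b => fr1 e (weyl L.g x a b c) 0) 0 := by
    ext a c
    simp only [electric, fr1, he.zero, Finset.mul_sum]
    exact Finset.sum_congr rfl fun b _ => Finset.sum_congr rfl fun d _ => by ring
  rw [h]
  refine Finset.sum_congr rfl fun a _ => ?_
  congr 1
  exact fr1_comm e (fun c b => fr1 e (weyl L.g x a b c) 0) k 0

theorem fr2_magnetic (i k : Fin 4) : fr2 e (L.magnetic x) i k =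
    (∑ m, ∑ n, sg m * sg n * (fr4 e (L.vol x) i 0 m n * fr4 e (weyl L.g x) m n k 0)) / 2 := by
  have hd (a b c d : Fin 4) : L.dualWeyl x a b c d = (1 / 2) * ∑ m, ∑ n, sg m * sg n *
      (fr2 e (L.vol x a b) m n * fr2 e (fun i j => weyl L.g x i j c d) m n) := by
    have := sum_raise_raise_mul he.inv_eq (fun i j => weyl L.g x i j c d) (L.vol x a b)
    have h' : ∑ m, ∑ n, sg m * sg n *
        (fr2 e (L.vol x a b) m n * fr2 e (fun i j => weyl L.g x i j c d) m n) = ∑ m, ∑ n,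
        sg m * sg n * (fr2 e (fun i j => weyl L.g x i j c d) m n * fr2 e (L.vol x a b) m n) :=
      Finset.sum_congr rfl fun m _ => Finset.sum_congr rfl fun n _ => by ring
    have h'' : ∑ e, ∑ f, ∑ i, ∑ j,
        L.vol x a b e f * inv L.g x e i * inv L.g x f j * weyl L.g x i j c d =
        ∑ b', ∑ c', (∑ i, ∑ j, inv L.g x b' i * inv L.g x c' j * weyl L.g x i j c d)
          * L.vol x a b b' c' := by
      refine Finset.sum_congr rfl fun m _ => Finset.sum_congr rfl fun n _ => ?_
      simp only [Finset.sum_mul]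
      exact Finset.sum_congr rfl fun i _ => Finset.sum_congr rfl fun j _ => by ring
    rw [h', ← this, dualWeyl, h'']
    ring
  have h : L.magnetic x = fun a c => (1 / 2) * fr2 e (fun b d => ∑ m, ∑ n, sg m * sg n *
      (fr2 e (L.vol x a b) m n * fr2 e (fun i j => weyl L.g x i j c d) m n)) 0 0 := by
    ext a c
    rw [← fr2_const_mul]
    simp only [← hd]
    simp only [magnetic, fr2, fr1, he.zero, Finset.mul_sum]
    exact Finset.sum_congr rfl fun b _ => Finset.sum_congr rfl fun d _ => by ring
  rw [h, fr2_const_mul e (1 / 2) (fun a c => fr2 e (fun b d => ∑ m, ∑ n, sg m * sg n *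
      (fr2 e (L.vol x a b) m n * fr2 e (fun i j => weyl L.g x i j c d) m n)) 0 0)]
  have h2 (a c : Fin 4) : fr2 e (fun b d => ∑ m, ∑ n, sg m * sg n *
      (fr2 e (L.vol x a b) m n * fr2 e (fun i j => weyl L.g x i j c d) m n)) 0 0 =
      ∑ m, ∑ n, sg m * sg n * (fr3 e (L.vol x a) 0 m n *
        fr1 e (fun d => fr2 e (fun i j => weyl L.g x i j c d) m n) 0) :=
    fr2_sum_sum_mul e (fun m n => sg m * sg n) (fun b m n => fr2 e (L.vol x a b) m n)
      (fun d m n => fr2 e (fun i j => weyl L.g x i j c d) m n) 0 0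
  simp only [h2]
  rw [fr2_sum_sum_mul e (fun m n => sg m * sg n) (fun a m n => fr3 e (L.vol x a) 0 m n)
    (fun c m n => fr1 e (fun d => fr2 e (fun i j => weyl L.g x i j c d) m n) 0) i k]
  have h3 (m n : Fin 4) : fr1 e (fun c => fr1 e (fun d =>
      fr2 e (fun i j => weyl L.g x i j c d) m n) 0) k = fr4 e (weyl L.g x) m n k 0 := by
    have h4 (c : Fin 4) : fr1 e (fun d => fr2 e (fun i j => weyl L.g x i j c d) m n) 0 =
        fr2 e (fun i j => fr1 e (weyl L.g x i j c) 0) m n := by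
      refine (fr1_comm e (fun d i => fr1 e (fun j => weyl L.g x i j c d) n) 0 m).trans ?_
      refine Finset.sum_congr rfl fun i _ => ?_
      congr 1
      exact fr1_comm e (fun d j => weyl L.g x i j c d) 0 n
    simp only [h4]
    refine (fr1_comm e (fun c i => fr1 e (fun j => fr1 e (weyl L.g x i j c) 0) n) k m).trans ?_
    refine Finset.sum_congr rfl fun i _ => ?_
    congr 1
    exact fr1_comm e (fun c j => fr1 e (weyl L.g x i j c) 0) k n
  simp only [h3]
  change 1 / 2 * (∑ m, ∑ n, sg m * sg n *
    (fr4 e (L.vol x) i 0 m n * fr4 e (weyl L.g x) m n k 0)) = _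
  ring

end IsAdapted

end LocalData

/-! ### Algebra of purely magnetic Weyl tensors. -/

namespace Coord

/-- The three-dimensional Levi-Civita symbol on the spatial indices `1, 2, 3`. -/
def lc (i j k : Fin 4) : ℝ :=
  if i = 1 ∧ j = 2 ∧ k = 3 ∨ i = 2 ∧ j = 3 ∧ k = 1 ∨ i = 3 ∧ j = 1 ∧ k = 2 then 1
  else if i = 1 ∧ j = 3 ∧ k = 2 ∨ i = 3 ∧ j = 2 ∧ k = 1 ∨ i = 2 ∧ j = 1 ∧ k = 3 then -1
  else 0

/-- Components of a purely magnetic Weyl tensor in an adapted frame. -/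
def magneticWeyl (M : Fin 4 → Fin 4 → ℝ) (i j k l : Fin 4) : ℝ :=
  (∑ p, lc i j p * M p k) * (if l = 0 then 1 else 0)
    - (∑ p, lc i j p * M p l) * (if k = 0 then 1 else 0)
    + (∑ p, lc k l p * M p i) * (if j = 0 then 1 else 0)
    - (∑ p, lc k l p * M p j) * (if i = 0 then 1 else 0)

/-- The independent entries include T 3 1 rather than T 1 3, following the cyclic order 12, 23, 31
in which `lc` is positive. -/
theorem eq_zero_of_antisymm {T : Fin 4 → Fin 4 → ℝ} (h : ∀ i j, T j i = -T i j) (h01 : T 0 1 = 0)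
    (h02 : T 0 2 = 0) (h03 : T 0 3 = 0) (h12 : T 1 2 = 0) (h31 : T 3 1 = 0) (h23 : T 2 3 = 0)
    (i j : Fin 4) : T i j = 0 := by
  have hd (i : Fin 4) : T i i = 0 := by linarith [h i i]
  fin_cases i <;> fin_cases j <;> first | exact hd _ | assumption | (rw [h]; simpa)

theorem lc_swap (i j p : Fin 4) : lc j i p = -lc i j p := by
  unfold lc
  fin_cases i <;> fin_cases j <;> fin_cases p <;> simp

theorem magneticWeyl_swap_left (M : Fin 4 → Fin 4 → ℝ) (i j k l : Fin 4) :
    magneticWeyl M j i k l = -magneticWeyl M i j k l := by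
  simp only [magneticWeyl, lc_swap i j, neg_mul, Finset.sum_neg_distrib]
  ring

theorem magneticWeyl_swap_right (M : Fin 4 → Fin 4 → ℝ) (i j k l : Fin 4) :
    magneticWeyl M i j l k = -magneticWeyl M i j k l := by
  simp only [magneticWeyl, lc_swap k l, neg_mul, Finset.sum_neg_distrib]
  ring

/-- A tensor with the symmetries of a Weyl tensor and without electric part. -/
theorem exists_eq_magneticWeyl {w : Fin 4 → Fin 4 → Fin 4 → Fin 4 → ℝ}
    (hl : ∀ i j k l, w j i k l = -w i j k l) (hr : ∀ i j k l, w i j l k = -w i j k l)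
    (hp : ∀ i j k l, w k l i j = w i j k l)
    (hc : ∀ i j k l, w i j k l + w i k l j + w i l j k = 0)
    (ht : ∀ j l, ∑ i, sg i * w i j i l = 0) (hE : ∀ i j, w i 0 j 0 = 0) :
    ∃ M : Fin 4 → Fin 4 → ℝ, (∀ p, M p 0 = 0) ∧ (∀ p q, M p q = M q p) ∧
      M 1 1 + M 2 2 + M 3 3 = 0 ∧ ∀ i j k l, w i j k l = magneticWeyl M i j k l := by
  simp only [Fin.sum_univ_four, sg, if_true, neg_mul, one_mul, Fin.reduceEq, if_false] at ht
  have hrd (i j k : Fin 4) : w i j k k = 0 := by linarith [hr i j k k]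
  have hld (i k l : Fin 4) : w i i k l = 0 := by linarith [hl i i k l]
  let M (p k : Fin 4) : ℝ :=
    if p = 1 then w 2 3 k 0 else if p = 2 then w 3 1 k 0 else if p = 3 then w 1 2 k 0 else 0
  have hE' (i j : Fin 4) : w 0 i 0 j = 0 := by rw [hl, hr, hE]; simp
  have hE'' (i j : Fin 4) : w 0 i j 0 = 0 := by rw [hl, hE]; simp
  have hM1 (k : Fin 4) : M 1 k = w 2 3 k 0 := rfl
  have hM2 (k : Fin 4) : M 2 k = w 3 1 k 0 := rfl
  have hM3 (k : Fin 4) : M 3 k = w 1 2 k 0 := rfl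
  have hM0 (k : Fin 4) : M 0 k = 0 := rfl
  -- The mixed time-space traces of w make M symmetric; the cyclic identity, in `htr`, makes it
  -- trace-free.
  have h12 : w 2 3 2 0 = w 3 1 1 0 := by
    have := ht 3 0; linarith [hld 3 3 0, hE'' 3 0, hl 1 3 1 0]
  have h13 : w 2 3 3 0 = w 1 2 1 0 := by
    have := ht 2 0; linarith [hld 2 2 0, hE'' 2 0, hl 2 3 3 0]
  have h23 : w 3 1 3 0 = w 1 2 2 0 := by
    have := ht 1 0; linarith [hld 1 1 0, hE'' 1 0, hl 1 2 2 0]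
  have htr : w 2 3 1 0 + w 3 1 2 0 + w 1 2 3 0 = 0 := by
    have := hc 0 1 2 3
    linarith [hp 2 3 1 0, hp 3 1 2 0, hp 1 2 3 0, hl 0 1 2 3, hl 0 2 3 1, hl 0 3 1 2]
  have h0 (i j k : Fin 4) : w 0 i j k + w j k i 0 = 0 := by rw [hp, hr j k i 0]; ring
  have hk0 (i j k : Fin 4) : w i j 0 k + w i j k 0 = 0 := by rw [hr]; ring
  have hswap (i j k l : Fin 4) : w j i l k = w i j k l := by rw [hl, hr]; ring
  -- The purely spatial block is a curvature tensor in dimension three, determined by its Ricci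
  -- trace. That trace equals the electric part, so the whole block vanishes.
  have t1 : w 1 2 1 2 + w 3 1 3 1 = 0 := by
    linarith [ht 1 1, hld 1 1 1, hE' 1 1, hswap 1 2 1 2]
  have t2 : w 1 2 1 2 + w 2 3 2 3 = 0 := by
    linarith [ht 2 2, hld 2 2 2, hE' 2 2, hswap 2 3 2 3]
  have t3 : w 3 1 3 1 + w 2 3 2 3 = 0 := by
    linarith [ht 3 3, hld 3 3 3, hE' 3 3, hswap 1 3 1 3]
  have s12 : w 1 2 1 2 = 0 := by linarith
  have s31 : w 3 1 3 1 = 0 := by linarith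
  have s23 : w 2 3 2 3 = 0 := by linarith
  have s1231 : w 1 2 3 1 = 0 := by
    linarith [ht 2 3, hE' 2 3, hld 2 2 3, hrd 3 2 3, hr 1 2 1 3]
  have s1223 : w 1 2 2 3 = 0 := by
    linarith [ht 1 3, hE' 1 3, hld 1 1 3, hrd 3 1 3, hl 1 2 2 3]
  have s3123 : w 3 1 2 3 = 0 := by
    linarith [ht 1 2, hE' 1 2, hld 1 1 2, hrd 2 1 2, hr 3 1 3 2]
  refine ⟨M, fun p => ?_, fun p q => ?_, ?_, fun i j k l => ?_⟩
  · fin_cases p <;> simp [M, hrd]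
  · fin_cases p <;> fin_cases q <;> simp [M, hrd, h12, h13, h23]
  · simpa [M] using htr
  · have hs (i j : Fin 4) : (∀ k l, w i j k l - magneticWeyl M i j k l = 0) ↔
        w i j 0 1 - magneticWeyl M i j 0 1 = 0 ∧ w i j 0 2 - magneticWeyl M i j 0 2 = 0 ∧
        w i j 0 3 - magneticWeyl M i j 0 3 = 0 ∧ w i j 1 2 - magneticWeyl M i j 1 2 = 0 ∧
        w i j 3 1 - magneticWeyl M i j 3 1 = 0 ∧ w i j 2 3 - magneticWeyl M i j 2 3 = 0 :=
      ⟨fun h => ⟨h _ _, h _ _, h _ _, h _ _, h _ _, h _ _⟩, fun h k l =>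
        eq_zero_of_antisymm (T := fun k l => w i j k l - magneticWeyl M i j k l)
        (fun k l => by rw [hr, magneticWeyl_swap_right]; ring)
        h.1 h.2.1 h.2.2.1 h.2.2.2.1 h.2.2.2.2.1 h.2.2.2.2.2 k l⟩
    have key : ∀ i j, w i j k l - magneticWeyl M i j k l = 0 := by
      refine eq_zero_of_antisymm (fun i j => by rw [hl, magneticWeyl_swap_left]; ring)
        ((hs _ _).2 ?_ k l) ((hs _ _).2 ?_ k l) ((hs _ _).2 ?_ k l) ((hs _ _).2 ?_ k l)
        ((hs _ _).2 ?_ k l) ((hs _ _).2 ?_ k l)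
      all_goals
        simp only [magneticWeyl, lc, Fin.sum_univ_four, hM0, hM1, hM2, hM3]
        simp
        simp only [hE', h0, hk0, s12, s31, s23, s1231, s1223, s3123, hp 1 2 3 1, hp 1 2 2 3,
          hp 3 1 2 3, and_self]
    exact sub_eq_zero.1 (key i j)

end Coord

/-! ### Frame algebra: the strain constraint and the polynomial identity. -/

namespace Coord

/-- Action of an endomorphism on a covariant 4-tensor. -/
def act (γ : Fin 4 → Fin 4 → ℝ) (w : Fin 4 → Fin 4 → Fin 4 → Fin 4 → ℝ) (i j k l : Fin 4) : ℝ :=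
  ∑ p, γ i p * w p j k l + ∑ p, γ j p * w i p k l + ∑ p, γ k p * w i j p l
    + ∑ p, γ l p * w i j k p

theorem act_swap_left {γ : Fin 4 → Fin 4 → ℝ} {w : Fin 4 → Fin 4 → Fin 4 → Fin 4 → ℝ}
    (hl : ∀ i j k l, w j i k l = -w i j k l) (i j k l : Fin 4) :
    act γ w j i k l = -act γ w i j k l := by
  have h1 (p : Fin 4) : w p i k l = -w i p k l := hl _ _ _ _
  have h2 (p : Fin 4) : w j p k l = -w p j k l := hl _ _ _ _
  have h3 (p : Fin 4) : w j i p l = -w i j p l := hl _ _ _ _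
  have h4 (p : Fin 4) : w j i k p = -w i j k p := hl _ _ _ _
  simp only [act, h1, h2, h3, h4, mul_neg, Finset.sum_neg_distrib]
  ring

/-- The condition on γ says that it is an infinitesimal Lorentz transformation, and these preserve
the vanishing of traces. -/
theorem trace_act {γ : Fin 4 → Fin 4 → ℝ} {w : Fin 4 → Fin 4 → Fin 4 → Fin 4 → ℝ}
    (hγ : ∀ i j, γ i j * sg j + γ j i * sg i = 0)
    (ht : ∀ b d, ∑ e, sg e * w e b e d = 0) (b d : Fin 4) :
    ∑ e, sg e * act γ w e b e d = 0 := by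
  have h2 : ∑ e, sg e * ∑ p, γ b p * w e p e d = 0 := by
    have : ∑ p, γ b p * ∑ e, sg e * w e p e d = 0 := by simp [ht]
    rw [← this]
    simp only [Finset.mul_sum]
    rw [Finset.sum_comm]
    exact Finset.sum_congr rfl fun p _ => Finset.sum_congr rfl fun e _ => by ring
  have h4 : ∑ e, sg e * ∑ p, γ d p * w e b e p = 0 := by
    have : ∑ p, γ d p * ∑ e, sg e * w e b e p = 0 := by simp [ht]
    rw [← this]
    simp only [Finset.mul_sum]
    rw [Finset.sum_comm]
    exact Finset.sum_congr rfl fun p _ => Finset.sum_congr rfl fun e _ => by ring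
  have h13 : ∑ e, sg e * ∑ p, γ e p * w p b e d + ∑ e, sg e * ∑ p, γ e p * w e b p d = 0 := by
    simp only [Finset.mul_sum]
    rw [Finset.sum_comm, ← Finset.sum_add_distrib]
    refine Finset.sum_eq_zero fun p _ => ?_
    rw [← Finset.sum_add_distrib]
    refine Finset.sum_eq_zero fun e _ => ?_
    linear_combination sg e * sg p * w p b e d * hγ e p - γ e p * sg e * w p b e d * sg_mul_self p
      - γ p e * sg p * w p b e d * sg_mul_self e
  simp only [act, mul_add, Finset.sum_add_distrib]
  linarith

/-- A tensor with the second Bianchi identity and without traces has no divergence. -/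
theorem div_of_cyclic {D : Fin 4 → Fin 4 → Fin 4 → Fin 4 → Fin 4 → ℝ}
    (hc : ∀ e a b c d, D e a b c d + D a b e c d + D b e a c d = 0)
    (hl : ∀ m i j k l, D m j i k l = -D m i j k l)
    (ht : ∀ m b d, ∑ e, sg e * D m e b e d = 0) (a b d : Fin 4) :
    ∑ e, sg e * D e a b e d = 0 := by
  have h : ∑ e, sg e * (D e a b e d + D a b e e d + D b e a e d) = 0 := by simp [hc]
  simp only [mul_add, Finset.sum_add_distrib, hl a _ b, ht, mul_neg, Finset.sum_neg_distrib] at h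
  linarith

theorem magneticWeyl_trace {M : Fin 4 → Fin 4 → ℝ} (h0 : ∀ p, M p 0 = 0)
    (hs : ∀ p q, M p q = M q p) (b d : Fin 4) :
    ∑ e, sg e * magneticWeyl M e b e d = 0 := by
  fin_cases b <;> fin_cases d <;>
    simp [magneticWeyl, lc, sg, Fin.sum_univ_four, h0, hs 2 1, hs 3 1, hs 3 2]

theorem magneticWeyl_eq_zero {M : Fin 4 → Fin 4 → ℝ} (h0 : ∀ p, M p 0 = 0)
    (i k : Fin 4) : magneticWeyl M i 0 k 0 = 0 := by
  fin_cases i <;> fin_cases k <;> simp [magneticWeyl, lc, h0]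

/-- The contraction `W_{abcd} (u^b ∇^a u^d + u^d ∇^a u^b)` in a frame. -/
def weylStrain (B : Fin 4 → Fin 4 → ℝ) (w : Fin 4 → Fin 4 → Fin 4 → Fin 4 → ℝ) (j : Fin 4) : ℝ :=
  ∑ k, ∑ l, B k l * (w k l j 0 + w k 0 j l)

/-- Vorticity in an adapted frame. -/
def vorticityComp (B : Fin 4 → Fin 4 → ℝ) (i : Fin 4) : ℝ :=
  -(∑ m, ∑ n, lc i m n * B m n) / 2

/-- Covariant derivative of the vorticity in an adapted frame with connection `γ`. -/
def nablaVorticityComp (γ : Fin 4 → Fin 4 → Fin 4 → ℝ) (B : Fin 4 → Fin 4 → ℝ)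
    (dB : Fin 4 → Fin 4 → Fin 4 → ℝ) (k i : Fin 4) : ℝ :=
  vorticityComp (dB k) i - ∑ l, γ k i l * vorticityComp B l

/-- Spatial part of a 2-tensor in an adapted frame. -/
def spatialPart (A : Fin 4 → Fin 4 → ℝ) (i j : Fin 4) : ℝ := if i = 0 ∨ j = 0 then 0 else A i j

/-- Shear in an adapted frame. -/
def shearComp (B : Fin 4 → Fin 4 → ℝ) (θ : ℝ) (i j : Fin 4) : ℝ :=
  (spatialPart B i j + spatialPart B j i) / 2 - θ / 3 * (if i = j ∧ i ≠ 0 then 1 else 0)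

/-- Covariant derivative of the shear in an adapted frame with connection `γ`. -/
def nablaShearComp (γ : Fin 4 → Fin 4 → Fin 4 → ℝ) (B : Fin 4 → Fin 4 → ℝ)
    (dB : Fin 4 → Fin 4 → Fin 4 → ℝ) (θ : ℝ) (dθ : Fin 4 → ℝ) (k i j : Fin 4) : ℝ :=
  shearComp (dB k) (dθ k) i j - ∑ l, γ k i l * shearComp B θ l j - ∑ l, γ k j l * shearComp B θ i l

/-- Curl of the shear in an adapted frame with connection `γ`. -/
def curlShearComp (γ : Fin 4 → Fin 4 → Fin 4 → ℝ) (B : Fin 4 → Fin 4 → ℝ)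
    (dB : Fin 4 → Fin 4 → Fin 4 → ℝ) (θ : ℝ) (dθ : Fin 4 → ℝ) (i j : Fin 4) : ℝ :=
  (∑ m, ∑ n, lc i m n * nablaShearComp γ B dB θ dθ m j n
    + ∑ m, ∑ n, lc j m n * nablaShearComp γ B dB θ dθ m i n) / 2

section Frame

variable {γ : Fin 4 → Fin 4 → Fin 4 → ℝ} {B M : Fin 4 → Fin 4 → ℝ} {dM : Fin 4 → Fin 4 → Fin 4 → ℝ}
  {D : Fin 4 → Fin 4 → Fin 4 → Fin 4 → Fin 4 → ℝ}

/-- The electric components stay zero under differentiation, so D must cancel the connection terms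
there. These terms survive only in the slots occupied by u, where the connection is ∇u; the
divergence constraint then says that the strain vanishes. The strain carries no sign for its first
index because terms with that index 0 are electric components, which are zero. -/
theorem weylStrain_eq_zero (hγ : ∀ k i j, γ k i j * sg j + γ k j i * sg i = 0)
    (hB : ∀ k i, B k i = γ k i 0) (h0 : ∀ p, M p 0 = 0) (hs : ∀ p q, M p q = M q p)
    (htr : M 1 1 + M 2 2 + M 3 3 = 0) (hd0 : ∀ m p, dM m p 0 = 0)
    (hD : ∀ m i j k l, magneticWeyl (dM m) i j k l =
      act (γ m) (magneticWeyl M) i j k l + D m i j k l)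
    (hdiv : ∀ a b d, ∑ e, sg e * D e a b e d = 0) (j : Fin 4) :
    weylStrain B (magneticWeyl M) j = 0 := by
  have hM3 : M 3 3 = -M 1 1 - M 2 2 := by linarith
  -- The derivative of a purely magnetic Weyl tensor is itself purely magnetic in form, so its i0k0
  -- component is 0.
  have hact (m i k : Fin 4) : D m i 0 k 0 = -act (γ m) (magneticWeyl M) i 0 k 0 := by
    have := hD m i 0 k 0
    rw [magneticWeyl_eq_zero (hd0 m)] at this
    linarith
  have h := hdiv j 0 0
  simp only [hact] at h
  have g00 (m : Fin 4) : γ m 0 0 = 0 := by have := hγ m 0 0; simp [sg] at this; linarith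
  have g0 (m i : Fin 4) (hi : i ≠ 0) : γ m 0 i = B m i := by
    have := hγ m 0 i; simp [sg, hi] at this; rw [hB]; linarith
  have g10 (m i : Fin 4) : γ m i 0 = B m i := (hB m i).symm
  have hB0 (m : Fin 4) : B m 0 = 0 := by rw [hB, g00]
  have gd (m i : Fin 4) : γ m i i = 0 := by
    have := hγ m i i; have h2 := sg_mul_self i
    have h3 : 2 * (γ m i i * (sg i * sg i)) = 0 := by linear_combination sg i * this
    rw [h2] at h3; linarith
  have gs (m i j : Fin 4) (hi : i ≠ 0) (hj : j ≠ 0) : γ m j i = -γ m i j := by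
    have := hγ m i j; simp [sg, hi, hj] at this; linarith
  have g21 (m : Fin 4) := gs m 1 2 (by decide) (by decide)
  have g31 (m : Fin 4) := gs m 1 3 (by decide) (by decide)
  have g32 (m : Fin 4) := gs m 2 3 (by decide) (by decide)
  fin_cases j
  · simp [weylStrain, magneticWeyl, lc, h0]
  all_goals
    simp [act, magneticWeyl, lc, sg, Fin.sum_univ_four, h0, g10, hB0, g0,
      hs 2 1, hs 3 1, hs 3 2, hM3] at h
    simp [weylStrain, magneticWeyl, lc, Fin.sum_univ_four, h0, hB0, hs 2 1, hs 3 1, hs 3 2,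
      hM3]
    linear_combination -h

-- The analytic input reduced to numbers: γ is the connection, B = ∇u, C = ∇∇u, `hR` the Ricci
-- identity, `hZ` the strain constraint and `hstar` its divergence. The matrix P is arbitrary: on
-- spatial indices it enters through P_{0i}, in terms that pair with the symmetric M to zero.
set_option maxHeartbeats 2000000 in
theorem vorticity_curl_identity
    {dB C : Fin 4 → Fin 4 → Fin 4 → ℝ} {P : Fin 4 → Fin 4 → ℝ} {θ : ℝ} {dθ : Fin 4 → ℝ}
    (hγ : ∀ k i j, γ k i j * sg j + γ k j i * sg i = 0)
    (hB : ∀ k i, B k i = γ k i 0) (h0 : ∀ p, M p 0 = 0) (hs : ∀ p q, M p q = M q p)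
    (htr : M 1 1 + M 2 2 + M 3 3 = 0)
    (hC : ∀ m k l, dB m k l = ∑ p, γ m k p * B p l + ∑ p, γ m l p * B k p + C m k l)
    (hR : ∀ k i j, C k i j - C i k j = -(magneticWeyl M 0 j k i
      + ((if 0 = k then sg 0 else 0) * P j i - (if 0 = i then sg 0 else 0) * P j k
        - (if j = k then sg j else 0) * P 0 i + (if j = i then sg j else 0) * P 0 k)))
    (hZ : ∀ j, weylStrain B (magneticWeyl M) j = 0)
    (hstar : ∑ j, sg j * ∑ k, ∑ l,
      (dB j k l * (magneticWeyl M k l j 0 + magneticWeyl M k 0 j l)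
        + B k l * (act (γ j) (magneticWeyl M) k l j 0 + act (γ j) (magneticWeyl M) k 0 j l)) = 0) :
    ∑ i, ∑ j, M i j * M i j =
      4 * ∑ i, ∑ j, M i j * (nablaVorticityComp γ B dB i j + 2 * (B 0 i * vorticityComp B j)) ∧
    ∑ i, ∑ j, M i j * curlShearComp γ B dB θ dθ i j =
      3 * ∑ i, ∑ j, M i j * (nablaVorticityComp γ B dB i j + 2 * (B 0 i * vorticityComp B j)) := by
  have h0' (p : Fin 4) : M 0 p = 0 := by rw [hs, h0]
  have hM3 : M 3 3 = -M 1 1 - M 2 2 := by linarith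
  have g00 (m : Fin 4) : γ m 0 0 = 0 := by have := hγ m 0 0; simp [sg] at this; linarith
  have g0 (m i : Fin 4) (hi : i ≠ 0) : γ m 0 i = B m i := by
    have := hγ m 0 i; simp [sg, hi] at this; rw [hB]; linarith
  have g10 (m i : Fin 4) : γ m i 0 = B m i := (hB m i).symm
  have hB0 (m : Fin 4) : B m 0 = 0 := by rw [hB, g00]
  have gd (m i : Fin 4) : γ m i i = 0 := by
    have := hγ m i i; have h2 := sg_mul_self i
    have h3 : 2 * (γ m i i * (sg i * sg i)) = 0 := by linear_combination sg i * this
    rw [h2] at h3; linarith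
  have gs (m i j : Fin 4) (hi : i ≠ 0) (hj : j ≠ 0) : γ m j i = -γ m i j := by
    have := hγ m i j; simp [sg, hi, hj] at this; linarith
  have g21 (m : Fin 4) := gs m 1 2 (by decide) (by decide)
  have g31 (m : Fin 4) := gs m 1 3 (by decide) (by decide)
  have g32 (m : Fin 4) := gs m 2 3 (by decide) (by decide)
  have z1 := hZ 1
  have z2 := hZ 2
  have z3 := hZ 3
  -- The Ricci identity is solved for the second derivatives whose two spatial derivative indices
  -- are in decreasing order; this is the exchange of derivatives that produces the square of M.
  have a1 := eq_add_of_sub_eq (hR 2 1 1)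
  have a2 := eq_add_of_sub_eq (hR 2 1 2)
  have a3 := eq_add_of_sub_eq (hR 2 1 3)
  have b1 := eq_add_of_sub_eq (hR 3 1 1)
  have b2 := eq_add_of_sub_eq (hR 3 1 2)
  have b3 := eq_add_of_sub_eq (hR 3 1 3)
  have c1 := eq_add_of_sub_eq (hR 3 2 1)
  have c2 := eq_add_of_sub_eq (hR 3 2 2)
  have c3 := eq_add_of_sub_eq (hR 3 2 3)
  simp [magneticWeyl, lc, sg, h0, hs 2 1, hs 3 1, hs 3 2, hM3]
    at a1 a2 a3 b1 b2 b3 c1 c2 c3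
  simp [weylStrain, magneticWeyl, lc, Fin.sum_univ_four, h0, hB0, hs 2 1, hs 3 1, hs 3 2,
    hM3] at z1 z2 z3
  simp [act, magneticWeyl, lc, sg, Fin.sum_univ_four, h0, g10, hB0, g0, gd, g21, g31, g32,
      hs 2 1, hs 3 1, hs 3 2, hM3, hC, a1, a2, a3, b1, b2, b3, c1, c2, c3] at hstar
  simp [nablaVorticityComp, vorticityComp, curlShearComp, nablaShearComp, shearComp, spatialPart,
    Fin.sum_univ_four, lc, h0, h0', g10, hB0, g0, gd, g21, g31, g32,
      hs 2 1, hs 3 1, hs 3 2, hM3, hC, a1, a2, a3, b1, b2, b3, c1, c2, c3]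
  -- Both goals have the same residual, because after substitution the Ricci constraint (M, curl σ)
  -- = |M|² - (M, Dω + 2a⊗ω) holds identically. The coefficients of z1, z2, z3 built from γ are the
  -- spatial traces Σ_m γ m m i: they turn the frame divergence in `hstar` into a covariant one. The
  -- bracket with factor 3 absorbs the acceleration terms, which are the acceleration contracted
  -- with the strain.
  constructor
  · linear_combination hstar - ((-γ 2 1 2 - γ 3 1 3) * z1 + (γ 1 1 2 - γ 3 2 3) * z2
      + (γ 1 1 3 + γ 2 2 3) * z3) + 3 * (B 0 1 * z1 + B 0 2 * z2 + B 0 3 * z3)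
  · linear_combination hstar - ((-γ 2 1 2 - γ 3 1 3) * z1 + (γ 1 1 2 - γ 3 2 3) * z2
      + (γ 1 1 3 + γ 2 2 3) * z3) + 3 * (B 0 1 * z1 + B 0 2 * z2 + B 0 3 * z3)

end Frame

end Coord

/-! ### Frame components under permutation of indices. -/

namespace Coord

section Permutations

variable (e : Fin 4 → Fin 4 → ℝ)

theorem fr4_swap₁ (T : Fin 4 → Fin 4 → Fin 4 → Fin 4 → ℝ) (i j k l : Fin 4) :
    fr4 e (fun a b c d => T b a c d) i j k l = fr4 e T j i k l :=
  fr2_swap e (fun a b => fr2 e (T a b) k l) i j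

theorem fr4_swap₂ (T : Fin 4 → Fin 4 → Fin 4 → Fin 4 → ℝ) (i j k l : Fin 4) :
    fr4 e (fun a b c d => T a c b d) i j k l = fr4 e T i k j l :=
  Finset.sum_congr rfl fun a _ => congrArg _ (fr2_swap e (fun b c => fr1 e (T a b c) l) j k)

theorem fr4_swap₃ (T : Fin 4 → Fin 4 → Fin 4 → Fin 4 → ℝ) (i j k l : Fin 4) :
    fr4 e (fun a b c d => T a b d c) i j k l = fr4 e T i j l k :=
  Finset.sum_congr rfl fun a _ => congrArg _ <| Finset.sum_congr rfl fun b _ =>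
    congrArg _ (fr2_swap e (fun c d => T a b c d) k l)

theorem fr4_pair (T : Fin 4 → Fin 4 → Fin 4 → Fin 4 → ℝ) (i j k l : Fin 4) :
    fr4 e (fun a b c d => T c d a b) i j k l = fr4 e T k l i j := by
  rw [fr4_swap₂ e (fun a b c d => T b d a c), fr4_swap₁ e (fun a b c d => T a d b c),
    fr4_swap₃ e (fun a b c d => T a c b d), fr4_swap₂]

theorem fr4_cycle (T : Fin 4 → Fin 4 → Fin 4 → Fin 4 → ℝ) (i j k l : Fin 4) :
    fr4 e (fun a b c d => T a c d b) i j k l = fr4 e T i k l j := by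
  rw [fr4_swap₂ e (fun a b c d => T a b d c), fr4_swap₃]

theorem fr3_rotate (T : Fin 4 → Fin 4 → Fin 4 → ℝ) (i j k : Fin 4) :
    fr3 e (fun a b c => T b c a) i j k = fr3 e T j k i := by
  have h := fr2_swap e (fun b a => fr1 e (fun c => T b c a) k) i j
  refine h.trans ?_
  refine Finset.sum_congr rfl fun b _ => congrArg _ ?_
  exact fr2_swap e (fun c a => T b c a) i k

theorem fr4_neg (T : Fin 4 → Fin 4 → Fin 4 → Fin 4 → ℝ) (i j k l : Fin 4) :
    fr4 e (fun a b c d => -T a b c d) i j k l = -fr4 e T i j k l := by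
  simp [fr4, fr3, fr2, fr1]

theorem fr4_add (S T : Fin 4 → Fin 4 → Fin 4 → Fin 4 → ℝ) (i j k l : Fin 4) :
    fr4 e (fun a b c d => S a b c d + T a b c d) i j k l =
      fr4 e S i j k l + fr4 e T i j k l := by
  simp only [fr4, fr3, fr2, fr1, mul_add, Finset.sum_add_distrib]

theorem fr4_antisymm₁ {T : Fin 4 → Fin 4 → Fin 4 → Fin 4 → ℝ}
    (h : ∀ a b c d, T b a c d = -T a b c d) (i j k l : Fin 4) :
    fr4 e T j i k l = -fr4 e T i j k l := by
  rw [← fr4_swap₁, ← fr4_neg]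
  exact congrArg (fun S => fr4 e S i j k l) (by ext; exact h _ _ _ _)

theorem fr4_antisymm₂ {T : Fin 4 → Fin 4 → Fin 4 → Fin 4 → ℝ}
    (h : ∀ a b c d, T a c b d = -T a b c d) (i j k l : Fin 4) :
    fr4 e T i k j l = -fr4 e T i j k l := by
  rw [← fr4_swap₂, ← fr4_neg]
  exact congrArg (fun S => fr4 e S i j k l) (by ext; exact h _ _ _ _)

theorem fr4_antisymm₃ {T : Fin 4 → Fin 4 → Fin 4 → Fin 4 → ℝ}
    (h : ∀ a b c d, T a b d c = -T a b c d) (i j k l : Fin 4) :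
    fr4 e T i j l k = -fr4 e T i j k l := by
  rw [← fr4_swap₃, ← fr4_neg]
  exact congrArg (fun S => fr4 e S i j k l) (by ext; exact h _ _ _ _)

theorem fr3_sub (S T : Fin 4 → Fin 4 → Fin 4 → ℝ) (i j k : Fin 4) :
    fr3 e (fun a b c => S a b c - T a b c) i j k = fr3 e S i j k - fr3 e T i j k := by
  simp only [fr3, fr2, fr1, mul_sub, Finset.sum_sub_distrib]

theorem fr3_neg (T : Fin 4 → Fin 4 → Fin 4 → ℝ) (i j k : Fin 4) :
    fr3 e (fun a b c => -T a b c) i j k = -fr3 e T i j k := by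
  simp [fr3, fr2, fr1]

theorem fr4_mul (A B : Fin 4 → Fin 4 → ℝ) (i j k l : Fin 4) :
    fr4 e (fun a b c d => A a b * B c d) i j k l = fr2 e A i j * fr2 e B k l := by
  have h (a b : Fin 4) : fr2 e (fun c d => A a b * B c d) k l = A a b * fr2 e B k l :=
    fr2_const_mul e _ _ _ _
  simp only [fr4, fr3, h]
  rw [show fr2 e A i j = ∑ a, e i a * ∑ b, e j b * A a b from rfl]
  simp only [Finset.sum_mul, Finset.mul_sum]
  exact Finset.sum_congr rfl fun a _ => Finset.sum_congr rfl fun b _ => by ring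

theorem fr4_kn (g P : E4 → Fin 4 → Fin 4 → ℝ) (x : E4) (i j k l : Fin 4) :
    fr4 e (kn g P x) i j k l = fr2 e (g x) i k * fr2 e (P x) j l - fr2 e (g x) i l * fr2 e (P x) j k
      - fr2 e (g x) j k * fr2 e (P x) i l + fr2 e (g x) j l * fr2 e (P x) i k := by
  have h1 (i j k l : Fin 4) : fr4 e (fun a b c d => g x a c * P x b d) i j k l =
      fr2 e (g x) i k * fr2 e (P x) j l := by
    rw [fr4_swap₂ e (fun a b c d => g x a b * P x c d), fr4_mul]
  have h2 (i j k l : Fin 4) : fr4 e (fun a b c d => g x a d * P x b c) i j k l =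
      fr2 e (g x) i l * fr2 e (P x) j k := by
    rw [fr4_swap₃ e (fun a b c d => g x a c * P x b d), h1]
  have h3 : fr4 e (fun a b c d => g x b c * P x a d) i j k l =
      fr2 e (g x) j k * fr2 e (P x) i l := by
    rw [fr4_swap₁ e (fun a b c d => g x a c * P x b d), h1]
  have h4 : fr4 e (fun a b c d => g x b d * P x a c) i j k l =
      fr2 e (g x) j l * fr2 e (P x) i k := by
    rw [fr4_swap₁ e (fun a b c d => g x a d * P x b c), h2]
  have h : kn g P x = fun a b c d => (g x a c * P x b d + -(g x a d * P x b c))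
      + (-(g x b c * P x a d) + g x b d * P x a c) := by
    ext a b c d
    simp only [kn]
    ring
  rw [h, fr4_add e (fun a b c d => g x a c * P x b d + -(g x a d * P x b c))
    (fun a b c d => -(g x b c * P x a d) + g x b d * P x a c),
    fr4_add e (fun a b c d => g x a c * P x b d) (fun a b c d => -(g x a d * P x b c)),
    fr4_add e (fun a b c d => -(g x b c * P x a d)) (fun a b c d => g x b d * P x a c),
    fr4_neg, fr4_neg, h1, h2, h3, h4]
  ring

theorem fr1_moveOut (S : Fin 4 → Fin 4 → Fin 4 → Fin 4 → ℝ) (i j k l : Fin 4) :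
    fr3 e (fun a b c => fr1 e (fun d => S d a b c) l) i j k = fr4 e S l i j k := by
  have h1 (a b : Fin 4) : fr1 e (fun c => fr1 e (fun d => S d a b c) l) k =
      fr1 e (fun d => fr1 e (S d a b) k) l := fr1_comm e _ _ _
  have h2 (a : Fin 4) : fr1 e (fun b => fr1 e (fun d => fr1 e (S d a b) k) l) j =
      fr1 e (fun d => fr2 e (S d a) j k) l := fr1_comm e _ _ _
  have h3 : fr1 e (fun a => fr1 e (fun d => fr2 e (S d a) j k) l) i =
      fr1 e (fun d => fr3 e (S d) i j k) l := fr1_comm e _ _ _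
  refine Eq.trans ?_ h3
  refine Finset.sum_congr rfl fun a _ => congrArg _ (Eq.trans ?_ (h2 a))
  exact Finset.sum_congr rfl fun b _ => congrArg _ (h1 a b)

end Permutations

end Coord

/-! ### The connection of an adapted frame field. -/

namespace LocalData

open Coord

variable {L : LocalData} {U : Set E4}

/-- `X` is a field of adapted frames near `x`, differentiable at `x`. -/
structure IsFrameField (L : LocalData) (x : E4) (X : E4 → Fin 4 → Fin 4 → ℝ) : Prop where
  diff : ∀ i a, DifferentiableAt ℝ (fun y => X y i a) x
  eventually : ∀ᶠ y in nhds x, L.IsAdapted y (X y)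

/-- The vector `∇_{X_k} X_i`. -/
def nablaFrame (L : LocalData) (X : E4 → Fin 4 → Fin 4 → ℝ) (x : E4) (k i a : Fin 4) : ℝ :=
  ∑ c, X x k c * (pd c (fun y => X y i a) x + ∑ b, christoffel L.g x a c b * X x i b)

/-- The connection coefficients of a frame field: `∇_{X_k} X_i = ∑ j, conn k i j X_j`. -/
def conn (L : LocalData) (X : E4 → Fin 4 → Fin 4 → ℝ) (x : E4) (k i j : Fin 4) : ℝ :=
  sg j * ∑ c, L.nablaFrame X x k i c * ∑ b, X x j b * L.g x c b

theorem IsRegularOn.exists_isFrameField (hL : L.IsRegularOn U) {x : E4} (hx : x ∈ U)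
    {e : Fin 4 → Fin 4 → ℝ} (he : L.IsAdapted x e) : ∃ X, X x = e ∧ L.IsFrameField x X := by
  obtain ⟨X, h1, h2, h3⟩ := hL.exists_frameField hx he
  exact ⟨X, h1, h2, h3⟩

theorem IsRegularOn.smooth_uLow (hL : L.IsRegularOn U) (a : Fin 4) :
    ContDiffOn ℝ ∞ (fun y => L.uLow y a) U :=
  ContDiffOn.sum fun b _ => (hL.smooth_g a b).mul (hL.smooth_u b)

theorem IsRegularOn.smooth_nabla1 (hL : L.IsRegularOn U) {v : E4 → Fin 4 → ℝ}
    (hv : ∀ a, ContDiffOn ℝ ∞ (fun y => v y a) U) (a b : Fin 4) :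
    ContDiffOn ℝ ∞ (fun y => nabla1 L.g v y a b) U :=
  (contDiffOn_pd hL.isOpen (hv b) a).sub <| ContDiffOn.sum fun e _ =>
    (hL.isMetricOn.smooth_christoffel e a b).mul (hv e)

namespace IsFrameField

variable {x : E4} {X : E4 → Fin 4 → Fin 4 → ℝ} (hX : L.IsFrameField x X)

include hX

theorem isAdapted : L.IsAdapted x (X x) := hX.eventually.self_of_nhds

section

variable (hL : L.IsRegularOn U) (hx : x ∈ U)

include hL hx

theorem hasDir_frame (k i a : Fin 4) : HasDir (fun y => X y i a) x (X x k)
    (∑ j, L.conn X x k i j * X x j a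
      - ∑ b, (∑ c, X x k c * christoffel L.g x a c b) * X x i b) := by
  refine (HasDir.of_differentiableAt (hX.diff i a) _).congr_val ?_
  have h := hX.isAdapted.isFrame.expand (L.nablaFrame X x k i) (hL.symm x hx) a
  change ∑ j, L.conn X x k i j * X x j a = _ at h
  rw [h]
  simp only [nablaFrame, mul_add, Finset.sum_add_distrib, Finset.sum_mul, Finset.mul_sum]
  rw [Finset.sum_comm (f := fun b c => X x k c * christoffel L.g x a c b * X x i b)]
  simp only [mul_assoc]
  ring

omit hX hL hx in
theorem hasDir_tensor₁ {T : E4 → Fin 4 → ℝ} {w : Fin 4 → ℝ} {a : Fin 4}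
    (hT : DifferentiableAt ℝ (fun y => T y a) x) :
    HasDir (fun y => T y a) x w (∑ c, w c * nabla1 L.g T x c a
      + ∑ f, (∑ c, w c * christoffel L.g x f c a) * T x f) := by
  refine (HasDir.of_differentiableAt hT _).congr_val ?_
  simp only [nabla1, mul_sub, Finset.sum_sub_distrib, Finset.mul_sum, Finset.sum_mul]
  rw [Finset.sum_comm (f := fun f c => w c * christoffel L.g x f c a * T x f)]
  simp only [mul_assoc]
  ring

omit hX hL hx in
theorem hasDir_tensor₂ {T : E4 → Fin 4 → Fin 4 → ℝ} {w : Fin 4 → ℝ} {a b : Fin 4}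
    (hT : DifferentiableAt ℝ (fun y => T y a b) x) :
    HasDir (fun y => T y a b) x w (∑ c, w c * nabla2 L.g T x c a b
      + ∑ f, (∑ c, w c * christoffel L.g x f c a) * T x f b
      + ∑ f, (∑ c, w c * christoffel L.g x f c b) * T x a f) := by
  refine (HasDir.of_differentiableAt hT _).congr_val ?_
  simp only [nabla2, mul_sub, mul_add, Finset.sum_sub_distrib, Finset.sum_add_distrib,
    Finset.mul_sum, Finset.sum_mul]
  rw [Finset.sum_comm (f := fun f c => w c * christoffel L.g x f c a * T x f b),
    Finset.sum_comm (f := fun f c => w c * christoffel L.g x f c b * T x a f)]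
  simp only [mul_assoc]
  ring

omit hX hL hx in
theorem hasDir_tensor₄ {T : E4 → Fin 4 → Fin 4 → Fin 4 → Fin 4 → ℝ} {w : Fin 4 → ℝ}
    {a b d e : Fin 4} (hT : DifferentiableAt ℝ (fun y => T y a b d e) x) :
    HasDir (fun y => T y a b d e) x w (∑ c, w c * nabla4 L.g T x c a b d e
      + ∑ f, (∑ c, w c * christoffel L.g x f c a) * T x f b d e
      + ∑ f, (∑ c, w c * christoffel L.g x f c b) * T x a f d e
      + ∑ f, (∑ c, w c * christoffel L.g x f c d) * T x a b f e
      + ∑ f, (∑ c, w c * christoffel L.g x f c e) * T x a b d f) := by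
  refine (HasDir.of_differentiableAt hT _).congr_val ?_
  simp only [nabla4, mul_sub, mul_add, Finset.sum_sub_distrib, Finset.sum_add_distrib,
    Finset.mul_sum, Finset.sum_mul]
  rw [Finset.sum_comm (f := fun f c => w c * christoffel L.g x f c a * T x f b d e),
    Finset.sum_comm (f := fun f c => w c * christoffel L.g x f c b * T x a f d e),
    Finset.sum_comm (f := fun f c => w c * christoffel L.g x f c d * T x a b f e),
    Finset.sum_comm (f := fun f c => w c * christoffel L.g x f c e * T x a b d f)]
  simp only [mul_assoc]
  ring

/-- Differentiating a scalar component rotates the frame and differentiates the tensor covariantly.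
This and its higher-rank versions link the scalar functions to ∇. -/
theorem hasDir_fr1 {T : E4 → Fin 4 → ℝ} (hT : ∀ a, DifferentiableAt ℝ (fun y => T y a) x)
    (k i : Fin 4) : HasDir (fun y => fr1 (X y) (T y) i) x (X x k)
      (∑ l, L.conn X x k i l * fr1 (X x) (T x) l + fr2 (X x) (nabla1 L.g T x) k i) := by
  refine (Coord.hasDir_fr1 (hX.hasDir_frame hL hx k) (fun a => hasDir_tensor₁ (hT a)) i
    ).congr_val ?_
  have := fr1_add_sum (X x) (fun _ => 0) (X x k) (nabla1 L.g T x) i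
  simp only [zero_add] at this
  rw [this]
  simp [fr2, fr1]

theorem hasDir_fr2 {T : E4 → Fin 4 → Fin 4 → ℝ}
    (hT : ∀ a b, DifferentiableAt ℝ (fun y => T y a b) x)
    (k i j : Fin 4) : HasDir (fun y => fr2 (X y) (T y) i j) x (X x k)
      (∑ l, L.conn X x k i l * fr2 (X x) (T x) l j + ∑ l, L.conn X x k j l * fr2 (X x) (T x) i l
        + fr3 (X x) (nabla2 L.g T x) k i j) := by
  refine (Coord.hasDir_fr2 (hX.hasDir_frame hL hx k) (fun a b => hasDir_tensor₂ (hT a b)) i j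
    ).congr_val ?_
  have := fr2_add_sum (X x) (fun _ _ => 0) (X x k) (nabla2 L.g T x) i j
  simp only [zero_add] at this
  rw [this]
  simp [fr3, fr2, fr1]

theorem hasDir_fr4 {T : E4 → Fin 4 → Fin 4 → Fin 4 → Fin 4 → ℝ}
    (hT : ∀ a b c d, DifferentiableAt ℝ (fun y => T y a b c d) x)
    (m i j k l : Fin 4) : HasDir (fun y => fr4 (X y) (T y) i j k l) x (X x m)
      (act (L.conn X x m) (fr4 (X x) (T x)) i j k l
        + fr5 (X x) (nabla4 L.g T x) m i j k l) := by
  refine (Coord.hasDir_fr4 (hX.hasDir_frame hL hx m)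
    (fun a b c d => hasDir_tensor₄ (hT a b c d)) i j k l).congr_val ?_
  have := fr4_add_sum (X x) (fun _ _ _ _ => 0) (X x m) (nabla4 L.g T x) i j k l
  simp only [zero_add] at this
  rw [this]
  simp [fr5, fr4, fr3, fr2, fr1, act]

/-- Differentiate the constants g(X_i, X_j) and use ∇g = 0. -/
theorem conn_antisymm (k i j : Fin 4) :
    L.conn X x k i j * sg j + L.conn X x k j i * sg i = 0 := by
  have h := (hX.hasDir_fr2 hL hx (T := L.g) (fun a b =>
    differentiableAt_of_contDiffOn hL.isOpen (hL.smooth_g a b) hx) k i j).eq_zero_of_eventually_const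
    (s := if i = j then sg i else 0) (by
      filter_upwards [hX.eventually] with y hy using hy.isFrame i j)
  have h0 : fr3 (X x) (nabla2 L.g L.g x) k i j = 0 := by
    simp [fr3, fr2, fr1, hL.isMetricOn.nabla2_metric hx]
  have hf : ∀ i j, fr2 (X x) (L.g x) i j = if i = j then sg i else 0 := hX.isAdapted.isFrame
  simpa [h0, hf] using h

/-- Since X_0 = u near x, the components u_i = -δ_{i0} are constant, and their vanishing derivative
identifies ∇u with connection coefficients. -/
theorem fr2_nabla1_uLow (k i : Fin 4) :
    fr2 (X x) (nabla1 L.g L.uLow x) k i = L.conn X x k i 0 := by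
  have h := (hX.hasDir_fr1 hL hx (T := L.uLow) (fun a =>
    differentiableAt_of_contDiffOn hL.isOpen (hL.smooth_uLow a) hx) k i).eq_zero_of_eventually_const
    (s := if i = 0 then -1 else 0) (by
      filter_upwards [hX.eventually] with y hy using hy.fr1_uLow i)
  simp only [hX.isAdapted.fr1_uLow] at h
  simp at h
  linarith

theorem ricci_identity (k i j : Fin 4) :
    fr3 (X x) (nabla2 L.g (nabla1 L.g L.uLow) x) k i j
      - fr3 (X x) (nabla2 L.g (nabla1 L.g L.uLow) x) i k j =
      -fr4 (X x) (riemann L.g x) 0 j k i := by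
  have h0 (c a b : Fin 4) : ∑ e, riemannUp L.g x e b c a * L.uLow x e =
      fr1 (X x) (fun f => riemann L.g x f b c a) 0 := by
    simp only [fr1, uLow, riemann, hX.isAdapted.zero, Finset.mul_sum]
    rw [Finset.sum_comm]
    refine Finset.sum_congr rfl fun a _ => Finset.sum_congr rfl fun b _ => ?_
    rw [hL.symm x hx a b]
    ring
  have h1 : (fun c a b => nabla2 L.g (nabla1 L.g L.uLow) x c a b
      - nabla2 L.g (nabla1 L.g L.uLow) x a c b) =
      fun c a b => -fr1 (X x) (fun f => riemann L.g x f b c a) 0 := by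
    ext c a b
    rw [hL.isMetricOn.nabla2_nabla1_comm hx hL.smooth_uLow, h0]
  have h2 : fr3 (X x) (fun c a b => nabla2 L.g (nabla1 L.g L.uLow) x a c b) k i j =
      fr3 (X x) (nabla2 L.g (nabla1 L.g L.uLow) x) i k j :=
    fr2_swap (X x) (fun a c => fr1 (X x) (nabla2 L.g (nabla1 L.g L.uLow) x a c) j) k i
  rw [← h2, ← fr3_sub, h1, fr3_neg, fr1_moveOut (X x) (fun f c a b => riemann L.g x f b c a),
    fr4_swap₃ (X x) (fun f c a b => riemann L.g x f a c b), fr4_swap₂]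

end

end IsFrameField

namespace IsRegularOn

variable (hL : L.IsRegularOn U) {x : E4} (hx : x ∈ U) (e : Fin 4 → Fin 4 → ℝ)

include hL hx

theorem fr4_vol_swap₁ (i j k l : Fin 4) : fr4 e (L.vol x) j i k l = -fr4 e (L.vol x) i j k l :=
  fr4_antisymm₁ e (fun a b c d => hL.vol_swap₁ x hx a b c d) _ _ _ _

theorem fr4_vol_swap₂ (i j k l : Fin 4) : fr4 e (L.vol x) i k j l = -fr4 e (L.vol x) i j k l :=
  fr4_antisymm₂ e (fun a b c d => hL.vol_swap₂ x hx a b c d) _ _ _ _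

theorem fr4_vol_swap₃ (i j k l : Fin 4) : fr4 e (L.vol x) i j l k = -fr4 e (L.vol x) i j k l :=
  fr4_antisymm₃ e (fun a b c d => hL.vol_swap₃ x hx a b c d) _ _ _ _

/-- An alternating form in dimension four is fixed by one component; the factor in front of `lc` is
the orientation sign. -/
theorem fr4_vol (i m n : Fin 4) :
    fr4 e (L.vol x) i m n 0 = fr4 e (L.vol x) 1 2 3 0 * lc i m n := by
  have s1 := hL.fr4_vol_swap₁ hx e
  have s2 := hL.fr4_vol_swap₂ hx e
  have s3 := hL.fr4_vol_swap₃ hx e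
  have z1 (i k l : Fin 4) : fr4 e (L.vol x) i i k l = 0 := by linarith [s1 i i k l]
  have z2 (i k l : Fin 4) : fr4 e (L.vol x) k i i l = 0 := by linarith [s2 k i i l]
  have z3 (i k l : Fin 4) : fr4 e (L.vol x) k l i i = 0 := by linarith [s3 k l i i]
  have z4 (i k l : Fin 4) : fr4 e (L.vol x) i k i l = 0 := by linarith [s2 i k i l, z1 i k l]
  have z5 (i k l : Fin 4) : fr4 e (L.vol x) k i l i = 0 := by linarith [s3 k i l i, z2 i k l]
  have z6 (i k l : Fin 4) : fr4 e (L.vol x) i k l i = 0 := by linarith [s3 i k l i, z4 i k l]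
  have p213 := s1 1 2 3 0
  have p132 := s2 1 2 3 0
  have p231 : fr4 e (L.vol x) 2 3 1 0 = fr4 e (L.vol x) 1 2 3 0 := by
    linarith [s2 2 1 3 0]
  have p312 : fr4 e (L.vol x) 3 1 2 0 = fr4 e (L.vol x) 1 2 3 0 := by
    linarith [s1 1 3 2 0]
  have p321 : fr4 e (L.vol x) 3 2 1 0 = -fr4 e (L.vol x) 1 2 3 0 := by
    linarith [s1 2 3 1 0]
  fin_cases i <;> fin_cases m <;> fin_cases n <;>
    simp [lc, z1, z2, z3, z4, z5, z6, p213, p132, p231, p312, p321]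

theorem fr4_vol' (i m n : Fin 4) :
    fr4 e (L.vol x) i 0 m n = fr4 e (L.vol x) 1 2 3 0 * lc i m n := by
  rw [hL.fr4_vol_swap₂ hx e i m 0 n, hL.fr4_vol_swap₃ hx e i m n 0, neg_neg, hL.fr4_vol hx e]

end IsRegularOn

namespace IsAdapted

variable {x : E4} {e : Fin 4 → Fin 4 → ℝ} (he : L.IsAdapted x e)
  (hL : L.IsRegularOn U) (hx : x ∈ U)

include hL hx

/-- The Weyl tensor of a spacetime with `E = 0` in an adapted frame. -/
theorem exists_fr4_weyl_eq (he : L.IsAdapted x e) (hE : L.electric x = 0) :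
    ∃ M : Fin 4 → Fin 4 → ℝ, (∀ p, M p 0 = 0) ∧ (∀ p q, M p q = M q p) ∧
      M 1 1 + M 2 2 + M 3 3 = 0 ∧
      ∀ i j k l, fr4 e (weyl L.g x) i j k l = magneticWeyl M i j k l := by
  have hg := hL.isMetricOn
  refine exists_eq_magneticWeyl (fun i j k l => ?_) (fun i j k l => ?_) (fun i j k l => ?_)
    (fun i j k l => ?_) (fun j l => ?_) (fun i j => ?_)
  · exact fr4_antisymm₁ e (fun a b c d => hg.weyl_antisymm_left hx a b c d) _ _ _ _
  · exact fr4_antisymm₃ e (fun a b c d => hg.weyl_antisymm_right hx a b c d) _ _ _ _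
  · rw [← fr4_pair]
    exact congrArg (fun S => fr4 e S i j k l)
      (by ext a b c d; exact hg.weyl_pair_symm hx a b c d)
  · have h1 := fr4_cycle e (weyl L.g x) i j k l
    have h2 := fr4_cycle e (fun a b c d => weyl L.g x a c d b) i j k l
    rw [fr4_cycle e (weyl L.g x) i k l j] at h2
    rw [← h1, ← h2, ← fr4_add, ← fr4_add e (fun a b c d => weyl L.g x a b c d
      + weyl L.g x a c d b)]
    simp only [hg.weyl_cyclic hx]
    simp [fr4, fr3, fr2, fr1]
  · have h (m : Fin 4) : fr4 e (weyl L.g x) m j m l =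
        fr2 e (fun a c => fr2 e (fun b d => weyl L.g x a b c d) j l) m m := by
      rw [← fr4_swap₂]
      rfl
    simp only [h]
    rw [← sum_contract he.inv_eq]
    have h3 : fr2 e (fun b d => ∑ a, ∑ c, inv L.g x a c * weyl L.g x a b c d) j l =
        ∑ a, ∑ c, inv L.g x a c * fr2 e (fun b d => weyl L.g x a b c d) j l := by
      unfold fr2
      simp only [fr1_sum_sum e (inv L.g x) (fun d a c => weyl L.g x a _ c d)]
      exact fr1_sum_sum e (inv L.g x) (fun b a c => fr1 e (fun d => weyl L.g x a b c d) l) j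
    rw [← h3]
    simp [hg.weyl_trace hx, fr2, fr1]
  · rw [← he.fr2_electric, hE]
    simp [fr2, fr1]

include he

theorem vol_sq : fr4 e (L.vol x) 1 2 3 0 * fr4 e (L.vol x) 1 2 3 0 = 1 := by
  have h := hL.vol_sq x hx e he.isFrame
  rw [hL.fr4_vol_swap₃ hx e 1 2 0 3, hL.fr4_vol_swap₂ hx e 1 0 2 3,
    hL.fr4_vol_swap₁ hx e 0 1 2 3]
  linarith

end IsAdapted

end LocalData

/-! ### The Weyl tensor along a frame field when E = 0. -/

namespace Coord

theorem IsMetricOn.nabla4_weyl_pair_symm {g : E4 → Fin 4 → Fin 4 → ℝ} {U : Set E4} {x : E4}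
    (hg : IsMetricOn g U) (hx : x ∈ U) (e a b c d : Fin 4) :
    nabla4 g (weyl g) x e c d a b = nabla4 g (weyl g) x e a b c d := by
  have : (fun y => weyl g y c d a b) =ᶠ[nhds x] fun y => weyl g y a b c d := by
    filter_upwards [hg.isOpen.mem_nhds hx] with y hy using hg.weyl_pair_symm hy a b c d
  have h : pd e (fun y => weyl g y c d a b) x = pd e (fun y => weyl g y a b c d) x := by
    simp [pd, this.fderiv_eq]
  unfold nabla4
  rw [h]
  congr 1
  refine Finset.sum_congr rfl fun f _ => ?_
  rw [hg.weyl_pair_symm hx a b f d, hg.weyl_pair_symm hx a b c f, hg.weyl_pair_symm hx f b c d,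
    hg.weyl_pair_symm hx a f c d]
  ring

/-- The Bianchi identity cycles through the second index pair; pair symmetry moves it to the first,
the form needed to take a divergence. -/
theorem IsMetricOn.fr5_nabla4_weyl_cyclic {g : E4 → Fin 4 → Fin 4 → ℝ} {U : Set E4} {x : E4}
    (hg : IsMetricOn g U) (hx : x ∈ U) (hC : cotton g x = 0) (e : Fin 4 → Fin 4 → ℝ)
    (m i j k l : Fin 4) :
    fr5 e (nabla4 g (weyl g) x) m i j k l + fr5 e (nabla4 g (weyl g) x) i j m k l
      + fr5 e (nabla4 g (weyl g) x) j m i k l = 0 := by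
  let F (a b c : Fin 4) : ℝ := fr2 e (nabla4 g (weyl g) x a b c) k l
  have h1 : fr5 e (nabla4 g (weyl g) x) i j m k l = fr3 e (fun a b c => F b c a) m i j :=
    (fr3_rotate e F m i j).symm
  have h2 : fr5 e (nabla4 g (weyl g) x) j m i k l = fr3 e (fun a b c => F c a b) m i j := by
    have h := fr3_rotate e (fun a b c => F b c a) m i j
    rw [fr3_rotate e F i j m] at h
    exact h.symm
  have h3 (a b c : Fin 4) : F a b c + F b c a + F c a b = 0 := by
    simp only [F, fr2, fr1, ← Finset.sum_add_distrib, ← mul_add]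
    refine Finset.sum_eq_zero fun p _ => mul_eq_zero_of_right _ <|
      Finset.sum_eq_zero fun q _ => mul_eq_zero_of_right _ ?_
    have := hg.bianchi_weyl hx hC a p q b c
    simpa only [hg.nabla4_weyl_pair_symm hx _ p q] using this
  have h4 : fr3 e F m i j + fr3 e (fun a b c => F b c a) m i j
      + fr3 e (fun a b c => F c a b) m i j = fr3 e (fun a b c => F a b c + F b c a + F c a b) m i j := by
    simp only [fr3, fr2, fr1, mul_add, Finset.sum_add_distrib]
  rw [h1, h2]
  refine h4.trans ?_
  simp [h3, fr3, fr2, fr1]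

theorem hasDir_magneticWeyl {M : E4 → Fin 4 → Fin 4 → ℝ} {dM : Fin 4 → Fin 4 → ℝ} {x : E4}
    {w : Fin 4 → ℝ} (h : ∀ p q, HasDir (fun y => M y p q) x w (dM p q)) (i j k l : Fin 4) :
    HasDir (fun y => magneticWeyl (M y) i j k l) x w (magneticWeyl dM i j k l) := by
  have h' (r : Fin 4 → ℝ) (s : ℝ) (q : Fin 4) :
      HasDir (fun y => (∑ p, r p * M y p q) * s) x w ((∑ p, r p * dM p q) * s) :=
    ((HasDir.sum fun p => (h p q).const_mul (r p)).mul (.const s)).congr_val (by ring)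
  exact (((h' _ _ k).sub (h' _ _ l)).add (h' _ _ i)).sub (h' _ _ j)

end Coord

namespace LocalData

open Coord

variable {L : LocalData} {U : Set E4}

/-- The dual of the spatial part of `w i j k 0` on its first two indices. -/
def magneticComp (w : Fin 4 → Fin 4 → Fin 4 → Fin 4 → ℝ) (p k : Fin 4) : ℝ :=
  if p = 1 then w 2 3 k 0 else if p = 2 then w 3 1 k 0 else if p = 3 then w 1 2 k 0 else 0

/-- M is recovered from W by an explicit linear formula. Hence it depends differentiably on the
point, which a pointwise existence statement would not give. -/
theorem magneticComp_magneticWeyl {M : Fin 4 → Fin 4 → ℝ} (h0 : ∀ p, M p 0 = 0)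
    (hs : ∀ p q, M p q = M q p) : magneticComp (magneticWeyl M) = M := by
  have h0' (p : Fin 4) : M 0 p = 0 := by rw [hs, h0]
  ext p k
  fin_cases p <;> fin_cases k <;>
    simp [magneticComp, magneticWeyl, lc, h0, h0', hs]

theorem IsAdapted.magneticComp_weyl {x : E4} {e : Fin 4 → Fin 4 → ℝ} (he : L.IsAdapted x e)
    (hL : L.IsRegularOn U) (hx : x ∈ U) (hE : L.electric x = 0) :
    let M := magneticComp (fr4 e (weyl L.g x))
    (∀ p, M p 0 = 0) ∧ (∀ p q, M p q = M q p) ∧ M 1 1 + M 2 2 + M 3 3 = 0 ∧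
      fr4 e (weyl L.g x) = magneticWeyl M := by
  obtain ⟨M, h0, hs, ht, hM⟩ := exists_fr4_weyl_eq hL hx he hE
  have h : fr4 e (weyl L.g x) = magneticWeyl M := by
    ext i j k l
    exact hM i j k l
  rw [h, magneticComp_magneticWeyl h0 hs]
  exact ⟨h0, hs, ht, rfl⟩

namespace IsFrameField

variable {x : E4} {X : E4 → Fin 4 → Fin 4 → ℝ}

/-- Because E vanishes on all of U, the purely magnetic form holds at every point near x and can be
differentiated there; the symmetry of M and the vanishing of its entries M p 0 pass to dM. -/
theorem exists_hasDir_magneticComp (hX : L.IsFrameField x X) (hL : L.IsRegularOn U) (hx : x ∈ U)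
    (hE : ∀ y ∈ U, L.electric y = 0) :
    ∃ dM : Fin 4 → Fin 4 → Fin 4 → ℝ, (∀ m p, dM m p 0 = 0) ∧ (∀ m p q, dM m p q = dM m q p) ∧
      ∀ m i j k l, magneticWeyl (dM m) i j k l =
        act (L.conn X x m) (fr4 (X x) (weyl L.g x)) i j k l
          + fr5 (X x) (nabla4 L.g (weyl L.g) x) m i j k l := by
  have hd := hX.hasDir_fr4 hL hx (T := weyl L.g) fun a b c d => hL.isMetricOn.smooth_weyl hx a b c d
  have hev : ∀ᶠ y in nhds x, y ∈ U ∧ L.IsAdapted y (X y) :=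
    (hL.isOpen.eventually_mem hx).and hX.eventually
  let W (m i j k l : Fin 4) : ℝ := act (L.conn X x m) (fr4 (X x) (weyl L.g x)) i j k l
          + fr5 (X x) (nabla4 L.g (weyl L.g) x) m i j k l
  have hM (m p q : Fin 4) : HasDir (fun y => magneticComp (fr4 (X y) (weyl L.g y)) p q) x (X x m)
      (magneticComp (W m) p q) := by
    unfold magneticComp
    split_ifs
    · exact hd _ _ _ _ _
    · exact hd _ _ _ _ _
    · exact hd _ _ _ _ _
    · exact .const 0
  refine ⟨fun m => magneticComp (W m), fun m p => ?_, fun m p q => ?_, fun m i j k l => ?_⟩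
  · refine (hM m p 0).eq_zero_of_eventually_const (s := 0) ?_
    filter_upwards [hev] with y hy
    exact (hy.2.magneticComp_weyl hL hy.1 (hE y hy.1)).1 p
  · refine (hM m p q).unique ((hM m q p).congr ?_)
    filter_upwards [hev] with y hy
    exact (hy.2.magneticComp_weyl hL hy.1 (hE y hy.1)).2.1 p q
  · refine (hasDir_magneticWeyl (hM m) i j k l).unique ((hd m i j k l).congr ?_)
    filter_upwards [hev] with y hy
    rw [← (hy.2.magneticComp_weyl hL hy.1 (hE y hy.1)).2.2.2]

/-- The antisymmetry and trace-freeness of ∇W are obtained as differences of two terms that have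
them, `magneticWeyl` of dM and the connection action. Contracting the Bianchi identity then gives
div W = 0. -/
theorem weyl_divergence_and_strain (hX : L.IsFrameField x X) (hL : L.IsRegularOn U) (hx : x ∈ U)
    (hE : ∀ y ∈ U, L.electric y = 0) (hC : cotton L.g x = 0) :
    (∀ a b d, ∑ m, sg m * fr5 (X x) (nabla4 L.g (weyl L.g) x) m a b m d = 0) ∧
      ∀ j, weylStrain (fr2 (X x) (nabla1 L.g L.uLow x)) (fr4 (X x) (weyl L.g x)) j = 0 := by
  obtain ⟨dM, hd0, hds, hD⟩ := hX.exists_hasDir_magneticComp hL hx hE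
  obtain ⟨h0, hs, htr, hw⟩ := hX.isAdapted.magneticComp_weyl hL hx (hE x hx)
  set M := magneticComp (fr4 (X x) (weyl L.g x))
  have hγ := hX.conn_antisymm hL hx
  have hdiv : ∀ a b d, ∑ m, sg m * fr5 (X x) (nabla4 L.g (weyl L.g) x) m a b m d = 0 := by
    refine div_of_cyclic (fun m i j k l => hL.isMetricOn.fr5_nabla4_weyl_cyclic hx hC _ m i j k l)
      (fun m i j k l => ?_) (fun m b d => ?_)
    · have h1 := hD m i j k l
      have h2 := hD m j i k l
      rw [hw] at h1 h2
      rw [magneticWeyl_swap_left, act_swap_left (magneticWeyl_swap_left M)] at h2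
      linarith
    · have h1 := magneticWeyl_trace (hd0 m) (hds m) b d
      have h2 := trace_act (hγ m) (magneticWeyl_trace h0 hs) b d
      simp only [hD, hw, mul_add, Finset.sum_add_distrib] at h1
      linarith
  refine ⟨hdiv, fun j => ?_⟩
  rw [hw]
  exact weylStrain_eq_zero hγ (hX.fr2_nabla1_uLow hL hx) h0 hs htr hd0
    (fun m i j k l => by rw [← hw]; exact hD m i j k l) hdiv j

theorem weylStrain_divergence (hX : L.IsFrameField x X) (hL : L.IsRegularOn U) (hx : x ∈ U)
    (hE : ∀ y ∈ U, L.electric y = 0) (hC : ∀ y ∈ U, cotton L.g y = 0)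
    {dB : Fin 4 → Fin 4 → Fin 4 → ℝ} (hB : ∀ m k l,
      HasDir (fun y => fr2 (X y) (nabla1 L.g L.uLow y) k l) x (X x m) (dB m k l)) :
    let B := fr2 (X x) (nabla1 L.g L.uLow x)
    let w := fr4 (X x) (weyl L.g x)
    ∑ j, sg j * ∑ k, ∑ l, (dB j k l * (w k l j 0 + w k 0 j l)
        + B k l * (act (L.conn X x j) w k l j 0 + act (L.conn X x j) w k 0 j l)) = 0 := by
  intro B w
  have hdiv := (hX.weyl_divergence_and_strain hL hx hE (hC x hx)).1
  have hd := hX.hasDir_fr4 hL hx (T := weyl L.g) fun a b c d => hL.isMetricOn.smooth_weyl hx a b c d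
  have hev : ∀ᶠ y in nhds x, y ∈ U ∧ L.IsAdapted y (X y) :=
    (hL.isOpen.eventually_mem hx).and hX.eventually
  let N := fr5 (X x) (nabla4 L.g (weyl L.g) x)
  have h (j : Fin 4) : ∑ k, ∑ l, (dB j k l * (w k l j 0 + w k 0 j l)
      + B k l * (act (L.conn X x j) w k l j 0 + N j k l j 0
        + (act (L.conn X x j) w k 0 j l + N j k 0 j l))) = 0 := by
    refine (HasDir.sum fun k => HasDir.sum fun l => (hB j k l).mul
      ((hd j k l j 0).add (hd j k 0 j l))).eq_zero_of_eventually_const (s := 0) ?_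
    filter_upwards [hev] with y hy
    -- X is known to be differentiable only at x, so the strain constraint at a nearby y is taken
    -- from another frame field with the same value at y. The strain at y involves only that value.
    obtain ⟨Y, hY, hYf⟩ := hL.exists_isFrameField hy.1 hy.2
    have := (hYf.weyl_divergence_and_strain hL hy.1 hE (hC y hy.1)).2 j
    rwa [hY] at this
  -- The terms containing ∇W add up to divergences of W and vanish.
  have h1 : ∑ j, sg j * ∑ k, ∑ l, B k l * (N j k l j 0 + N j k 0 j l) = 0 := by
    have h2 (k l : Fin 4) : ∑ j, sg j * (N j k l j 0 + N j k 0 j l) = 0 := by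
      simp only [mul_add, Finset.sum_add_distrib]
      rw [hdiv, hdiv, add_zero]
    have h3 : ∑ k, ∑ l, B k l * ∑ j, sg j * (N j k l j 0 + N j k 0 j l) = 0 := by simp [h2]
    rw [← h3]
    simp only [Finset.mul_sum]
    rw [Finset.sum_comm]
    refine Finset.sum_congr rfl fun k _ => ?_
    rw [Finset.sum_comm]
    exact Finset.sum_congr rfl fun l _ => Finset.sum_congr rfl fun j _ => by ring
  have h2 : ∑ j, sg j * ∑ k, ∑ l, (dB j k l * (w k l j 0 + w k 0 j l)
      + B k l * (act (L.conn X x j) w k l j 0 + N j k l j 0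
        + (act (L.conn X x j) w k 0 j l + N j k 0 j l))) = 0 := by simp [h]
  have h6 : (∑ j, sg j * ∑ k, ∑ l, (dB j k l * (w k l j 0 + w k 0 j l)
        + B k l * (act (L.conn X x j) w k l j 0 + act (L.conn X x j) w k 0 j l)))
      + ∑ j, sg j * ∑ k, ∑ l, B k l * (N j k l j 0 + N j k 0 j l) = 0 := by
    rw [← h2, ← Finset.sum_add_distrib]
    refine Finset.sum_congr rfl fun j _ => ?_
    rw [← mul_add, ← Finset.sum_add_distrib]
    congr 1
    refine Finset.sum_congr rfl fun k _ => ?_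
    rw [← Finset.sum_add_distrib]
    exact Finset.sum_congr rfl fun l _ => by ring
  linarith

end IsFrameField

end LocalData

/-! ### Shear, vorticity and H in the frame field; the local identity. -/

namespace Coord

namespace IsFrame

variable {G e : Fin 4 → Fin 4 → ℝ} (h : IsFrame G e)

include h

theorem eq_zero_of_fr1 {v : Fin 4 → ℝ} (hv : ∀ i, fr1 e v i = 0) : v = 0 := by
  have hm : (Matrix.of fun a i => sg i * e i a) * Matrix.of e * Matrix.of G = 1 := by
    ext a b
    simp only [Matrix.mul_apply, Matrix.of_apply, h.completeness a b, Matrix.one_apply]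
  have hd := congrArg Matrix.det hm
  rw [Matrix.det_mul, Matrix.det_mul, Matrix.det_one] at hd
  refine Matrix.eq_zero_of_mulVec_eq_zero (M := Matrix.of e) (fun h0 => ?_) (funext hv)
  rw [h0] at hd
  simp at hd

theorem eq_zero_of_fr2 {A : Fin 4 → Fin 4 → ℝ} (hA : ∀ i j, fr2 e A i j = 0) : A = 0 := by
  have h1 (j : Fin 4) : (fun a => fr1 e (A a) j) = 0 := h.eq_zero_of_fr1 fun i => hA i j
  funext a
  exact h.eq_zero_of_fr1 fun j => congrFun (h1 j) a

end IsFrame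

theorem lc_eq_zero {i m n : Fin 4} (h : i = 0 ∨ m = 0 ∨ n = 0) : lc i m n = 0 := by
  unfold lc
  rcases h with rfl | rfl | rfl <;> simp

theorem sg_eq_one {i : Fin 4} (h : i ≠ 0) : sg i = 1 := if_neg h

/-- `lc` vanishes on any index 0, so the deleted components and the Lorentz signs have no effect on
a sum against it. -/
theorem sum_lc_mul (s : ℝ) (i : Fin 4) (p : Prop) [Decidable p] (hp : ¬p) (F : Fin 4 → Fin 4 → ℝ) :
    ∑ m, ∑ n, sg m * sg n * (s * lc i m n * (if m = 0 ∨ p ∨ n = 0 then 0 else F m n)) =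
      s * ∑ m, ∑ n, lc i m n * F m n := by
  simp only [Finset.mul_sum]
  refine Finset.sum_congr rfl fun m _ => Finset.sum_congr rfl fun n _ => ?_
  by_cases hm : m = 0
  · simp [lc_eq_zero (.inr (.inl hm))]
  by_cases hn : n = 0
  · simp [lc_eq_zero (.inr (.inr hn))]
  simp [hm, hn, hp, sg_eq_one]
  ring

theorem hasDir_vorticityComp {B : E4 → Fin 4 → Fin 4 → ℝ} {dB : Fin 4 → Fin 4 → ℝ} {x : E4}
    {w : Fin 4 → ℝ} (h : ∀ p q, HasDir (fun y => B y p q) x w (dB p q)) (i : Fin 4) :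
    HasDir (fun y => vorticityComp (B y) i) x w (vorticityComp dB i) := by
  have h1 := (HasDir.sum fun m => HasDir.sum fun n => (h m n).const_mul (lc i m n)).const_mul (-1 / 2)
  have h2 (A : Fin 4 → Fin 4 → ℝ) :
      vorticityComp A i = -1 / 2 * ∑ m, ∑ n, lc i m n * A m n := by
    unfold vorticityComp; ring
  simp only [h2]
  exact h1

theorem hasDir_shearComp {B : E4 → Fin 4 → Fin 4 → ℝ} {dB : Fin 4 → Fin 4 → ℝ} {θ : E4 → ℝ} {dθ : ℝ}
    {x : E4} {w : Fin 4 → ℝ} (h : ∀ p q, HasDir (fun y => B y p q) x w (dB p q))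
    (hθ : HasDir θ x w dθ) (i j : Fin 4) :
    HasDir (fun y => shearComp (B y) (θ y) i j) x w (shearComp dB dθ i j) := by
  have hs (i j : Fin 4) : HasDir (fun y => spatialPart (B y) i j) x w (spatialPart dB i j) := by
    unfold spatialPart
    split_ifs
    · exact .const 0
    · exact h i j
  have h1 := (((hs i j).add (hs j i)).const_mul (1 / 2)).sub
    (hθ.const_mul ((if i = j ∧ i ≠ 0 then 1 else 0) / 3))
  have h2 (A : Fin 4 → Fin 4 → ℝ) (t : ℝ) : shearComp A t i j =
      1 / 2 * (spatialPart A i j + spatialPart A j i)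
        - (if i = j ∧ i ≠ 0 then 1 else 0) / 3 * t := by
    unfold shearComp; ring
  simp only [h2]
  exact h1

end Coord

namespace LocalData

open Coord

variable {L : LocalData} {U : Set E4}

namespace IsRegularOn

variable (hL : L.IsRegularOn U)

include hL

theorem smooth_proj (a b : Fin 4) : ContDiffOn ℝ ∞ (fun y => L.proj y a b) U :=
  contDiffOn_const.add ((hL.smooth_u a).mul (hL.smooth_uLow b))

theorem smooth_D1_uLow (a b : Fin 4) : ContDiffOn ℝ ∞ (fun y => L.D1 L.uLow y a b) U :=
  ContDiffOn.sum fun _ _ => ContDiffOn.sum fun _ _ => ((hL.smooth_proj _ _).mul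
    (hL.smooth_proj _ _)).mul (hL.smooth_nabla1 hL.smooth_uLow _ _)

theorem smooth_epsUp (a b c : Fin 4) : ContDiffOn ℝ ∞ (fun y => L.epsUp y a b c) U :=
  ContDiffOn.sum fun _ _ => ContDiffOn.sum fun _ _ => ((hL.isMetricOn.smooth_inv _ _).mul
    (hL.isMetricOn.smooth_inv _ _)).mul <| ContDiffOn.sum fun _ _ =>
      (hL.smooth_vol _ _ _ _).mul (hL.smooth_u _)

theorem smooth_vorticity (a : Fin 4) : ContDiffOn ℝ ∞ (fun y => L.vorticity y a) U :=
  (ContDiffOn.sum fun _ _ => ContDiffOn.sum fun _ _ => (hL.smooth_epsUp _ _ _).mul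
    (hL.smooth_D1_uLow _ _)).neg.div_const _

theorem smooth_expansion : ContDiffOn ℝ ∞ L.expansion U :=
  ContDiffOn.sum fun _ _ => ContDiffOn.sum fun _ _ => (hL.isMetricOn.smooth_inv _ _).mul
    (hL.smooth_nabla1 hL.smooth_uLow _ _)

theorem smooth_shear (a b : Fin 4) : ContDiffOn ℝ ∞ (fun y => L.shear y a b) U :=
  (((hL.smooth_D1_uLow _ _).add (hL.smooth_D1_uLow _ _)).div_const _).sub
    ((hL.smooth_expansion.div_const _).mul
      ((hL.smooth_g _ _).add ((hL.smooth_uLow _).mul (hL.smooth_uLow _))))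

end IsRegularOn

namespace IsAdapted

variable {x : E4} {e : Fin 4 → Fin 4 → ℝ} (he : L.IsAdapted x e)

include he

theorem fr2_shear_eq (i j : Fin 4) : fr2 e (L.shear x) i j =
    shearComp (fr2 e (nabla1 L.g L.uLow x)) (L.expansion x) i j := by
  rw [he.fr2_shear, he.fr2_D1, he.fr2_D1]
  rfl

variable (hL : L.IsRegularOn U) (hx : x ∈ U)

include hL hx

theorem fr1_vorticity_eq (i : Fin 4) : fr1 e (L.vorticity x) i =
    fr4 e (L.vol x) 1 2 3 0 * vorticityComp (fr2 e (nabla1 L.g L.uLow x)) i := by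
  have h := sum_lc_mul (fr4 e (L.vol x) 1 2 3 0) i False not_false (fr2 e (nabla1 L.g L.uLow x))
  simp only [false_or] at h
  simp only [he.fr1_vorticity, he.fr2_D1, hL.fr4_vol hx e i, h, vorticityComp]
  ring

/-- The magnetic field is the orientation sign times M. Vorticity and curl carry the same sign, so
it drops out of every scalar product with H. -/
theorem fr2_magnetic_eq (hE : L.electric x = 0) (i k : Fin 4) : fr2 e (L.magnetic x) i k =
    fr4 e (L.vol x) 1 2 3 0 * magneticComp (fr4 e (weyl L.g x)) i k := by
  obtain ⟨h0, hs, -, hw⟩ := he.magneticComp_weyl hL hx hE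
  set M := magneticComp (fr4 e (weyl L.g x))
  have h0' (p : Fin 4) : M 0 p = 0 := by rw [hs, h0]
  simp only [he.fr2_magnetic, hL.fr4_vol' hx e i, hw]
  fin_cases i <;> fin_cases k <;>
    simp [magneticWeyl, lc, sg, Fin.sum_univ_four, h0, h0']

theorem traceSq_magnetic (hE : L.electric x = 0) : traceSq L.g x (L.magnetic x) =
    ∑ i, ∑ j, magneticComp (fr4 e (weyl L.g x)) i j * magneticComp (fr4 e (weyl L.g x)) i j := by
  obtain ⟨h0, hs, -, -⟩ := he.magneticComp_weyl hL hx hE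
  simp only [he.traceSq_eq, he.fr2_magnetic_eq hL hx hE]
  set M := magneticComp (fr4 e (weyl L.g x))
  have h0' (p : Fin 4) : M 0 p = 0 := by rw [hs, h0]
  refine Finset.sum_congr rfl fun i _ => Finset.sum_congr rfl fun j _ => ?_
  by_cases hi : i = 0
  · simp [hi, h0']
  by_cases hj : j = 0
  · simp [hj, h0]
  rw [sg_eq_one hi, sg_eq_one hj, hs j i]
  linear_combination M i j * M i j * he.vol_sq hL hx

/-- H has only spatial components and is symmetric, so Tr H² is a sum of squares despite the
Lorentzian signature. -/
theorem traceSq_magnetic_pos (hE : L.electric x = 0) (hH : L.magnetic x ≠ 0) :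
    0 < traceSq L.g x (L.magnetic x) := by
  rw [he.traceSq_magnetic hL hx hE]
  have hnn (i j : Fin 4) : 0 ≤ magneticComp (fr4 e (weyl L.g x)) i j
      * magneticComp (fr4 e (weyl L.g x)) i j := mul_self_nonneg _
  refine (Finset.sum_nonneg fun i _ => Finset.sum_nonneg fun j _ => hnn i j).lt_of_ne' fun h => hH ?_
  refine he.isFrame.eq_zero_of_fr2 fun i j => ?_
  have h1 := (Finset.sum_eq_zero_iff_of_nonneg fun i _ => Finset.sum_nonneg fun j _ => hnn i j).1 h
    i (Finset.mem_univ i)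
  have h2 := (Finset.sum_eq_zero_iff_of_nonneg fun j _ => hnn i j).1 h1 j (Finset.mem_univ j)
  rw [he.fr2_magnetic_eq hL hx hE, mul_self_eq_zero.1 h2, mul_zero]

/-- The scalar product of the magnetic field with a tensor whose spatial components are known. -/
theorem inner2_magnetic (hE : L.electric x = 0) {A C : Fin 4 → Fin 4 → ℝ}
    (hA : ∀ i j, i ≠ 0 → j ≠ 0 → fr2 e A i j = fr4 e (L.vol x) 1 2 3 0 * C i j) :
    inner2 L.g x (L.magnetic x) A =
      ∑ i, ∑ j, magneticComp (fr4 e (weyl L.g x)) i j * C i j := by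
  obtain ⟨h0, hs, -, -⟩ := he.magneticComp_weyl hL hx hE
  simp only [he.inner2_eq, he.fr2_magnetic_eq hL hx hE]
  set M := magneticComp (fr4 e (weyl L.g x))
  have h0' (p : Fin 4) : M 0 p = 0 := by rw [hs, h0]
  refine Finset.sum_congr rfl fun i _ => Finset.sum_congr rfl fun j _ => ?_
  by_cases hi : i = 0
  · simp [hi, h0']
  by_cases hj : j = 0
  · simp [hj, h0]
  rw [sg_eq_one hi, sg_eq_one hj, hA i j hi hj]
  linear_combination M i j * C i j * he.vol_sq hL hx

end IsAdapted

namespace IsFrameField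

variable {x : E4} {X : E4 → Fin 4 → Fin 4 → ℝ} (hX : L.IsFrameField x X)
  (hL : L.IsRegularOn U) (hx : x ∈ U)

include hX hL hx

/-- The component has square 1 near x; differentiating the square and dividing by the nonzero
component shows that its derivative is 0. This allows the sign to be pulled out of ∇ω. -/
theorem hasDir_vol (m : Fin 4) : HasDir (fun y => fr4 (X y) (L.vol y) 1 2 3 0) x (X x m) 0 := by
  have h := hX.hasDir_fr4 hL hx (T := L.vol) (fun a b c d =>
    differentiableAt_of_contDiffOn hL.isOpen (hL.smooth_vol a b c d) hx) m 1 2 3 0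
  refine h.congr_val ?_
  have h2 := (h.mul h).eq_zero_of_eventually_const (s := 1) (by
    filter_upwards [hL.isOpen.eventually_mem hx, hX.eventually] with y hy hy' using hy'.vol_sq hL hy)
  have h3 := hX.isAdapted.vol_sq hL hx
  set r := act (L.conn X x m) (fr4 (X x) (L.vol x)) 1 2 3 0
    + fr5 (X x) (nabla4 L.g L.vol x) m 1 2 3 0
  linear_combination fr4 (X x) (L.vol x) 1 2 3 0 / 2 * h2 - r * h3

variable {dB : Fin 4 → Fin 4 → Fin 4 → ℝ}
  (hB : ∀ m k l, HasDir (fun y => fr2 (X y) (nabla1 L.g L.uLow y) k l) x (X x m) (dB m k l))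

include hB

theorem fr2_nabla1_vorticity (m i : Fin 4) : fr2 (X x) (nabla1 L.g L.vorticity x) m i =
    fr4 (X x) (L.vol x) 1 2 3 0 *
      nablaVorticityComp (L.conn X x) (fr2 (X x) (nabla1 L.g L.uLow x)) dB m i := by
  have h1 := hX.hasDir_fr1 hL hx (T := L.vorticity) (fun a =>
    differentiableAt_of_contDiffOn hL.isOpen (hL.smooth_vorticity a) hx) m i
  have h2 := (hX.hasDir_vol hL hx m).mul (hasDir_vorticityComp (hB m) i)
  have h3 := h1.unique (h2.congr (by
    filter_upwards [hL.isOpen.eventually_mem hx, hX.eventually] with y hy hy'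
    exact hy'.fr1_vorticity_eq hL hy i))
  simp only [hX.isAdapted.fr1_vorticity_eq hL hx] at h3
  simp only [nablaVorticityComp, mul_sub, Finset.mul_sum]
  rw [← eq_sub_iff_add_eq'] at h3
  rw [h3, zero_mul, zero_add]
  congr 1
  exact Finset.sum_congr rfl fun l _ => by ring

theorem fr3_nabla2_shear {dθ : Fin 4 → ℝ} (hθ : ∀ m, HasDir L.expansion x (X x m) (dθ m))
    (m i j : Fin 4) : fr3 (X x) (nabla2 L.g L.shear x) m i j =
      nablaShearComp (L.conn X x) (fr2 (X x) (nabla1 L.g L.uLow x)) dB (L.expansion x) dθ m i j := by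
  have h1 := hX.hasDir_fr2 hL hx (T := L.shear) (fun a b =>
    differentiableAt_of_contDiffOn hL.isOpen (hL.smooth_shear a b) hx) m i j
  have h3 := h1.unique ((hasDir_shearComp (hB m) (hθ m) i j).congr (by
    filter_upwards [hX.eventually] with y hy'
    exact hy'.fr2_shear_eq i j))
  simp only [hX.isAdapted.fr2_shear_eq] at h3
  simp only [nablaShearComp]
  linarith

theorem magVorticity_eq (hE : L.electric x = 0) :
    let B := fr2 (X x) (nabla1 L.g L.uLow x)
    L.magVorticity x = ∑ i, ∑ j, magneticComp (fr4 (X x) (weyl L.g x)) i j *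
      (nablaVorticityComp (L.conn X x) B dB i j + 2 * (B 0 i * vorticityComp B j)) := by
  intro B
  refine hX.isAdapted.inner2_magnetic hL hx hE fun i j hi hj => ?_
  rw [hX.isAdapted.fr2_vorticityTensor, hX.isAdapted.fr2_D1, if_neg (not_or.2 ⟨hi, hj⟩),
    hX.fr2_nabla1_vorticity hL hx hB, hX.isAdapted.fr1_vorticity_eq hL hx]
  ring

theorem magCurlShear_eq (hE : L.electric x = 0) {dθ : Fin 4 → ℝ}
    (hθ : ∀ m, HasDir L.expansion x (X x m) (dθ m)) :
    let B := fr2 (X x) (nabla1 L.g L.uLow x)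
    L.magCurlShear x = ∑ i, ∑ j, magneticComp (fr4 (X x) (weyl L.g x)) i j *
      curlShearComp (L.conn X x) B dB (L.expansion x) dθ i j := by
  intro B
  refine hX.isAdapted.inner2_magnetic hL hx hE fun i j hi hj => ?_
  simp only [hX.isAdapted.fr2_curl, hX.isAdapted.fr3_D2, hL.fr4_vol hx (X x) i,
    hL.fr4_vol hx (X x) j, sum_lc_mul _ _ (i = 0) hi, sum_lc_mul _ _ (j = 0) hj,
    hX.fr3_nabla2_shear hL hx hB hθ, curlShearComp]
  ring

end IsFrameField

/-- The equations are tensorial, so any adapted frame field at x may be used. The Schouten tensor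
serves as P, and the scalars are evaluated by `vorticity_curl_identity`. -/
theorem IsRegularOn.magnetic_identity (hL : L.IsRegularOn U) {x : E4} (hx : x ∈ U)
    (hE : ∀ y ∈ U, L.electric y = 0) (hC : ∀ y ∈ U, cotton L.g y = 0) :
    (1 / 4 : ℝ) * traceSq L.g x (L.magnetic x) = L.magVorticity x ∧
      L.magVorticity x = (1 / 3 : ℝ) * L.magCurlShear x := by
  obtain ⟨e, he⟩ := hL.exists_isAdapted hx
  obtain ⟨X, -, hX⟩ := hL.exists_isFrameField hx he
  have hg := hL.isMetricOn
  have hB := hX.hasDir_fr2 hL hx (T := nabla1 L.g L.uLow) fun a b =>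
    differentiableAt_of_contDiffOn hL.isOpen (hL.smooth_nabla1 hL.smooth_uLow a b) hx
  have hθ (m : Fin 4) := HasDir.of_differentiableAt
    (differentiableAt_of_contDiffOn hL.isOpen hL.smooth_expansion hx) (X x m)
  obtain ⟨h0, hs, htr, hw⟩ := hX.isAdapted.magneticComp_weyl hL hx (hE x hx)
  have hZ := (hX.weyl_divergence_and_strain hL hx hE (hC x hx)).2
  have hstar := hX.weylStrain_divergence hL hx hE hC hB
  rw [hX.isAdapted.traceSq_magnetic hL hx (hE x hx), hX.magVorticity_eq hL hx hB (hE x hx),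
    hX.magCurlShear_eq hL hx hB (hE x hx) hθ]
  generalize magneticComp (fr4 (X x) (weyl L.g x)) = M at *
  rw [hw] at hZ
  simp only [hw] at hstar
  have h := vorticity_curl_identity (P := fr2 (X x) (schouten L.g x)) (θ := L.expansion x)
    (dθ := fun m => ∑ c, X x m c * pd c L.expansion x) (hX.conn_antisymm hL hx)
    (hX.fr2_nabla1_uLow hL hx) h0 hs htr (fun m k l => rfl) (fun k i j => ?_) hZ hstar
  · obtain ⟨h1, h2⟩ := h
    constructor <;> linarith
  -- The Ricci identity involves the full curvature, here split into its Weyl part and the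
  -- Kulkarni–Nomizu product with P.
  · have h1 : riemann L.g x = fun a b c d => weyl L.g x a b c d + kn L.g (schouten L.g) x a b c d := by
      ext a b c d
      rw [IsMetricOn.weyl_eq]
      ring
    rw [hX.ricci_identity hL hx, h1, fr4_add, hw, fr4_kn]
    simp only [hX.isAdapted.isFrame _ _]

end LocalData

/-! ### From the manifold to charts. -/

section Multilinear

variable {V : Type*} [AddCommGroup V] [Module ℝ V]

theorem AlternatingMap.map_fin_four_swap₁ (f : V [⋀^Fin 4]→ₗ[ℝ] ℝ) (a b c d : V) :
    f ![b, a, c, d] = -f ![a, b, c, d] := by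
  rw [← f.map_swap ![a, b, c, d] (i := 0) (j := 1) (by decide)]
  congr 1
  ext i
  fin_cases i <;> rfl

theorem AlternatingMap.map_fin_four_swap₂ (f : V [⋀^Fin 4]→ₗ[ℝ] ℝ) (a b c d : V) :
    f ![a, c, b, d] = -f ![a, b, c, d] := by
  rw [← f.map_swap ![a, b, c, d] (i := 1) (j := 2) (by decide)]
  congr 1
  ext i
  fin_cases i <;> rfl

theorem AlternatingMap.map_fin_four_swap₃ (f : V [⋀^Fin 4]→ₗ[ℝ] ℝ) (a b c d : V) :
    f ![a, b, d, c] = -f ![a, b, c, d] := by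
  rw [← f.map_swap ![a, b, c, d] (i := 2) (j := 3) (by decide)]
  congr 1
  ext i
  fin_cases i <;> rfl

theorem AlternatingMap.map_fin_four_sum_last (f : V [⋀^Fin 4]→ₗ[ℝ] ℝ) (r : Fin 4 → ℝ)
    (w : Fin 4 → V) (a b c : V) :
    f ![a, b, c, ∑ i, r i • w i] = ∑ i, r i * f ![a, b, c, w i] := by
  have h (v : V) : f ![a, b, c, v] = f.toMultilinearMap.toLinearMap ![a, b, c, 0] 3 v := by
    rw [MultilinearMap.toLinearMap_apply]
    refine congrArg f ?_
    ext i
    fin_cases i <;> rfl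
  simp only [h, map_sum, map_smul, smul_eq_mul]

theorem AlternatingMap.map_fin_four_sum (f : V [⋀^Fin 4]→ₗ[ℝ] ℝ) (e : Fin 4 → Fin 4 → ℝ)
    (w : Fin 4 → V) (i j k l : Fin 4) :
    f ![∑ a, e i a • w a, ∑ a, e j a • w a, ∑ a, e k a • w a, ∑ a, e l a • w a] =
      Coord.fr4 e (fun a b c d => f ![w a, w b, w c, w d]) i j k l := by
  have h3 (r : Fin 4 → ℝ) (a b c : V) :
      f ![a, b, ∑ i, r i • w i, c] = ∑ i, r i * f ![a, b, w i, c] := by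
    rw [f.map_fin_four_swap₃, f.map_fin_four_sum_last, ← Finset.sum_neg_distrib]
    exact Finset.sum_congr rfl fun i _ => by rw [f.map_fin_four_swap₃]; ring
  have h2 (r : Fin 4 → ℝ) (a b c : V) :
      f ![a, ∑ i, r i • w i, b, c] = ∑ i, r i * f ![a, w i, b, c] := by
    rw [f.map_fin_four_swap₂, h3, ← Finset.sum_neg_distrib]
    exact Finset.sum_congr rfl fun i _ => by rw [f.map_fin_four_swap₂]; ring
  have h1 (r : Fin 4 → ℝ) (a b c : V) :
      f ![∑ i, r i • w i, a, b, c] = ∑ i, r i * f ![w i, a, b, c] := by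
    rw [f.map_fin_four_swap₁, h2, ← Finset.sum_neg_distrib]
    exact Finset.sum_congr rfl fun i _ => by rw [f.map_fin_four_swap₁]; ring
  simp only [h1, h2, h3, f.map_fin_four_sum_last, Coord.fr4, Coord.fr3, Coord.fr2, Coord.fr1]

end Multilinear

section Charts

variable {M : Type*} [TopologicalSpace M] [ChartedSpace E4 M] [IsManifold (𝓡 4) ∞ M]
  {e : OpenPartialHomeomorph M E4} (he : e ∈ IsManifold.maximalAtlas (𝓡 4) ∞ M)

include he

omit [IsManifold (𝓡 4) ∞ M] in
theorem mdifferentiable_of_mem_maximalAtlas : e.MDifferentiable (𝓡 4) (𝓡 4) :=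
  ⟨(contMDiffOn_of_mem_maximalAtlas he).mdifferentiableOn (by simp),
    (contMDiffOn_symm_of_mem_maximalAtlas he).mdifferentiableOn (by simp)⟩

/-- The coordinate field is the tangent map of the inverse chart applied to a constant field. -/
theorem contMDiffOn_coordVec (i : Fin 4) :
    ContMDiffOn (𝓡 4) (𝓡 4).tangent ∞
      (fun x => (⟨e.symm x, coordVec e x i⟩ : TangentBundle (𝓡 4) M)) e.target := by
  have h1 : IsManifold (𝓡 4) 1 M := .of_le (n := ∞) (by simp)
  have h := (contMDiffOn_symm_of_mem_maximalAtlas he).contMDiffOn_tangentMapWithin (m := ∞)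
    (by simp) e.open_target.uniqueMDiffOn
  have hc : ContMDiffOn (𝓡 4) (𝓡 4).tangent ∞
      (fun x => (⟨x, (EuclideanSpace.single i (1 : ℝ) : E4)⟩ : TangentBundle (𝓡 4) E4)) e.target :=
    contMDiffOn_vectorSpace_iff_contDiffOn.2 contDiffOn_const
  refine (h.comp hc fun x hx => hx).congr fun x hx => ?_
  exact (tangentMapWithin_eq_tangentMap (p := (⟨x, (EuclideanSpace.single i (1 : ℝ) : E4)⟩ :
    TangentBundle (𝓡 4) E4)) (e.open_target.uniqueMDiffOn x hx)
    ((mdifferentiable_of_mem_maximalAtlas he).mdifferentiableAt_symm hx)).symm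

theorem contDiffOn_mfderiv_section {u : ∀ p : M, TangentSpace (𝓡 4) p}
    (hu : ContMDiff (𝓡 4) (𝓡 4).tangent ∞ (fun p => (⟨p, u p⟩ : TangentBundle (𝓡 4) M))) :
    ContDiffOn ℝ ∞ (fun x => (mfderiv (𝓡 4) (𝓡 4) e (e.symm x) (u (e.symm x)) : E4)) e.target := by
  have h1 : IsManifold (𝓡 4) 1 M := .of_le (n := ∞) (by simp)
  have h := (contMDiffOn_of_mem_maximalAtlas he).contMDiffOn_tangentMapWithin (m := ∞)
    (by simp) e.open_source.uniqueMDiffOn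
  have h2 := h.comp (hu.comp_contMDiffOn (contMDiffOn_symm_of_mem_maximalAtlas he))
    fun x hx => e.map_target hx
  have h3 := (contMDiff_snd_tangentBundle_modelSpace E4 𝓘(ℝ, E4)).comp_contMDiffOn (h2.of_le le_rfl)
  refine (contMDiffOn_iff_contDiffOn.1 h3).congr fun x hx => ?_
  have h4 := tangentMapWithin_eq_tangentMap (I := 𝓡 4) (I' := 𝓡 4) (f := e)
    (p := (⟨e.symm x, u (e.symm x)⟩ : TangentBundle (𝓡 4) M))
    (e.open_source.uniqueMDiffOn _ (e.map_target hx))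
    ((mdifferentiable_of_mem_maximalAtlas he).mdifferentiableAt (e.map_target hx))
  exact (congrArg (fun q : TangentBundle (𝓡 4) E4 => (q.2 : E4)) h4).symm

omit he [IsManifold (𝓡 4) ∞ M] in
theorem sum_smul_coordVec (x : E4) (w : E4) :
    ∑ i, w i • coordVec e x i = mfderiv (𝓡 4) (𝓡 4) e.symm x w := by
  let F : E4 →L[ℝ] TangentSpace (𝓡 4) (e.symm x) := mfderiv (𝓡 4) (𝓡 4) e.symm x
  have h : w = ∑ i, w i • (EuclideanSpace.single i (1 : ℝ) : E4) := by
    ext j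
    fin_cases j <;> simp [Fin.sum_univ_four]
  calc ∑ i, w i • coordVec e x i = ∑ i, F (w i • (EuclideanSpace.single i (1 : ℝ) : E4)) :=
        Finset.sum_congr rfl fun i _ => (map_smul F _ _).symm
    _ = F w := by rw [← map_sum F, ← h]

omit [IsManifold (𝓡 4) ∞ M] in
/-- Every tangent vector is the combination of the coordinate vectors given by its components. -/
theorem sum_smul_coordVec_mfderiv {x : E4} (hx : x ∈ e.target)
    (v : TangentSpace (𝓡 4) (e.symm x)) {w : E4}
    (hw : w = mfderiv (𝓡 4) (𝓡 4) e (e.symm x) v) : ∑ i, w i • coordVec e x i = v := by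
  have h := (mdifferentiable_of_mem_maximalAtlas he).symm_comp_deriv (e.map_target hx)
  rw [e.right_inv hx] at h
  rw [sum_smul_coordVec, hw]
  exact congrArg (fun F : TangentSpace (𝓡 4) (e.symm x) →L[ℝ] TangentSpace (𝓡 4) (e.symm x) =>
    F v) h

end Charts

namespace OrientedSpacetime

open Coord

variable {M : Type*} [TopologicalSpace M] [ChartedSpace E4 M] [IsManifold (𝓡 4) ∞ M]
  (S : OrientedSpacetime M) {e : OpenPartialHomeomorph M E4}

theorem pair_metricComp (x : E4) (v w : Fin 4 → ℝ) : pair (S.metricComp e x) v w =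
    S.g (e.symm x) (∑ i, v i • coordVec e x i) (∑ i, w i • coordVec e x i) := by
  have h : S.g (e.symm x) (∑ i, v i • coordVec e x i) =
      ∑ i, v i • S.g (e.symm x) (coordVec e x i) := by simp only [map_sum, map_smul]
  rw [h, sum_apply]
  refine Finset.sum_congr rfl fun a _ => ?_
  rw [smul_apply, smul_eq_mul, map_sum]
  simp only [map_smul, smul_eq_mul, metricComp]

/-- Smoothness of the volume form is assumed for one component only; every other is a constant
multiple of it, by the sign of a permutation or by 0. -/
theorem exists_volComp_eq (i j k l : Fin 4) :
    ∃ c : ℝ, ∀ x, S.volComp e x i j k l = c * S.vol (e.symm x) (coordVec e x) := by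
  have h (x : E4) : S.volComp e x i j k l = S.vol (e.symm x) (coordVec e x ∘ ![i, j, k, l]) := by
    refine congrArg (S.vol (e.symm x)) ?_
    ext a
    fin_cases a <;> rfl
  by_cases hr : Function.Injective ![i, j, k, l]
  · let σ : Equiv.Perm (Fin 4) := .ofBijective _ (Finite.injective_iff_bijective.1 hr)
    refine ⟨(Equiv.Perm.sign σ : ℤ), fun x => (h x).trans ?_⟩
    have := (S.vol (e.symm x)).map_perm (coordVec e x) σ
    rw [Units.smul_def, zsmul_eq_mul] at this
    exact this
  · refine ⟨0, fun x => (h x).trans ?_⟩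
    rw [zero_mul]
    exact (S.vol (e.symm x)).map_eq_zero_of_not_injective _ fun hi => hr hi.of_comp

variable (he : e ∈ IsManifold.maximalAtlas (𝓡 4) ∞ M)

include he

theorem contDiffOn_metricComp (i j : Fin 4) :
    ContDiffOn ℝ ∞ (fun x => S.metricComp e x i j) e.target := by
  have h1 : IsManifold (𝓡 4) 1 M := .of_le (n := ∞) (by simp)
  have h : ContMDiffOn (𝓡 4) ((𝓡 4).prod 𝓘(ℝ)) ∞ (fun x => Bundle.TotalSpace.mk' ℝ
      (E := Bundle.Trivial M ℝ) (e.symm x) (S.metricComp e x i j)) e.target := by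
    refine ContMDiffOn.clm_bundle_apply₂ (F₁ := E4) (F₂ := E4)
      (S.contMDiff.comp_contMDiffOn (contMDiffOn_symm_of_mem_maximalAtlas he))
      (contMDiffOn_coordVec he i) (contMDiffOn_coordVec he j)
  refine contMDiffOn_iff_contDiffOn.1 fun x hx => ?_
  have := h x hx
  simp only [Bundle.contMDiffWithinAt_totalSpace] at this
  exact this.2

theorem exists_isFrame_metricComp {x : E4} (hx : x ∈ e.target) :
    ∃ f, IsFrame (S.metricComp e x) f := by
  obtain ⟨b, hb⟩ := S.signature (e.symm x)
  let c (i : Fin 4) : E4 := mfderiv (𝓡 4) (𝓡 4) e (e.symm x) (b i)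
  refine ⟨fun i a => c i a, fun i j => ?_⟩
  have h := S.pair_metricComp (e := e) x (fun a => c i a) (fun a => c j a)
  rw [sum_smul_coordVec_mfderiv he hx (b i) rfl, sum_smul_coordVec_mfderiv he hx (b j) rfl, hb] at h
  exact h

end OrientedSpacetime

namespace Observer

open Coord

variable {M : Type*} [TopologicalSpace M] [ChartedSpace E4 M] [IsManifold (𝓡 4) ∞ M]
  {S : OrientedSpacetime M} (O : Observer S) {e : OpenPartialHomeomorph M E4}

/-- The only bridge between the two settings: the hypotheses of the local identity hold on the
target of every chart of the maximal atlas. -/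
theorem isRegularOn_inChart (he : e ∈ IsManifold.maximalAtlas (𝓡 4) ∞ M) :
    (O.inChart e).IsRegularOn e.target where
  isOpen := e.open_target
  smooth_g := S.contDiffOn_metricComp he
  smooth_u i := (EuclideanSpace.proj (𝕜 := ℝ) i).contDiff.comp_contDiffOn
    (contDiffOn_mfderiv_section he O.contMDiff)
  smooth_vol i j k l := by
    obtain ⟨c, hc⟩ := S.exists_volComp_eq (e := e) i j k l
    exact (contDiffOn_const.mul (S.vol_smooth e he)).congr fun x _ => hc x
  symm x _ i j := S.symm _ _ _
  exists_frame x hx := S.exists_isFrame_metricComp he hx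
  unit x hx := by
    have h := S.pair_metricComp (e := e) x (fun a => O.comp e x a) (fun a => O.comp e x a)
    rw [sum_smul_coordVec_mfderiv he hx (O.u (e.symm x)) (w := O.comp e x) rfl, O.unit] at h
    exact h
  vol_swap₁ x _ _ _ _ _ := (S.vol (e.symm x)).map_fin_four_swap₁ _ _ _ _
  vol_swap₂ x _ _ _ _ _ := (S.vol (e.symm x)).map_fin_four_swap₂ _ _ _ _
  vol_swap₃ x _ _ _ _ _ := (S.vol (e.symm x)).map_fin_four_swap₃ _ _ _ _
  vol_sq x hx f hf := by
    let v (i : Fin 4) : TangentSpace (𝓡 4) (e.symm x) := ∑ a, f i a • coordVec e x a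
    have h := (S.vol (e.symm x)).map_fin_four_sum f (coordVec e x) 0 1 2 3
    have h1 : fr4 f ((O.inChart e).vol x) 0 1 2 3 = S.vol (e.symm x) v := by
      refine h.symm.trans (congrArg (S.vol (e.symm x)) ?_)
      ext i
      fin_cases i <;> rfl
    -- The Gram matrix of an orthonormal frame is diag(-1,1,1,1), with determinant -1, so the volume
    -- form squares to 1 on it.
    have h2 : (Matrix.of fun i j => S.g (e.symm x) (v i) (v j)) = Matrix.diagonal sg := by
      ext i j
      rw [Matrix.of_apply, ← S.pair_metricComp x (f i) (f j), Matrix.diagonal_apply]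
      exact hf i j
    rw [h1, S.vol_sq, h2, Matrix.det_diagonal]
    simp [sg]

end Observer

/-! ### Fields vanishing on an open set; vacuum has zero Cotton tensor. -/

namespace Coord

variable {g : E4 → Fin 4 → Fin 4 → ℝ} {U : Set E4} {x : E4}

theorem pd_eq_zero (hU : IsOpen U) (hx : x ∈ U) {f : E4 → ℝ} (hf : ∀ y ∈ U, f y = 0) (i : Fin 4) :
    pd i f x = 0 := by
  have h : f =ᶠ[nhds x] fun _ => 0 := by
    filter_upwards [hU.mem_nhds hx] with y hy using hf y hy
  simp [pd, h.fderiv_eq]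

theorem nabla1_eq_zero (hU : IsOpen U) (hx : x ∈ U) {v : E4 → Fin 4 → ℝ} (hv : ∀ y ∈ U, v y = 0)
    (a b : Fin 4) : nabla1 g v x a b = 0 := by
  simp [nabla1, hv x hx, pd_eq_zero hU hx (f := fun y => v y b) fun y hy => by simp [hv y hy]]

theorem nabla2_eq_zero (hU : IsOpen U) (hx : x ∈ U) {T : E4 → Fin 4 → Fin 4 → ℝ}
    (hT : ∀ y ∈ U, T y = 0) (c a b : Fin 4) : nabla2 g T x c a b = 0 := by
  simp [nabla2, hT x hx, pd_eq_zero hU hx (f := fun y => T y a b) fun y hy => by simp [hT y hy]]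

end Coord

namespace LocalData

open Coord

variable {L : LocalData} {x : E4}

theorem curl_eq_zero {U : Set E4} (hU : IsOpen U) (hx : x ∈ U) {S : E4 → Fin 4 → Fin 4 → ℝ}
    (hS : ∀ y ∈ U, S y = 0) : L.curl S x = 0 := by
  have h (c a b : Fin 4) : nabla2 L.g S x c a b = 0 := nabla2_eq_zero hU hx hS c a b
  ext a b
  simp [curl, D2, h]

theorem vorticityTensor_eq_zero {U : Set E4} (hU : IsOpen U) (hx : x ∈ U)
    (hω : ∀ y ∈ U, L.vorticity y = 0) : L.vorticityTensor x = 0 := by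
  have h (a b : Fin 4) : nabla1 L.g L.vorticity x a b = 0 := nabla1_eq_zero hU hx hω a b
  ext a b
  simp [vorticityTensor, D1, h, hω x hx]

end LocalData

namespace OrientedSpacetime

variable {M : Type*} [TopologicalSpace M] [ChartedSpace E4 M] [IsManifold (𝓡 4) ∞ M]

theorem IsVacuum.cottonVanishes {S : OrientedSpacetime M} (h : S.IsVacuum) : S.CottonVanishes := by
  intro e he x hx
  have hP : ∀ y ∈ e.target, Coord.schouten (S.metricComp e) y = 0 := fun y hy => by
    have hr := h e he y hy
    ext a b
    simp [Coord.schouten, Coord.scalar, hr]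
  ext a b c
  simp [Coord.cotton, Coord.nabla2_eq_zero e.open_target hx hP]

end OrientedSpacetime
end

theorem theorem1 {M : Type*} [TopologicalSpace M] [ChartedSpace E4 M] [IsManifold (𝓡 4) ∞ M]
    (S : OrientedSpacetime M) (O : Observer S) (hE : O.ElectricVanishes) :
    (S.CottonVanishes →
      (∀ e ∈ IsManifold.maximalAtlas (𝓡 4) ∞ M, ∀ x ∈ e.target,
        (1 / 4 : ℝ) * Coord.traceSq (S.metricComp e) x ((O.inChart e).magnetic x)
            = (O.inChart e).magVorticity x ∧
          (O.inChart e).magVorticity x = (1 / 3 : ℝ) * (O.inChart e).magCurlShear x) ∧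
      (∀ e ∈ IsManifold.maximalAtlas (𝓡 4) ∞ M, ∀ x ∈ e.target,
        (O.inChart e).magnetic x ≠ 0 →
          0 < (O.inChart e).magCurlShear x ∧ 0 < (O.inChart e).magVorticity x) ∧
      (O.ShearFree → O.MagneticVanishes) ∧
      (O.VorticityFree → O.MagneticVanishes)) ∧
    (S.IsVacuum →
      ¬ ∃ e ∈ IsManifold.maximalAtlas (𝓡 4) ∞ M, ∃ x ∈ e.target,
        (O.inChart e).magnetic x ≠ 0 ∧
          ((O.inChart e).magCurlShear x ≤ 0 ∨ (O.inChart e).magVorticity x ≤ 0)) := by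
  have hid (hC : S.CottonVanishes) : ∀ e ∈ IsManifold.maximalAtlas (𝓡 4) ∞ M, ∀ x ∈ e.target,
      (1 / 4 : ℝ) * Coord.traceSq (S.metricComp e) x ((O.inChart e).magnetic x)
          = (O.inChart e).magVorticity x ∧
        (O.inChart e).magVorticity x = (1 / 3 : ℝ) * (O.inChart e).magCurlShear x :=
    fun e he x hx => (O.isRegularOn_inChart he).magnetic_identity hx (hE e he) (hC e he)
  have hpos (hC : S.CottonVanishes) : ∀ e ∈ IsManifold.maximalAtlas (𝓡 4) ∞ M, ∀ x ∈ e.target,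
      (O.inChart e).magnetic x ≠ 0 →
        0 < (O.inChart e).magCurlShear x ∧ 0 < (O.inChart e).magVorticity x := by
    intro e he x hx hH
    have hL := O.isRegularOn_inChart he
    obtain ⟨f, hf⟩ := hL.exists_isAdapted hx
    have h : 0 < Coord.traceSq (S.metricComp e) x ((O.inChart e).magnetic x) :=
      hf.traceSq_magnetic_pos hL hx (hE e he x hx) hH
    obtain ⟨h1, h2⟩ := hid hC e he x hx
    constructor <;> linarith
  refine ⟨fun hC => ⟨hid hC, hpos hC, fun hσ e he x hx => ?_, fun hω e he x hx => ?_⟩, ?_⟩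
  · by_contra hH
    -- If H were nonzero, this scalar would be positive; but it is linear in the curl of a shear
    -- that vanishes on the whole chart.
    have h := (hpos hC e he x hx hH).1
    rw [LocalData.magCurlShear, LocalData.curl_eq_zero e.open_target hx (hσ e he)] at h
    simp [Coord.inner2] at h
  · by_contra hH
    have h := (hpos hC e he x hx hH).2
    rw [LocalData.magVorticity, LocalData.vorticityTensor_eq_zero e.open_target hx (hω e he)] at h
    simp [Coord.inner2] at h
  · rintro hV ⟨e, he, x, hx, hH, h⟩
    obtain ⟨h1, h2⟩ := hpos hV.cottonVanishes e he x hx hH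
    rcases h with h | h <;> linarith
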